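/- Let $\Gamma$ be a countable discrete abelian group, $B\neq 0$ a unital $C^*$-algebra and $\beta:\Gamma\to\mathrm{Aut}(B)$ an action. Let $A\subset\ell^\infty(\Gamma,B)$ be a $C^*$-subalgebra that is invariant under the translations $[\alpha_g(f)](x)=\beta_g(f(g^{-1}x))$, contains $C_0(\Gamma,B)$, and whose functions together take all values in $B$. Assume that $A\cong C_0(\Omega,B)$, i.e. there is a locally compact Hausdorff space $\Omega$ with a $\Gamma$-action by homeomorphisms, containing $\Gamma$ equivariantly as a dense, open, discrete subset, such that $A$ consists exactly of the restrictions to $\Gamma$ of the functions in $C_0(\Omega,B)$. Put $\partial\Omega=\Omega\setminus\Gamma$ and assume $\partial\Omega\neq\emptyset$. Let $\ell^2(\Gamma,B)=\{\psi:\Gamma\to B \mid \sum_x\psi(x)^*\psi(x)\text{ converges in }B\}$ be the standard right Hilbert $B$-module, $\mathrm{End}_B(\ell^2(\Gamma,B))$ its algebra of adjointable operators and $\mathbb K_B(\ell^2(\Gamma,B))$ the closed ideal of compact operators. Let $A$ and $\Gamma$ act on $\ell^2(\Gamma,B)$ by the covariant representation $(f\psi)(x)=\beta_x^{-1}(f(x))\psi(x)$,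 $(S_g\psi)(x)=\psi(g^{-1}x)$, and let $A\rtimes\Gamma\subset\mathrm{End}_B(\ell^2(\Gamma,B))$ be the closure of the set of finite sums $\sum_g S_gf_g$, $f_g\in A$. For $T\in\mathrm{End}_B(\ell^2(\Gamma,B))$ the $B$-essential spectrum $\sigma^B_{\mathrm{ess}}(T)$ is the spectrum of the class of $T$ in $\mathrm{End}_B(\ell^2(\Gamma,B))/\mathbb K_B(\ell^2(\Gamma,B))$. For $\omega\in\partial\Omega$ let $\Xi_\omega=\overline{\Gamma\cdot\omega}$ be its quasi-orbit. Let $(\omega_j)_{j\in J}$ be a family in $\partial\Omega$ with $\partial\Omega=\bigcup_{j\in J}\Xi_j$, $\Xi_j:=\Xi_{\omega_j}$. Let $C_0(\Xi_j,B)\rtimes\Gamma$ be the crossed product for the action $(g\cdot h)(\xi)=\beta_g(h(g^{-1}\xi))$. For every $j$ there is exactly one continuous $*$-homomorphism $q_j:A\rtimes\Gamma\to C_0(\Xi_j,B)\rtimes\Gamma$ with $q_j(S_gf)=S_g\,f|_{\Xi_j}$ for all $g\in\Gamma$, $f\in A\cong C_0(\Omega,B)$, and for every $T\in A\rtimes\Gamma$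 $$\sigma^B_{\mathrm{ess}}(T)=\overline{\bigcup_{j\in J}\sigma\big(q_j(T)\big)}\subset\mathbb C .$$ Here, if $A$ is unital, $\sigma(q_j(T))$ is the spectrum in the unital $C^*$-algebra $C(\Xi_j,B)\rtimes\Gamma$; if $A$ is not unital, $\sigma(q_j(T))$ is the spectrum in $(C_0(\Xi_j,B)\rtimes\Gamma)^\sim$, the algebra obtained by adjoining a unit (also when $C_0(\Xi_j,B)\rtimes\Gamma$ already has one). -/

import Mathlib

open Filter Topology
open scoped ENNReal ZeroAtInfty

namespace Interface

section HilbertModule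

variable (Γ D : Type*) [NonUnitalCStarAlgebra D]

theorem summable_of_nonneg_of_le {Γ D : Type*} [NonUnitalCStarAlgebra D] [PartialOrder D]
    [StarOrderedRing D] {a b : Γ → D} (ha : ∀ x, 0 ≤ a x) (hab : ∀ x, a x ≤ b x)
    (hb : Summable b) : Summable a := by
  rw [summable_iff_vanishing_norm] at hb ⊢
  intro ε hε
  obtain ⟨s, hs⟩ := hb ε hε
  exact ⟨s, fun t ht => lt_of_le_of_lt (CStarAlgebra.norm_le_norm_of_nonneg_of_le
    (Finset.sum_nonneg fun x _ => ha x) (Finset.sum_le_sum fun x _ => hab x)) (hs t ht)⟩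

/-- The functions `ψ : Γ → D` for which `∑ₓ ψ(x)* ψ(x)` converges (unconditionally, in norm)
in the C⋆-algebra `D`. -/
def l2Submodule : Submodule ℂ (Γ → D) where
  carrier := {ψ | Summable fun x => star (ψ x) * ψ x}
  zero_mem' := by simp [summable_zero]
  add_mem' := by
    intro ψ φ hψ hφ
    let _ := CStarAlgebra.spectralOrder D
    let _ := CStarAlgebra.spectralOrderedRing D
    refine summable_of_nonneg_of_le (fun x => star_mul_self_nonneg _) (fun x => ?_)
      ((hψ.add hφ).const_smul (2 : ℂ))
    have h : 0 ≤ star (ψ x - φ x) * (ψ x - φ x) := star_mul_self_nonneg _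
    have e : (2 : ℂ) • (star (ψ x) * ψ x + star (φ x) * φ x)
        - star ((ψ + φ) x) * (ψ + φ) x = star (ψ x - φ x) * (ψ x - φ x) := by
      simp only [two_smul, Pi.add_apply, star_add, star_sub, mul_add, add_mul, mul_sub, sub_mul]
      abel
    exact sub_nonneg.1 (e ▸ h)
  smul_mem' := by
    intro c ψ hψ
    have := Summable.const_smul (star c * c) hψ
    refine this.congr fun x => ?_
    simp only [Pi.smul_apply, star_smul, smul_mul_assoc, mul_smul_comm, smul_smul,
      mul_comm (star c) c]

/-- The standard Hilbert C⋆-module `ℓ²(Γ, D)` over the C⋆-algebra `D`. -/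
def L2 : Type _ := l2Submodule Γ D

noncomputable instance : AddCommGroup (L2 Γ D) := inferInstanceAs (AddCommGroup (l2Submodule Γ D))
noncomputable instance : Module ℂ (L2 Γ D) := inferInstanceAs (Module ℂ (l2Submodule Γ D))

namespace L2

variable {Γ D}

instance : CoeFun (L2 Γ D) fun _ => Γ → D := ⟨fun ψ => ψ.1⟩

/-- The element of `ℓ²(Γ, D)` given by a square-summable function. -/
def mk (f : Γ → D) (h : Summable fun x => star (f x) * f x) : L2 Γ D := ⟨f, h⟩

theorem summable_self (ψ : L2 Γ D) : Summable fun x => star (ψ x) * ψ x := ψ.2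

@[ext] theorem ext {ψ φ : L2 Γ D} (h : ∀ x, ψ x = φ x) : ψ = φ := Subtype.ext (funext h)

@[simp] theorem add_apply (ψ φ : L2 Γ D) (x : Γ) : (ψ + φ) x = ψ x + φ x := rfl
@[simp] theorem sub_apply (ψ φ : L2 Γ D) (x : Γ) : (ψ - φ) x = ψ x - φ x := rfl
@[simp] theorem zero_apply (x : Γ) : (0 : L2 Γ D) x = 0 := rfl
@[simp] theorem smul_apply (c : ℂ) (ψ : L2 Γ D) (x : Γ) : (c • ψ) x = c • ψ x := rfl

theorem summable_ip (ψ φ : L2 Γ D) : Summable fun x => star (ψ x) * φ x := by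
  have h1 := (ψ + φ).summable_self
  have h2 := (ψ + Complex.I • φ).summable_self
  have h3 := ψ.summable_self
  have h4 := φ.summable_self
  have key := ((h1.sub (h3.add h4)).sub
    ((h2.sub (h3.add h4)).const_smul Complex.I)).const_smul (1 / 2 : ℂ)
  refine key.congr fun x => ?_
  have hI : Complex.I * Complex.I = -1 := Complex.I_mul_I
  simp only [add_apply, smul_apply, star_add, star_smul, mul_add, add_mul, smul_mul_assoc,
    mul_smul_comm, smul_sub, smul_add, smul_smul, Complex.star_def, Complex.conj_I,
    neg_mul, hI, neg_neg, neg_smul, one_smul]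
  match_scalars <;> first
    | ring1
    | linear_combination (1 / 2) * hI

/-- The `D`-valued inner product `(ψ | φ) = ∑ₓ ψ(x)* φ(x)`. -/
noncomputable def ip (ψ φ : L2 Γ D) : D := ∑' x, star (ψ x) * φ x

theorem hasSum_ip (ψ φ : L2 Γ D) : HasSum (fun x => star (ψ x) * φ x) (ip ψ φ) :=
  (summable_ip ψ φ).hasSum

theorem ip_add_right (ψ φ χ : L2 Γ D) : ip ψ (φ + χ) = ip ψ φ + ip ψ χ :=
  ((hasSum_ip ψ (φ + χ)).unique (by
    simpa [mul_add] using (hasSum_ip ψ φ).add (hasSum_ip ψ χ)))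

theorem ip_smul_right (c : ℂ) (ψ φ : L2 Γ D) : ip ψ (c • φ) = c • ip ψ φ :=
  ((hasSum_ip ψ (c • φ)).unique (by
    simpa only [smul_apply, mul_smul_comm] using (hasSum_ip ψ φ).const_smul c))

theorem star_ip (ψ φ : L2 Γ D) : star (ip ψ φ) = ip φ ψ :=
  ((hasSum_ip φ ψ).unique (by simpa using (hasSum_ip ψ φ).star)).symm

theorem ip_add_left (ψ φ χ : L2 Γ D) : ip (ψ + φ) χ = ip ψ χ + ip φ χ := by
  rw [← star_ip, ip_add_right, star_add, star_ip, star_ip]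

theorem ip_smul_left (c : ℂ) (ψ φ : L2 Γ D) : ip (c • ψ) φ = star c • ip ψ φ := by
  rw [← star_ip, ip_smul_right, star_smul, star_ip]

theorem ip_self_nonneg [PartialOrder D] [StarOrderedRing D] (ψ : L2 Γ D) : 0 ≤ ip ψ ψ :=
  tsum_nonneg fun _ => star_mul_self_nonneg _

theorem ip_self_eq_zero (ψ : L2 Γ D) : ip ψ ψ = 0 ↔ ψ = 0 := by
  constructor
  · intro h
    let _ := CStarAlgebra.spectralOrder D
    let _ := CStarAlgebra.spectralOrderedRing D
    ext x
    have h1 : star (ψ x) * ψ x ≤ ip ψ ψ :=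
      ψ.summable_self.le_tsum x fun _ _ => star_mul_self_nonneg _
    rw [h] at h1
    exact CStarRing.star_mul_self_eq_zero_iff _ |>.1 (le_antisymm h1 (star_mul_self_nonneg _))
  · rintro rfl
    simp [ip]

/-- The right action of `D`, `(ψ · b)(x) = ψ(x) b`. -/
noncomputable def rsmul (ψ : L2 Γ D) (b : D) : L2 Γ D :=
  mk (fun x => ψ x * b) <| by
    have := (ψ.summable_self.mul_right b).mul_left (star b)
    refine this.congr fun x => ?_
    simp [mul_assoc]

@[simp] theorem rsmul_apply (ψ : L2 Γ D) (b : D) (x : Γ) : (ψ.rsmul b) x = ψ x * b := rfl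

theorem ip_rsmul_right (ψ φ : L2 Γ D) (b : D) : ip ψ (φ.rsmul b) = ip ψ φ * b :=
  (hasSum_ip ψ (φ.rsmul b)).unique (by simpa [mul_assoc] using (hasSum_ip ψ φ).mul_right b)

theorem ip_rsmul_left (ψ φ : L2 Γ D) (b : D) : ip (ψ.rsmul b) φ = star b * ip ψ φ := by
  rw [← star_ip, ip_rsmul_right, star_mul, star_ip]

/-- The Hilbert-module norm `‖ψ‖ = ‖(ψ | ψ)‖^{1/2}`. -/
noncomputable instance : Norm (L2 Γ D) := ⟨fun ψ => √‖ip ψ ψ‖⟩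

theorem norm_def (ψ : L2 Γ D) : ‖ψ‖ = √‖ip ψ ψ‖ := rfl

theorem normCore : NormedSpace.Core ℂ (L2 Γ D) ∧ ∀ ψ φ : L2 Γ D, ‖ip ψ φ‖ ≤ ‖ψ‖ * ‖φ‖ := by
  let _ := CStarAlgebra.spectralOrder D
  let _ := CStarAlgebra.spectralOrderedRing D
  let _ : SMul Dᵐᵒᵖ (L2 Γ D) := ⟨fun b ψ => ψ.rsmul b.unop⟩
  let _ : CStarModule Dᵐᵒᵖ (L2 Γ D) :=
    { inner := fun ψ φ => MulOpposite.op (ip ψ φ)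
      inner_add_right := by intro x y z; simp [ip_add_right]
      inner_self_nonneg := by
        intro x
        exact MulOpposite.op_nonneg.2 (ip_self_nonneg x)
      inner_self := by intro x; simp [ip_self_eq_zero]
      inner_op_smul_right := by
        intro a x y
        apply MulOpposite.unop_injective
        exact ip_rsmul_right x y a.unop
      inner_smul_right_complex := by intro z x y; simp [ip_smul_right]
      star_inner := by
        intro x y
        apply MulOpposite.unop_injective
        exact star_ip x y
      norm_eq_sqrt_norm_inner_self := fun x => rfl }
  exact ⟨CStarModule.normedSpaceCore Dᵐᵒᵖ, fun ψ φ =>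
    CStarModule.norm_inner_le (A := Dᵐᵒᵖ) (L2 Γ D) (x := ψ) (y := φ)⟩

noncomputable instance : NormedAddCommGroup (L2 Γ D) := NormedAddCommGroup.ofCore normCore.1
noncomputable instance : NormedSpace ℂ (L2 Γ D) := NormedSpace.ofCore normCore.1

theorem norm_ip_le (ψ φ : L2 Γ D) : ‖ip ψ φ‖ ≤ ‖ψ‖ * ‖φ‖ := normCore.2 ψ φ

theorem norm_sq (ψ : L2 Γ D) : ‖ψ‖ ^ 2 = ‖ip ψ ψ‖ := Real.sq_sqrt (norm_nonneg _)

theorem eq_of_ip_eq {φ χ : L2 Γ D} (h : ∀ ψ, ip ψ φ = ip ψ χ) : φ = χ := by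
  rw [← sub_eq_zero, ← ip_self_eq_zero]
  have e : φ - χ = φ + (-1 : ℂ) • χ := by rw [neg_one_smul, sub_eq_add_neg]
  conv_lhs => rw [e, ip_add_right, ip_smul_right]
  rw [h]
  simp

theorem norm_rsmul_le (ψ : L2 Γ D) (b : D) : ‖ψ.rsmul b‖ ≤ ‖ψ‖ * ‖b‖ := by
  refine (sq_le_sq₀ (norm_nonneg _) (by positivity)).1 ?_
  rw [norm_sq, ip_rsmul_left, ip_rsmul_right, mul_pow, norm_sq]
  calc ‖star b * (ip ψ ψ * b)‖ ≤ ‖star b‖ * (‖ip ψ ψ‖ * ‖b‖) :=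
        (norm_mul_le _ _).trans (mul_le_mul_of_nonneg_left (norm_mul_le _ _) (norm_nonneg _))
    _ = ‖ip ψ ψ‖ * ‖b‖ ^ 2 := by rw [norm_star]; ring

end L2

/-- `T'` is an adjoint of `T` for the `D`-valued inner product. -/
def IsAdjoint {Γ D : Type*} [NonUnitalCStarAlgebra D] (T T' : L2 Γ D →L[ℂ] L2 Γ D) : Prop :=
  ∀ ψ φ, L2.ip (T ψ) φ = L2.ip ψ (T' φ)

namespace IsAdjoint

variable {Γ D}
variable {T T' S S' : L2 Γ D →L[ℂ] L2 Γ D}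

theorem symm (h : IsAdjoint T T') : IsAdjoint T' T := fun ψ φ => by
  rw [← L2.star_ip, ← h φ ψ, L2.star_ip]

theorem unique (h : IsAdjoint T T') (h' : IsAdjoint T S') : T' = S' :=
  ContinuousLinearMap.ext fun φ => L2.eq_of_ip_eq fun ψ => (h ψ φ).symm.trans (h' ψ φ)

theorem mul (h : IsAdjoint T T') (h' : IsAdjoint S S') : IsAdjoint (T * S) (S' * T') :=
  fun ψ φ => (h (S ψ) φ).trans (h' ψ (T' φ))

theorem add (h : IsAdjoint T T') (h' : IsAdjoint S S') : IsAdjoint (T + S) (T' + S') :=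
  fun ψ φ => by
    change L2.ip (T ψ + S ψ) φ = L2.ip ψ (T' φ + S' φ)
    rw [L2.ip_add_left, L2.ip_add_right, h ψ φ, h' ψ φ]

theorem smul (c : ℂ) (h : IsAdjoint T T') : IsAdjoint (c • T) (star c • T') := fun ψ φ => by
  change L2.ip (c • T ψ) φ = L2.ip ψ (star c • T' φ)
  rw [L2.ip_smul_left, L2.ip_smul_right, h ψ φ]

theorem one : IsAdjoint (1 : L2 Γ D →L[ℂ] L2 Γ D) 1 := fun _ _ => rfl

end IsAdjoint

/-- The adjointable operators on `ℓ²(Γ, D)` form a subalgebra of the bounded operators. -/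
def adjSubalgebra : Subalgebra ℂ (L2 Γ D →L[ℂ] L2 Γ D) where
  carrier := {T | ∃ T', IsAdjoint T T'}
  mul_mem' := fun ⟨_, h⟩ ⟨_, h'⟩ => ⟨_, h.mul h'⟩
  add_mem' := fun ⟨_, h⟩ ⟨_, h'⟩ => ⟨_, h.add h'⟩
  algebraMap_mem' := fun c => ⟨star c • 1, by
    rw [Algebra.algebraMap_eq_smul_one]; exact IsAdjoint.one.smul c⟩

/-- `End_D(ℓ²(Γ, D))`: the algebra of adjointable operators on the Hilbert module `ℓ²(Γ, D)`,
with the operator norm. (Adjointable operators are automatically right `D`-linear.) -/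
def AdjEnd : Type _ := adjSubalgebra Γ D

namespace AdjEnd

noncomputable instance : NormedRing (AdjEnd Γ D) := inferInstanceAs (NormedRing (adjSubalgebra Γ D))
noncomputable instance : NormedAlgebra ℂ (AdjEnd Γ D) :=
  inferInstanceAs (NormedAlgebra ℂ (adjSubalgebra Γ D))

variable {Γ D}

/-- The involution of `End_D(ℓ²(Γ, D))` is the adjoint. -/
noncomputable instance : Star (AdjEnd Γ D) :=
  ⟨fun T => ⟨T.2.choose, T.1, T.2.choose_spec.symm⟩⟩

theorem isAdjoint_star (T : AdjEnd Γ D) : IsAdjoint T.1 (star T).1 := T.2.choose_spec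

theorem star_eq {T S : AdjEnd Γ D} (h : IsAdjoint T.1 S.1) : star T = S :=
  Subtype.ext ((isAdjoint_star T).unique h)

noncomputable instance : StarRing (AdjEnd Γ D) where
  star_involutive T := star_eq (isAdjoint_star T).symm
  star_mul T S := star_eq ((isAdjoint_star T).mul (isAdjoint_star S))
  star_add T S := star_eq ((isAdjoint_star T).add (isAdjoint_star S))

instance : StarModule ℂ (AdjEnd Γ D) where
  star_smul c T := star_eq ((isAdjoint_star T).smul c)

theorem norm_apply_le (T : AdjEnd Γ D) (ψ : L2 Γ D) : ‖T.1 ψ‖ ≤ ‖T‖ * ‖ψ‖ := T.1.le_opNorm ψ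

instance : CStarRing (AdjEnd Γ D) where
  norm_mul_self_le T := by
    have h : ‖T‖ ≤ √‖star T * T‖ := T.1.opNorm_le_bound (Real.sqrt_nonneg _) fun ψ => by
      refine (sq_le_sq₀ (norm_nonneg _) (by positivity)).1 ?_
      rw [mul_pow, Real.sq_sqrt (norm_nonneg _), L2.norm_sq, isAdjoint_star T]
      calc ‖L2.ip ψ ((star T * T).1 ψ)‖ ≤ ‖ψ‖ * (‖star T * T‖ * ‖ψ‖) := (L2.norm_ip_le _ _).trans
            (mul_le_mul_of_nonneg_left (norm_apply_le _ _) (norm_nonneg _))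
        _ = ‖star T * T‖ * ‖ψ‖ ^ 2 := by ring
    calc ‖T‖ * ‖T‖ ≤ √‖star T * T‖ * √‖star T * T‖ := mul_self_le_mul_self (norm_nonneg _) h
      _ = ‖star T * T‖ := Real.mul_self_sqrt (norm_nonneg _)

instance : ContinuousStar (AdjEnd Γ D) := inferInstance

/-- The rank-one operator `Θ_{ψ,φ}(χ) = ψ · (φ | χ)`. -/
noncomputable def theta (ψ φ : L2 Γ D) : AdjEnd Γ D :=
  let θ : ∀ _ _ : L2 Γ D, L2 Γ D →L[ℂ] L2 Γ D := fun ψ φ => LinearMap.mkContinuous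
    { toFun := fun χ => ψ.rsmul (L2.ip φ χ)
      map_add' := fun χ η => by ext x; simp [L2.ip_add_right, mul_add]
      map_smul' := fun c χ => by
        ext x
        simp only [L2.ip_smul_right, L2.rsmul_apply, L2.smul_apply, mul_smul_comm,
          RingHom.id_apply] }
    (‖ψ‖ * ‖φ‖) fun χ => (L2.norm_rsmul_le _ _).trans <| by
      rw [mul_assoc]; exact mul_le_mul_of_nonneg_left (L2.norm_ip_le _ _) (norm_nonneg _)
  ⟨θ ψ φ, θ φ ψ, fun χ η => by
    change L2.ip (ψ.rsmul (L2.ip φ χ)) η = L2.ip χ (φ.rsmul (L2.ip ψ η))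
    rw [L2.ip_rsmul_left, L2.ip_rsmul_right, L2.star_ip]⟩

theorem theta_apply (ψ φ χ : L2 Γ D) : (theta ψ φ).1 χ = ψ.rsmul (L2.ip φ χ) := rfl

theorem apply_rsmul (T : AdjEnd Γ D) (ψ : L2 Γ D) (b : D) :
    T.1 (ψ.rsmul b) = (T.1 ψ).rsmul b := by
  refine L2.eq_of_ip_eq fun χ => ?_
  have h := (isAdjoint_star T).symm
  rw [← h, L2.ip_rsmul_right, L2.ip_rsmul_right, h]

theorem mul_theta (T : AdjEnd Γ D) (ψ φ : L2 Γ D) : T * theta ψ φ = theta (T.1 ψ) φ :=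
  Subtype.ext <| ContinuousLinearMap.ext fun χ => by
    change T.1 ((theta ψ φ).1 χ) = _
    rw [theta_apply, theta_apply, apply_rsmul]

theorem theta_mul (T : AdjEnd Γ D) (ψ φ : L2 Γ D) : theta ψ φ * T = theta ψ ((star T).1 φ) :=
  Subtype.ext <| ContinuousLinearMap.ext fun χ => by
    change (theta ψ φ).1 (T.1 χ) = _
    rw [theta_apply, theta_apply, (isAdjoint_star T).symm]

end AdjEnd

/-- The compact operators `𝕂_D(ℓ²(Γ, D))`: the norm closure in `End_D(ℓ²(Γ, D))` of the linear
span of the rank-one operators, as a (two-sided, see below) ideal. -/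
def compactIdeal : Ideal (AdjEnd Γ D) where
  carrier := closure (Submodule.span ℂ
    {T : AdjEnd Γ D | ∃ ψ φ, T = AdjEnd.theta ψ φ} : Set (AdjEnd Γ D))
  add_mem' := fun h h' => (Submodule.span ℂ
    {T : AdjEnd Γ D | ∃ ψ φ, T = AdjEnd.theta ψ φ}).topologicalClosure.add_mem h h'
  zero_mem' := subset_closure (Submodule.zero_mem _)
  smul_mem' := fun T S hS => by
    refine map_mem_closure (continuous_const_mul T) hS fun R hR => ?_
    refine Submodule.span_induction ?_ ?_ ?_ ?_ hR
    · rintro _ ⟨ψ, φ, rfl⟩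
      exact Submodule.subset_span ⟨_, _, AdjEnd.mul_theta T ψ φ⟩
    · simp
    · intro x y _ _ hx hy
      simpa only [smul_eq_mul, SetLike.mem_coe, mul_add] using Submodule.add_mem _ hx hy
    · intro c x _ hx
      simpa only [smul_eq_mul, SetLike.mem_coe, mul_smul_comm] using Submodule.smul_mem _ c hx

instance : (compactIdeal Γ D).IsTwoSided where
  mul_mem_of_left := fun {S} T hS => by
    refine map_mem_closure (f := fun R => R * T) (continuous_mul_const T) hS fun R hR => ?_
    refine Submodule.span_induction ?_ ?_ ?_ ?_ hR
    · rintro _ ⟨ψ, φ, rfl⟩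
      exact Submodule.subset_span ⟨_, _, AdjEnd.theta_mul T ψ φ⟩
    · simp
    · intro x y _ _ hx hy
      simpa only [smul_eq_mul, SetLike.mem_coe, add_mul] using Submodule.add_mem _ hx hy
    · intro c x _ hx
      simpa only [smul_eq_mul, SetLike.mem_coe, smul_mul_assoc] using Submodule.smul_mem _ c hx

/-- The generalised Calkin algebra `𝒬_D(ℓ²(Γ, D)) = End_D(ℓ²(Γ, D)) / 𝕂_D(ℓ²(Γ, D))`. -/
abbrev Calkin : Type _ := AdjEnd Γ D ⧸ compactIdeal Γ D

variable {Γ D}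

/-- The `D`-essential spectrum of an adjointable operator on `ℓ²(Γ, D)`: the spectrum of its
class in the generalised Calkin algebra. -/
def essentialSpectrum (T : AdjEnd Γ D) : Set ℂ :=
  spectrum ℂ (Ideal.Quotient.mk (compactIdeal Γ D) T : Calkin Γ D)

/-- Pointwise multiplication `(a ψ)(x) = a(x) ψ(x)` by a bounded function `a : Γ → D`. -/
noncomputable def mulOp (a : lp (fun _ : Γ => D) ∞) : AdjEnd Γ D :=
  let M : lp (fun _ : Γ => D) ∞ → (L2 Γ D →L[ℂ] L2 Γ D) := fun a =>
    have key : ∀ ψ : L2 Γ D, ∃ h : Summable fun x => star (a x * ψ x) * (a x * ψ x),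
        ‖L2.mk (fun x => a x * ψ x) h‖ ≤ ‖a‖ * ‖ψ‖ := by
      intro ψ
      let _ := CStarAlgebra.spectralOrder D
      let _ := CStarAlgebra.spectralOrderedRing D
      have hle : ∀ x, star (a x * ψ x) * (a x * ψ x) ≤
          ((‖a‖ ^ 2 : ℝ) : ℂ) • (star (ψ x) * ψ x) := by
        intro x
        have h1 : star (ψ x) * (star (a x) * a x) * ψ x ≤
            ‖star (a x) * a x‖ • (star (ψ x) * ψ x) :=
          CStarAlgebra.star_left_conjugate_le_norm_smul
        have h2 : ‖star (a x) * a x‖ • (star (ψ x) * ψ x) ≤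
            (‖a‖ ^ 2) • (star (ψ x) * ψ x) := by
          refine smul_le_smul_of_nonneg_right ?_ (star_mul_self_nonneg _)
          rw [CStarRing.norm_star_mul_self, ← sq]
          exact pow_le_pow_left₀ (norm_nonneg _) (lp.norm_apply_le_norm ENNReal.top_ne_zero a x) 2
        rw [Complex.coe_smul]
        refine le_trans (le_of_eq ?_) (h1.trans h2)
        simp only [star_mul, mul_assoc]
      have hs := summable_of_nonneg_of_le (fun x => star_mul_self_nonneg (a x * ψ x)) hle
        (ψ.summable_self.const_smul _)
      refine ⟨hs, (sq_le_sq₀ (norm_nonneg _) (by positivity)).1 ?_⟩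
      rw [mul_pow, L2.norm_sq, L2.norm_sq]
      have h3 := CStarAlgebra.norm_le_norm_of_nonneg_of_le
        (L2.ip_self_nonneg (L2.mk (fun x => a x * ψ x) hs))
        (hs.tsum_le_tsum hle (ψ.summable_self.const_smul _))
      refine h3.trans (le_of_eq ?_)
      rw [ψ.summable_self.tsum_const_smul, norm_smul]
      simp [L2.ip]
    LinearMap.mkContinuous
      { toFun := fun ψ => L2.mk (fun x => a x * ψ x) (key ψ).1
        map_add' := fun ψ φ => L2.ext fun x => mul_add (a x) (ψ x) (φ x)
        map_smul' := fun c ψ => L2.ext fun x => mul_smul_comm c (a x) (ψ x) }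
      ‖a‖ fun ψ => (key ψ).2
  ⟨M a, M (star a), fun ψ φ => tsum_congr fun x => by
    change star (a x * ψ x) * φ x = star (ψ x) * (star (a x) * φ x)
    rw [star_mul, mul_assoc]⟩

theorem mulOp_apply (a : lp (fun _ : Γ => D) ∞) (ψ : L2 Γ D) (x : Γ) :
    (mulOp a).1 ψ x = a x * ψ x := rfl

variable [CommGroup Γ]

/-- The lattice shift `(S_g ψ)(x) = ψ(g⁻¹ x)`. -/
noncomputable def shiftOp (g : Γ) : AdjEnd Γ D :=
  let S : Γ → (L2 Γ D →L[ℂ] L2 Γ D) := fun g => LinearMap.mkContinuous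
    { toFun := fun ψ => L2.mk (fun x => ψ (g⁻¹ * x))
        ((Equiv.mulLeft g⁻¹).summable_iff.2 ψ.summable_self)
      map_add' := fun _ _ => rfl
      map_smul' := fun _ _ => rfl }
    1 fun ψ => le_of_eq <| by
      rw [one_mul, L2.norm_def, L2.norm_def]
      congr 2
      exact (Equiv.mulLeft g⁻¹).tsum_eq fun x => star (ψ x) * ψ x
  ⟨S g, S g⁻¹, fun ψ φ => by
    refine ((Equiv.mulLeft g).tsum_eq _).symm.trans (tsum_congr fun x => ?_)
    change star (ψ (g⁻¹ * (g * x))) * φ (g * x) = star (ψ x) * φ (g⁻¹⁻¹ * x)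
    rw [inv_mul_cancel_left, inv_inv]⟩

theorem shiftOp_apply (g : Γ) (ψ : L2 Γ D) (x : Γ) :
    (shiftOp g).1 ψ x = ψ (g⁻¹ * x) := rfl

/-- The bounded function `x ↦ α_x⁻¹(f(x))`, for an action `α` of `Γ` on `D`. -/
noncomputable def untwist (α : Γ →* (D ≃⋆ₐ[ℂ] D)) (f : lp (fun _ : Γ => D) ∞) :
    lp (fun _ : Γ => D) ∞ :=
  ⟨fun x => α x⁻¹ (f x), memℓp_infty ⟨‖f‖, by
    rintro _ ⟨x, rfl⟩
    exact (NonUnitalStarAlgHom.norm_apply_le (α x⁻¹) (f x)).trans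
      (lp.norm_apply_le_norm ENNReal.top_ne_zero f x)⟩⟩

/-- The constant function `x ↦ d` on `Γ`. -/
noncomputable def constFun (Γ : Type*) {D : Type*} [NonUnitalCStarAlgebra D] (d : D) :
    lp (fun _ : Γ => D) ∞ :=
  ⟨fun _ => d, memℓp_infty ⟨‖d‖, by rintro _ ⟨x, rfl⟩; exact le_rfl⟩⟩

/-- The operator `S_g f` on `ℓ²(Γ, D)`, for `g ∈ Γ` and a bounded function `f : Γ → D`, in the
covariant representation `(f ψ)(x) = α_x⁻¹(f(x)) ψ(x)`, `(S_g ψ)(x) = ψ(g⁻¹ x)`. Here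
`S_g f S_g⁻¹` is the function `x ↦ α_g(f(g⁻¹ x))`. Conjugation by the isometric bijection
`(U ψ)(x) = α_x(ψ(x))` turns `f` into pointwise multiplication by `f` and `S_g` into
`ψ ↦ (x ↦ α_g(ψ(g⁻¹ x)))`; the latter are right `D`-linear only if `α` is trivial (and then
`U = 1`), whereas the operators used here are always adjointable. -/
noncomputable def monomialOp (α : Γ →* (D ≃⋆ₐ[ℂ] D)) (g : Γ) (f : lp (fun _ : Γ => D) ∞) :
    AdjEnd Γ D :=
  shiftOp g * mulOp (untwist α f)

/-- The C⋆-algebra generated by the operators `S_g f` with `g ∈ Γ`, `f ∈ F`. When `F` is a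
C⋆-algebra invariant under the translations `x ↦ α_g(f(g⁻¹ x))`, this is the closure of the set
of finite sums `∑ S_g f_g` with `f_g ∈ F`. -/
noncomputable def generatedBy (α : Γ →* (D ≃⋆ₐ[ℂ] D)) (F : Set (lp (fun _ : Γ => D) ∞)) :
    NonUnitalStarSubalgebra ℂ (AdjEnd Γ D) :=
  (NonUnitalStarAlgebra.adjoin ℂ
    {T | ∃ g : Γ, ∃ f ∈ F, T = monomialOp α g f}).topologicalClosure

/-- The (reduced) crossed product `D ⋊_α Γ` of a C⋆-algebra `D` by an action `α` of the discrete
abelian (hence amenable) group `Γ`, in its regular representation on `ℓ²(Γ, D)`: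
`(d ψ)(x) = α_x⁻¹(d) ψ(x)` and `(S_g ψ)(x) = ψ(g⁻¹ x)`. -/
noncomputable def crossedProduct (α : Γ →* (D ≃⋆ₐ[ℂ] D)) :
    NonUnitalStarSubalgebra ℂ (AdjEnd Γ D) :=
  generatedBy α (Set.range (constFun Γ))

/-- The spectrum of an element `a` of a C⋆-algebra `R` that has a unit (`R` being presented
without a distinguished unit): `μ` is a spectral value unless `μ e - a` has an inverse in `R`,
where `e` is the unit of `R`. -/
def unitalSpectrum {R : Type*} [NonUnitalRing R] [Module ℂ R] (a : R) : Set ℂ :=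
  {μ | ¬ ∃ e b : R, (∀ x, e * x = x ∧ x * e = x) ∧ (μ • e - a) * b = e ∧ b * (μ • e - a) = e}

end HilbertModule

section Functions

variable {Γ B Ω : Type*} [CommGroup Γ] [CStarAlgebra B]

/-- The automorphism `α_g` of `C₀(X, B)`, `(α_g f)(x) = β_g (f (g⁻¹ • x))`, of a `Γ`-space `X`. -/
def c0Translate {X : Type*} [TopologicalSpace X] [MulAction Γ X] [ContinuousConstSMul Γ X]
    (β : Γ →* (B ≃⋆ₐ[ℂ] B)) (g : Γ) (f : C₀(X, B)) : C₀(X, B) where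
  toFun x := β g (f (g⁻¹ • x))
  continuous_toFun :=
    (AddMonoidHomClass.continuous_of_bound (β g) 1 fun b => by
      simpa using NonUnitalStarAlgHom.norm_apply_le (β g) b).comp
      (f.continuous.comp (continuous_const_smul g⁻¹))
  zero_at_infty' := by
    have h1 : Tendsto (β g) (𝓝 0) (𝓝 0) := by
      have := (AddMonoidHomClass.continuous_of_bound (β g) 1 fun b => by
        simpa using NonUnitalStarAlgHom.norm_apply_le (β g) b).tendsto 0
      rwa [map_zero] at this
    exact h1.comp (f.zero_at_infty'.comp
      (Homeomorph.smul (α := X) g⁻¹).isClosedEmbedding.tendsto_cocompact)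

/-- The action `α` of `Γ` on `C₀(X, B)`, `(α_g f)(x) = β_g (f (g⁻¹ • x))`, of a `Γ`-space `X`. -/
def c0Action (X : Type*) [TopologicalSpace X] [MulAction Γ X] [ContinuousConstSMul Γ X]
    (β : Γ →* (B ≃⋆ₐ[ℂ] B)) : Γ →* (C₀(X, B) ≃⋆ₐ[ℂ] C₀(X, B)) where
  toFun g :=
    { toFun := c0Translate β g
      invFun := c0Translate β g⁻¹
      left_inv := fun f => by
        ext x
        change β g⁻¹ (β g (f (g⁻¹ • g⁻¹⁻¹ • x))) = f x
        rw [← StarAlgEquiv.mul_apply, ← map_mul]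
        simp
      right_inv := fun f => by
        ext x
        change β g (β g⁻¹ (f (g⁻¹⁻¹ • g⁻¹ • x))) = f x
        rw [← StarAlgEquiv.mul_apply, ← map_mul]
        simp
      map_mul' := fun f h => by ext x; exact map_mul (β g) _ _
      map_add' := fun f h => by ext x; exact map_add (β g) _ _
      map_star' := fun f => by ext x; exact map_star (β g) _
      map_smul' := fun c f => by ext x; exact map_smul (β g) c _ }
  map_one' := by
    ext f x
    change β 1 (f ((1 : Γ)⁻¹ • x)) = f x
    simp
  map_mul' g h := by
    ext f x
    change β (g * h) (f ((g * h)⁻¹ • x)) = β g (β h (f (h⁻¹ • g⁻¹ • x)))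
    rw [map_mul, StarAlgEquiv.mul_apply, smul_smul, mul_inv_rev]

theorem c0Action_apply {X : Type*} [TopologicalSpace X] [MulAction Γ X]
    [ContinuousConstSMul Γ X] (β : Γ →* (B ≃⋆ₐ[ℂ] B)) (g : Γ) (f : C₀(X, B)) (x : X) :
    c0Action X β g f x = β g (f (g⁻¹ • x)) := rfl

/-- The translation `[α_g(f)](x) = β_g(f(g⁻¹ x))` on `ℓ^∞(Γ, B)`. -/
noncomputable def translate (β : Γ →* (B ≃⋆ₐ[ℂ] B)) (g : Γ) (f : lp (fun _ : Γ => B) ∞) :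
    lp (fun _ : Γ => B) ∞ :=
  ⟨fun x => β g (f (g⁻¹ * x)), memℓp_infty ⟨‖f‖, by
    rintro _ ⟨x, rfl⟩
    exact (NonUnitalStarAlgHom.norm_apply_le (β g) _).trans
      (lp.norm_apply_le_norm ENNReal.top_ne_zero f _)⟩⟩

/-- The standing assumptions on the algebra `A ⊆ ℓ^∞(Γ, B)`: it is a C⋆-subalgebra (norm closed
⋆-subalgebra), invariant under translations, containing `C₀(Γ, B)`, whose functions take all
values in `B`. -/
structure IsInterfaceAlgebra (β : Γ →* (B ≃⋆ₐ[ℂ] B))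
    (A : NonUnitalStarSubalgebra ℂ (lp (fun _ : Γ => B) ∞)) : Prop where
  isClosed : IsClosed (A : Set (lp (fun _ : Γ => B) ∞))
  translate_mem : ∀ g : Γ, ∀ f ∈ A, translate β g f ∈ A
  c0_mem : ∀ f : lp (fun _ : Γ => B) ∞, Tendsto (fun x => f x) cofinite (𝓝 0) → f ∈ A
  range_eq : (⋃ f ∈ A, Set.range fun x => f x) = Set.univ

variable [TopologicalSpace Ω]

/-- The restriction to `Γ`, along `ι : Γ → Ω`, of a function in `C₀(Ω, B)`. -/
noncomputable def restrictGroup (ι : Γ → Ω) (F : C₀(Ω, B)) : lp (fun _ : Γ => B) ∞ :=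
  ⟨fun x => F (ι x), memℓp_infty ⟨‖F‖, by
    rintro _ ⟨x, rfl⟩
    exact F.toBCF.norm_coe_le_norm (ι x)⟩⟩

variable [MulAction Γ Ω]

/-- `A ≅ C₀(Ω, B)`: the `Γ`-space `Ω` contains `Γ` (through `ι`) equivariantly, as a dense open
discrete subset, and restriction to `Γ` identifies `C₀(Ω, B)` with `A ⊆ ℓ^∞(Γ, B)`. -/
structure IsModelSpace (A : NonUnitalStarSubalgebra ℂ (lp (fun _ : Γ => B) ∞)) (ι : Γ → Ω) :
    Prop where
  injective : Function.Injective ι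
  isOpen_singleton : ∀ x, IsOpen {ι x}
  denseRange : DenseRange ι
  equivariant : ∀ g x, ι (g * x) = g • ι x
  mem_iff : ∀ f, f ∈ A ↔ ∃ F : C₀(Ω, B), restrictGroup ι F = f

variable [ContinuousConstSMul Γ Ω]

/-- The quasi-orbit `Ξ_ω`: the closure of the orbit of `ω`, as a `Γ`-invariant set. -/
def quasiOrbit (Γ : Type*) {Ω : Type*} [CommGroup Γ] [TopologicalSpace Ω] [MulAction Γ Ω]
    [ContinuousConstSMul Γ Ω] (ω : Ω) : SubMulAction Γ Ω where
  carrier := closure (MulAction.orbit Γ ω)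
  smul_mem' g _ hx := smul_closure_orbit_subset g ω (Set.smul_mem_smul_set hx)

instance (ω : Ω) : ContinuousConstSMul Γ (quasiOrbit Γ ω) where
  continuous_const_smul g :=
    ((continuous_const_smul g).comp continuous_subtype_val).subtype_mk _

/-- The restriction `C₀(Ω, B) → C₀(Ξ_ω, B)`. -/
def restrictQuasiOrbit (ω : Ω) (F : C₀(Ω, B)) : C₀(quasiOrbit Γ ω, B) where
  toFun x := F x
  continuous_toFun := F.continuous.comp continuous_subtype_val
  zero_at_infty' := F.zero_at_infty'.comp
    (IsClosed.isClosedEmbedding_subtypeVal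
      (isClosed_closure (s := MulAction.orbit Γ ω))).tendsto_cocompact

/-- The crossed product `A ⋊ Γ ⊆ End_B(ℓ²(Γ, B))`, generated by the operators `S_g f`, `f ∈ A`. -/
noncomputable abbrev interfaceAlgebra (β : Γ →* (B ≃⋆ₐ[ℂ] B))
    (A : NonUnitalStarSubalgebra ℂ (lp (fun _ : Γ => B) ∞)) :
    NonUnitalStarSubalgebra ℂ (AdjEnd Γ B) :=
  generatedBy β (A : Set (lp (fun _ : Γ => B) ∞))

/-- The crossed product `C₀(Ξ_ω, B) ⋊ Γ`. -/
noncomputable abbrev bulkAlgebra (β : Γ →* (B ≃⋆ₐ[ℂ] B)) (ω : Ω) :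
    NonUnitalStarSubalgebra ℂ (AdjEnd Γ C₀(quasiOrbit Γ ω, B)) :=
  crossedProduct (c0Action (quasiOrbit Γ ω) β)

/-- `q` is the canonical (continuous) ⋆-homomorphism `A ⋊ Γ → C₀(Ξ_ω, B) ⋊ Γ` induced by the
restriction of functions: `q(S_g F) = S_g F|_{Ξ_ω}` for `g ∈ Γ`, `F ∈ C₀(Ω, B) ≅ A`. -/
def IsBulkQuotient (β : Γ →* (B ≃⋆ₐ[ℂ] B))
    (A : NonUnitalStarSubalgebra ℂ (lp (fun _ : Γ => B) ∞)) (ι : Γ → Ω) (ω : Ω)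
    (q : interfaceAlgebra β A →⋆ₙₐ[ℂ] bulkAlgebra β ω) : Prop :=
  Continuous q ∧ ∀ (g : Γ) (F : C₀(Ω, B)) (T : interfaceAlgebra β A),
    (T : AdjEnd Γ B) = monomialOp β g (restrictGroup ι F) →
      (q T : AdjEnd Γ C₀(quasiOrbit Γ ω, B)) =
        monomialOp (c0Action (quasiOrbit Γ ω) β) g (constFun Γ (restrictQuasiOrbit ω F))

end Functions

end Interface

/-! The proof is the method of limit operators. Let `(W_s ψ)(x) = β_s(ψ(x s))`. Conjugation by `W_s`
replaces the coefficient `f` of `S_g f` by `f(· s)`. When `s` tends to a boundary point `ξ`, the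
function `f(x s)` tends to `F(x • ξ)`, where `F ∈ C₀(Ω, B)` extends `f`. So `W_s T W_s⁻¹` converges
strongly, together with adjoints, to a limit operator. This limit is `q_j(T)` evaluated at `ξ`, for
every `ξ ∈ Ξ_j`. The pairs `(T, R)` for which evaluations of `R` are limits of translates of `T` at
all `ξ ∈ Ξ_j` form a closed ⋆-algebra on which `‖R‖ ≤ ‖T‖`. It is therefore the graph of a
homomorphism, and this produces `q_j` (`exists_isBulkQuotient`).

Bulk spectra lie in the essential spectrum because translates of compact operators tend strongly to
zero (`translatesTo_zero_of_mem_compactIdeal`). A left parametrix of `μ - T` bounds all limit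
operators of `μ - T` below, uniformly in `ξ`. The adjoint is treated in the same way, so `μ -
q_j(T)` is invertible (`isUnit_of_notMem_essentialSpectrum`).

For the converse, let all `μ - q_j(T)` be invertible. Every ultrafilter on `Γ` that leaves finite
sets converges in `Ω` to a boundary point or leaves all compact sets of `Ω`. In the second case the
limit of `μ - T` is `μ`, and this case is impossible when `A` is unital. Hence `X = (μ - T)⋆(μ - T)`
has a strictly positive limit along each such ultrafilter (`exists_translatesTo_formLE`). It follows
that `X` is bounded below off a finite set (`exists_formLE_compl`). Otherwise Følner localisation
(`exists_localisation`), applied at all scales `2⁻ᵏ` at once (`exists_nested`), yields points `s`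
going to infinity near which lower bounds proportional to `2⁻ᵏ` fail for all `k` below a growing
cutoff. A limit operator along these points would have no positive lower bound. The bounds of the
individual limits need not be uniform, so the union of the bulk spectra is already closed. A compact
correction makes `X` invertible and gives a left parametrix (`exists_left_inverse_of_formLE`).
Passing to `T⋆` gives a right one.

Lower bounds are inequalities `c (χ|χ) ≤ (χ|Xχ)` in the order of `B` rather than norm inequalities:
order inequalities can be added over the pieces of a localisation, norms of `B`-valued forms cannot.
-/

namespace Interface

/-! ### Invertibility and spectral permanence in C⋆-algebras. -/

section CStar

/-- In a C⋆-algebra, if left multiplication by `R` is bounded below, then `R⋆R` is invertible. -/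
theorem isUnit_star_mul_self_of_norm_le {E : Type*} [CStarAlgebra E] {R : E} {c : ℝ} (hc : 0 < c)
    (h : ∀ Y : E, c * ‖Y‖ ≤ ‖R * Y‖) : IsUnit (star R * R) := by
  let _ := CStarAlgebra.spectralOrder E
  let _ := CStarAlgebra.spectralOrderedRing E
  -- Any `0 < d < c²` would serve. The negative part `Y` of `R⋆R - d` satisfies `(RY)⋆(RY) = dY² -
  -- Y³ ≤ dY²`, so `c²‖Y‖² ≤ d‖Y‖²` and `Y = 0`, that is, `R⋆R ≥ d`.
  set d : ℝ := c ^ 2 / 2 with hd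
  have hd0 : 0 < d := by positivity
  set Z : E := star R * R - algebraMap ℝ E d with hZ
  have hZs : IsSelfAdjoint Z := (IsSelfAdjoint.star_mul_self R).sub (.algebraMap _ (.all d))
  set Y : E := Z⁻ with hY
  have hYs : star Y = Y := (CFC.negPart_nonneg Z).isSelfAdjoint
  have hYZ : Y * Z = -(Y * Y) := by
    conv_lhs => rw [← CFC.posPart_sub_negPart Z, mul_sub, CFC.negPart_mul_posPart, zero_sub]
  have key : star (R * Y) * (R * Y) ≤ d • (Y * Y) := by
    have e : star (R * Y) * (R * Y) = d • (Y * Y) - star Y * Y * Y := by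
      have : star R * R = Z + algebraMap ℝ E d := by rw [hZ, sub_add_cancel]
      rw [star_mul, mul_assoc, ← mul_assoc (star R), this, add_mul, mul_add, hYs, ← mul_assoc, hYZ,
        Algebra.algebraMap_eq_smul_one, smul_mul_assoc, one_mul, mul_smul_comm]
      simp only [neg_mul, mul_assoc]
      abel
    rw [e, sub_le_self_iff, hYs]
    have := star_left_conjugate_nonneg (CFC.negPart_nonneg Z) Y
    rwa [hYs] at this
  have h1 := CStarAlgebra.norm_le_norm_of_nonneg_of_le (star_mul_self_nonneg _) key
  rw [CStarRing.norm_star_mul_self, norm_smul, Real.norm_of_nonneg hd0.le] at h1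
  have h2 : ‖Y * Y‖ = ‖Y‖ * ‖Y‖ := by
    have := CStarRing.norm_star_mul_self (x := Y)
    rwa [hYs] at this
  have h3 := mul_self_le_mul_self (by positivity) (h Y)
  have h4 : ‖Y‖ = 0 := by
    by_contra hne
    have : 0 < ‖Y‖ * ‖Y‖ := by positivity
    rw [h2] at h1
    nlinarith
  have hZ0 : 0 ≤ Z := by rw [← CFC.negPart_eq_zero_iff Z hZs]; exact norm_eq_zero.1 h4
  refine CStarAlgebra.isUnit_of_le (algebraMap ℝ E d) (sub_nonneg.1 hZ0) ?_
  exact isStrictlyPositive_algebraMap hd0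

theorem isUnit_of_norm_le {E : Type*} [CStarAlgebra E] {R : E} {c d : ℝ} (hc : 0 < c) (hd : 0 < d)
    (h : ∀ Y : E, c * ‖Y‖ ≤ ‖R * Y‖) (h' : ∀ Y : E, d * ‖Y‖ ≤ ‖star R * Y‖) : IsUnit R := by
  obtain ⟨u, hu⟩ := isUnit_star_mul_self_of_norm_le hc h
  obtain ⟨v, hv⟩ := isUnit_star_mul_self_of_norm_le hd h'
  rw [star_star] at hv
  refine isUnit_iff_exists_and_exists.2 ⟨⟨star R * ↑v⁻¹, ?_⟩, ⟨↑u⁻¹ * star R, ?_⟩⟩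
  · rw [← mul_assoc, ← hv, Units.mul_inv]
  · rw [mul_assoc, ← hu, Units.inv_mul]

/-- Spectral permanence: if `q` lies in the C⋆-subalgebra `M` and `μ - q` has inverse `r`, then
`q r` and `r q` lie in `M`. -/
theorem mul_inverse_mem {E : Type*} [CStarAlgebra E] {M : NonUnitalStarSubalgebra ℂ E}
    (hM : IsClosed (M : Set E)) {q r : E} (hq : q ∈ M) {μ : ℂ}
    (h1 : (μ • 1 - q) * r = 1) (h2 : r * (μ • 1 - q) = 1) : q * r ∈ M ∧ r * q ∈ M := by
  let S := (StarAlgebra.adjoin ℂ (M : Set E)).topologicalClosure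
  have hS : IsClosed (S : Set E) := StarSubalgebra.isClosed_topologicalClosure _
  have hqS : q ∈ S := StarSubalgebra.le_topologicalClosure _ (StarAlgebra.subset_adjoin ℂ _ hq)
  have hx : μ • 1 - q ∈ S := sub_mem (S.smul_mem (one_mem S) μ) hqS
  have hu : IsUnit (⟨μ • 1 - q, hx⟩ : S) := by
    rw [← StarSubalgebra.coe_isUnit]
    exact ⟨⟨_, r, h1, h2⟩, rfl⟩
  have hr : r ∈ S := by
    obtain ⟨u, hu⟩ := hu
    have h3 : (μ • 1 - q) * ((↑u⁻¹ : S) : E) = 1 := by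
      have := congrArg (Subtype.val) u.mul_inv
      rwa [hu] at this
    have : r = ((↑u⁻¹ : S) : E) := by
      rw [← mul_one r, ← h3, ← mul_assoc, h2, one_mul]
    rw [this]; exact (↑u⁻¹ : S).2
  -- The inverse `r` lies only in `S`, the C⋆-algebra generated by `M` and the unit; but `M` is an
  -- ideal of `S`, so `q r` and `r q` return to `M`.
  have key : ∀ x ∈ S, ∀ m ∈ M, m * x ∈ M ∧ x * m ∈ M := by
    intro x hx m hm
    have hcl : IsClosed {x : E | m * x ∈ M ∧ x * m ∈ M} :=
      (hM.preimage (continuous_const_mul m)).inter (hM.preimage (continuous_mul_const m))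
    refine closure_minimal (s := (StarAlgebra.adjoin ℂ (M : Set E) : Set E)) ?_ hcl hx
    intro y hy
    have : ∀ m ∈ M, m * y ∈ M ∧ y * m ∈ M := by
      refine StarAlgebra.adjoin_induction (R := ℂ) (s := (M : Set E))
        (p := fun y _ => ∀ m ∈ M, m * y ∈ M ∧ y * m ∈ M) ?_ ?_ ?_ ?_ ?_ hy
      · exact fun y hy m hm => ⟨mul_mem hm hy, mul_mem hy hm⟩
      · intro c m hm
        simp only [Algebra.algebraMap_eq_smul_one, mul_smul_comm, mul_one, smul_mul_assoc, one_mul]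
        exact ⟨SMulMemClass.smul_mem c hm, SMulMemClass.smul_mem c hm⟩
      · intro a b _ _ ha hb m hm
        simp only [mul_add, add_mul]
        exact ⟨add_mem (ha m hm).1 (hb m hm).1, add_mem (ha m hm).2 (hb m hm).2⟩
      · intro a b _ _ ha hb m hm
        rw [← mul_assoc, mul_assoc a]
        exact ⟨(hb _ (ha m hm).1).1, (ha _ (hb m hm).2).2⟩
      · intro a _ ha m hm
        have := ha _ (star_mem hm)
        refine ⟨?_, ?_⟩
        · simpa using star_mem this.2
        · simpa using star_mem this.1
    exact this m hm
  exact ⟨(key r hr q hq).1, (key r hr q hq).2⟩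

end CStar

/-! ### Truncations, point functions and completeness of `ℓ²(Γ, D)`. -/

namespace L2
variable {Γ D : Type*} [NonUnitalCStarAlgebra D]

theorem norm_apply_le (ψ : L2 Γ D) (x : Γ) : ‖ψ x‖ ≤ ‖ψ‖ := by
  let _ := CStarAlgebra.spectralOrder D
  let _ := CStarAlgebra.spectralOrderedRing D
  refine (sq_le_sq₀ (norm_nonneg _) (norm_nonneg _)).1 ?_
  rw [norm_sq, sq, ← CStarRing.norm_star_mul_self]
  exact CStarAlgebra.norm_le_norm_of_nonneg_of_le (star_mul_self_nonneg _)
    (ψ.summable_self.le_tsum x fun _ _ => star_mul_self_nonneg _)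

/-- The restriction of `ψ` to a set `E ⊆ Γ`, extended by zero. -/
noncomputable def restrict (E : Set Γ) (ψ : L2 Γ D) : L2 Γ D :=
  mk (E.indicator fun x => ψ x) <| by
    refine (ψ.summable_self.indicator E).congr fun x => ?_
    by_cases hx : x ∈ E <;> simp [hx]

theorem restrict_apply (E : Set Γ) (ψ : L2 Γ D) (x : Γ) :
    ψ.restrict E x = E.indicator (fun x => ψ x) x := rfl

/-- The function with value `b` at `x` and `0` elsewhere. -/
noncomputable def single (x : Γ) (b : D) : L2 Γ D :=
  mk (({x} : Set Γ).indicator fun _ => b) <| summable_of_hasFiniteSupport <|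
    (Set.finite_singleton x).subset fun y hy => by
      by_contra h
      exact hy (by simp [Set.indicator_of_notMem h])

@[simp] theorem single_apply_self (x : Γ) (b : D) : single x b x = b :=
  Set.indicator_of_mem (s := ({x} : Set Γ)) rfl (fun _ : Γ => b)

theorem single_apply_of_ne {x y : Γ} (h : y ≠ x) (b : D) : single x b y = 0 :=
  Set.indicator_of_notMem (s := ({x} : Set Γ)) h (fun _ : Γ => b)

theorem ip_single_right (ψ : L2 Γ D) (x : Γ) (b : D) : ip ψ (single x b) = star (ψ x) * b := by
  rw [ip, tsum_eq_single x fun y hy => by rw [single_apply_of_ne hy, mul_zero], single_apply_self]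

theorem ip_single_left (ψ : L2 Γ D) (x : Γ) (b : D) : ip (single x b) ψ = star b * ψ x := by
  rw [← star_ip, ip_single_right, star_mul, star_star]

theorem norm_single (x : Γ) (b : D) : ‖single x b‖ = ‖b‖ := by
  rw [norm_def, ip_single_right, single_apply_self, CStarRing.norm_star_mul_self,
    Real.sqrt_mul_self (norm_nonneg _)]

theorem sum_apply {ι : Type*} (s : Finset ι) (f : ι → L2 Γ D) (x : Γ) :
    (∑ i ∈ s, f i) x = ∑ i ∈ s, f i x := by
  classical
  induction s using Finset.induction_on with
  | empty => simp
  | insert a s ha ih => simp [Finset.sum_insert ha, ih]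

/-- The finitely supported truncation of a function. -/
noncomputable def trunc (t : Finset Γ) (f : Γ → D) : L2 Γ D := ∑ x ∈ t, single x (f x)

theorem trunc_apply (t : Finset Γ) (f : Γ → D) (x : Γ) :
    trunc t f x = (t : Set Γ).indicator f x := by
  classical
  rw [trunc, sum_apply]
  by_cases hx : x ∈ t
  · rw [Finset.sum_eq_single x (fun y _ hy => single_apply_of_ne hy.symm _) (fun h => absurd hx h),
      single_apply_self, Set.indicator_of_mem (by simpa using hx)]
  · rw [Set.indicator_of_notMem (by simpa using hx)]
    exact Finset.sum_eq_zero fun y hy => single_apply_of_ne (by rintro rfl; exact hx hy) _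

theorem norm_trunc_sq (t : Finset Γ) (f : Γ → D) :
    ‖trunc t f‖ ^ 2 = ‖∑ x ∈ t, star (f x) * f x‖ := by
  rw [norm_sq, ip, tsum_eq_sum (s := t)]
  · congr 1
    refine Finset.sum_congr rfl fun x hx => ?_
    rw [trunc_apply, Set.indicator_of_mem (by simpa using hx)]
  · intro x hx
    rw [trunc_apply, Set.indicator_of_notMem (by simpa using hx), mul_zero]

theorem norm_trunc_le (t : Finset Γ) (ψ : L2 Γ D) : ‖trunc t fun x => ψ x‖ ≤ ‖ψ‖ := by
  let _ := CStarAlgebra.spectralOrder D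
  let _ := CStarAlgebra.spectralOrderedRing D
  refine (sq_le_sq₀ (norm_nonneg _) (norm_nonneg _)).1 ?_
  rw [norm_trunc_sq, norm_sq]
  exact CStarAlgebra.norm_le_norm_of_nonneg_of_le
    (Finset.sum_nonneg fun _ _ => star_mul_self_nonneg _)
    (ψ.summable_self.sum_le_tsum t fun _ _ => star_mul_self_nonneg _)

theorem trunc_add (t : Finset Γ) (f g : Γ → D) : trunc t (f + g) = trunc t f + trunc t g := by
  ext x
  simp only [trunc_apply, add_apply, Set.indicator_add']
  rfl

theorem continuous_single (x : Γ) : Continuous (single x : D → L2 Γ D) := by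
  have h : Isometry (single x : D → L2 Γ D) := by
    refine Isometry.of_dist_eq fun b c => ?_
    rw [dist_eq_norm, dist_eq_norm, ← norm_single x (b - c)]
    congr 1
    ext y
    by_cases hy : y = x
    · subst hy; simp
    · simp [single_apply_of_ne hy]
  exact h.continuous

theorem tendsto_trunc {ι : Type*} {l : Filter ι} (t : Finset Γ) {f : ι → Γ → D} {g : Γ → D}
    (h : ∀ x, Tendsto (fun i => f i x) l (𝓝 (g x))) :
    Tendsto (fun i => trunc t (f i)) l (𝓝 (trunc t g)) :=
  tendsto_finsetSum t fun x _ => ((continuous_single x).tendsto _).comp (h x)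

theorem norm_le_of_trunc {ψ : L2 Γ D} {c : ℝ} (hc : 0 ≤ c)
    (h : ∀ t : Finset Γ, ‖trunc t fun x => ψ x‖ ≤ c) : ‖ψ‖ ≤ c := by
  refine (sq_le_sq₀ (norm_nonneg _) hc).1 ?_
  rw [norm_sq]
  refine le_of_tendsto' (hasSum_ip ψ ψ).norm fun t => ?_
  rw [← norm_trunc_sq]
  exact pow_le_pow_left₀ (norm_nonneg _) (h t) 2

/-- Truncations converge. -/
theorem tendsto_trunc_self (ψ : L2 Γ D) :
    Tendsto (fun t : Finset Γ => trunc t fun x => ψ x) atTop (𝓝 ψ) := by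
  rw [Metric.tendsto_nhds]
  intro ε hε
  obtain ⟨s, hs⟩ := summable_iff_vanishing_norm.1 ψ.summable_self ((ε / 2) ^ 2) (by positivity)
  filter_upwards [eventually_ge_atTop s] with t ht
  rw [dist_comm, dist_eq_norm]
  refine lt_of_le_of_lt (norm_le_of_trunc (c := ε / 2) (by positivity) fun r => ?_)
    (half_lt_self hε)
  classical
  have e : (trunc r fun x => (ψ - trunc t fun x => ψ x) x) = trunc (r \ t) fun x => ψ x := by
    ext x
    simp only [trunc_apply, sub_apply]
    by_cases h1 : x ∈ r <;> by_cases h2 : x ∈ t <;> simp [h1, h2]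
  rw [e]
  refine (sq_le_sq₀ (norm_nonneg _) (by positivity)).1 ?_
  rw [norm_trunc_sq]
  exact (hs _ (Finset.sdiff_disjoint.mono_right ht)).le

/-- Values at points are Cauchy because evaluation is contractive. Norm estimates pass to the
pointwise limit on finite truncations, uniformly in the truncation, which suffices by
`norm_le_of_trunc`. -/
instance : CompleteSpace (L2 Γ D) := by
  refine Metric.complete_of_cauchySeq_tendsto fun u hu => ?_
  have hpt : ∀ x, ∃ b, Tendsto (fun n => u n x) atTop (𝓝 b) := fun x => by
    refine cauchySeq_tendsto_of_complete ?_
    rw [Metric.cauchySeq_iff'] at hu ⊢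
    intro ε hε
    obtain ⟨N, hN⟩ := hu ε hε
    refine ⟨N, fun n hn => lt_of_le_of_lt ?_ (hN n hn)⟩
    rw [dist_eq_norm, dist_eq_norm, ← sub_apply]
    exact norm_apply_le _ _
  choose f hf using hpt
  have key : ∀ ε > 0, ∃ N, ∀ n ≥ N, ∀ t, ‖trunc t ((fun x => u n x) - f)‖ ≤ ε := by
    intro ε hε
    obtain ⟨N, hN⟩ := Metric.cauchySeq_iff.1 hu ε hε
    refine ⟨N, fun n hn t => ?_⟩
    have h1 : Tendsto (fun m => trunc t ((fun x => u n x) - fun x => u m x)) atTop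
        (𝓝 (trunc t ((fun x => u n x) - f))) :=
      tendsto_trunc t fun x => tendsto_const_nhds.sub (hf x)
    refine le_of_tendsto h1.norm ?_
    filter_upwards [eventually_ge_atTop N] with m hm
    have h2 := (hN n hn m hm).le
    rw [dist_eq_norm] at h2
    exact (norm_trunc_le t (u n - u m)).trans h2
  have hs : Summable fun x => star (f x) * f x := by
    rw [summable_iff_vanishing_norm]
    intro ε hε
    obtain ⟨N, hN⟩ := key (√ε / 3) (by positivity)
    obtain ⟨s, hs⟩ := summable_iff_vanishing_norm.1 (u N).summable_self ((√ε / 3) ^ 2)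
      (by positivity)
    refine ⟨s, fun t ht => ?_⟩
    have h1 := hs t ht
    rw [← norm_trunc_sq, sq_lt_sq₀ (norm_nonneg _) (by positivity)] at h1
    have h2 := hN N le_rfl t
    have h3 : trunc t f + trunc t ((fun x => u N x) - f) = trunc t fun x => u N x := by
      rw [← trunc_add, add_sub_cancel]
    have h4 : ‖trunc t f‖ < √ε := by
      rw [← eq_sub_iff_add_eq] at h3
      rw [h3]
      have : 0 < √ε := by positivity
      linarith [norm_sub_le (trunc t fun x => u N x) (trunc t ((fun x => u N x) - f))]
    rw [← norm_trunc_sq, ← Real.sq_sqrt hε.le]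
    exact pow_lt_pow_left₀ h4 (norm_nonneg _) two_ne_zero
  refine ⟨mk f hs, Metric.tendsto_atTop.2 fun ε hε => ?_⟩
  obtain ⟨N, hN⟩ := key (ε / 2) (by positivity)
  refine ⟨N, fun n hn => ?_⟩
  rw [dist_eq_norm]
  exact lt_of_le_of_lt (norm_le_of_trunc (by positivity) fun t => hN n hn t) (half_lt_self hε)

theorem continuous_ip : Continuous fun p : L2 Γ D × L2 Γ D => ip p.1 p.2 := by
  refine continuous_iff_continuousAt.2 fun p => ?_
  rw [ContinuousAt, tendsto_iff_norm_sub_tendsto_zero]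
  have hb : Tendsto (fun q : L2 Γ D × L2 Γ D => ‖q.1 - p.1‖ * ‖q.2‖ + ‖p.1‖ * ‖q.2 - p.2‖) (𝓝 p)
      (𝓝 0) := by
    have : Continuous fun q : L2 Γ D × L2 Γ D => ‖q.1 - p.1‖ * ‖q.2‖ + ‖p.1‖ * ‖q.2 - p.2‖ := by
      fun_prop
    simpa using this.tendsto p
  refine squeeze_zero (fun _ => norm_nonneg _) (fun q => ?_) hb
  have e : ip q.1 q.2 - ip p.1 p.2 = ip (q.1 - p.1) q.2 + ip p.1 (q.2 - p.2) := by
    have h1 := ip_add_left (q.1 - p.1) p.1 q.2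
    have h2 := ip_add_right p.1 (q.2 - p.2) p.2
    rw [sub_add_cancel] at h1 h2
    rw [h1, h2]; abel
  rw [e]
  exact (norm_add_le _ _).trans (add_le_add (norm_ip_le _ _) (norm_ip_le _ _))

end L2

/-! ### The adjointable operators as a C⋆-algebra. -/

namespace AdjEnd
variable {Γ D : Type*} [NonUnitalCStarAlgebra D]

@[simp] theorem add_apply (T S : AdjEnd Γ D) (ψ : L2 Γ D) : (T + S).1 ψ = T.1 ψ + S.1 ψ := rfl
@[simp] theorem sub_apply (T S : AdjEnd Γ D) (ψ : L2 Γ D) : (T - S).1 ψ = T.1 ψ - S.1 ψ := rfl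
@[simp] theorem mul_apply (T S : AdjEnd Γ D) (ψ : L2 Γ D) : (T * S).1 ψ = T.1 (S.1 ψ) := rfl
@[simp] theorem one_apply (ψ : L2 Γ D) : (1 : AdjEnd Γ D).1 ψ = ψ := rfl
@[simp] theorem zero_apply (ψ : L2 Γ D) : (0 : AdjEnd Γ D).1 ψ = 0 := rfl
@[simp] theorem smul_apply (c : ℂ) (T : AdjEnd Γ D) (ψ : L2 Γ D) : (c • T).1 ψ = c • T.1 ψ := rfl

theorem ip_apply_left (T : AdjEnd Γ D) (ψ φ : L2 Γ D) :
    L2.ip (T.1 ψ) φ = L2.ip ψ ((star T).1 φ) := isAdjoint_star T ψ φ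

theorem norm_le_bound {T : AdjEnd Γ D} {c : ℝ} (hc : 0 ≤ c) (h : ∀ ψ, ‖T.1 ψ‖ ≤ c * ‖ψ‖) :
    ‖T‖ ≤ c := T.1.opNorm_le_bound hc h

@[ext] theorem ext {T S : AdjEnd Γ D} (h : ∀ ψ, T.1 ψ = S.1 ψ) : T = S :=
  Subtype.ext (ContinuousLinearMap.ext h)

/-- The involution is isometric, so adjoints of a Cauchy sequence converge too, and their limit is
an adjoint of the limit. -/
instance : CompleteSpace (AdjEnd Γ D) := by
  refine Metric.complete_of_cauchySeq_tendsto fun u hu => ?_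
  have h1 : CauchySeq fun n => (u n).1 :=
    uniformContinuous_subtype_val.comp_cauchySeq hu
  have h2 : CauchySeq fun n => (star (u n)).1 := uniformContinuous_subtype_val.comp_cauchySeq
    ((starₗᵢ ℂ (E := AdjEnd Γ D)).isometry.uniformContinuous.comp_cauchySeq hu)
  obtain ⟨T, hT⟩ := cauchySeq_tendsto_of_complete h1
  obtain ⟨T', hT'⟩ := cauchySeq_tendsto_of_complete h2
  have hadj : IsAdjoint T T' := fun ψ φ => by
    have a1 : Tendsto (fun n => L2.ip ((u n).1 ψ) φ) atTop (𝓝 (L2.ip (T ψ) φ)) :=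
      (L2.continuous_ip.tendsto (T ψ, φ)).comp
        ((((ContinuousLinearMap.apply ℂ _ ψ).continuous.tendsto T).comp hT).prodMk_nhds
          tendsto_const_nhds)
    have a2 : Tendsto (fun n => L2.ip ψ ((star (u n)).1 φ)) atTop (𝓝 (L2.ip ψ (T' φ))) :=
      (L2.continuous_ip.tendsto (ψ, T' φ)).comp
        (tendsto_const_nhds.prodMk_nhds
          (((ContinuousLinearMap.apply ℂ _ φ).continuous.tendsto T').comp hT'))
    refine tendsto_nhds_unique a1 (a2.congr fun n => ?_)
    rw [ip_apply_left]
  exact ⟨⟨T, T', hadj⟩, tendsto_subtype_rng.2 hT⟩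

noncomputable instance : CStarAlgebra (AdjEnd Γ D) where

noncomputable instance : PartialOrder (AdjEnd Γ D) := CStarAlgebra.spectralOrder _
noncomputable instance : StarOrderedRing (AdjEnd Γ D) := CStarAlgebra.spectralOrderedRing _

theorem ip_star_mul_self (T : AdjEnd Γ D) (ψ : L2 Γ D) :
    L2.ip ψ ((star T * T).1 ψ) = L2.ip (T.1 ψ) (T.1 ψ) :=
  (ip_apply_left T ψ _).symm

theorem ip_nonneg [PartialOrder D] [StarOrderedRing D] {T : AdjEnd Γ D} (hT : 0 ≤ T)
    (ψ : L2 Γ D) : 0 ≤ L2.ip ψ (T.1 ψ) := by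
  obtain ⟨S, rfl⟩ := CStarAlgebra.nonneg_iff_eq_star_mul_self.1 hT
  rw [ip_star_mul_self]
  exact L2.ip_self_nonneg _

/-- A lower bound for `R` on vectors is one for left multiplication by `R` on the operator algebra,
which is what the abstract criterion `isUnit_of_norm_le` requires. -/
theorem isUnit_of_bounded_below {R : AdjEnd Γ D} {c d : ℝ} (hc : 0 < c) (hd : 0 < d)
    (h : ∀ ψ, c * ‖ψ‖ ≤ ‖R.1 ψ‖) (h' : ∀ ψ, d * ‖ψ‖ ≤ ‖(star R).1 ψ‖) : IsUnit R := by
  have aux : ∀ (R : AdjEnd Γ D) (c : ℝ), 0 < c → (∀ ψ, c * ‖ψ‖ ≤ ‖R.1 ψ‖) →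
      ∀ Y : AdjEnd Γ D, c * ‖Y‖ ≤ ‖R * Y‖ := by
    intro R c hc h Y
    rw [← le_div_iff₀' hc]
    refine norm_le_bound (by positivity) fun ψ => ?_
    rw [div_mul_eq_mul_div, le_div_iff₀' hc]
    exact (h _).trans (norm_apply_le (R * Y) ψ)
  exact isUnit_of_norm_le hc hd (aux R c hc h) (aux (star R) d hd h')

end AdjEnd

/-! ### The twisted translations `W_s`. -/

theorem continuous_starAlgEquiv {D : Type*} [NonUnitalCStarAlgebra D] (φ : D ≃⋆ₐ[ℂ] D) :
    Continuous φ :=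
  AddMonoidHomClass.continuous_of_bound φ 1 fun b => by
    simpa using NonUnitalStarAlgHom.norm_apply_le φ b

theorem norm_starAlgEquiv {D : Type*} [NonUnitalCStarAlgebra D] (φ : D ≃⋆ₐ[ℂ] D) (d : D) :
    ‖φ d‖ = ‖d‖ := NonUnitalStarAlgHom.norm_map φ φ.injective d

namespace L2
variable {Γ D : Type*} [NonUnitalCStarAlgebra D]

/-- A uniformly bounded family of additive maps that tends to zero on functions supported at one
point tends to zero pointwise. -/
theorem tendsto_zero_of_single {E ι : Type*} [SeminormedAddCommGroup E] {l : Filter ι}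
    {L : ι → L2 Γ D →+ E} {C : ℝ} (h : ∀ i ψ, ‖L i ψ‖ ≤ C * ‖ψ‖)
    (hs : ∀ x b, Tendsto (fun i => L i (single x b)) l (𝓝 0)) (ψ : L2 Γ D) :
    Tendsto (fun i => L i ψ) l (𝓝 0) := by
  have ht : ∀ (t : Finset Γ) (f : Γ → D), Tendsto (fun i => L i (trunc t f)) l (𝓝 0) := by
    intro t f
    simp only [trunc, map_sum]
    simpa using tendsto_finsetSum t fun x _ => hs x (f x)
  rw [Metric.tendsto_nhds]
  intro ε hε
  have hC : 0 < |C| + 1 := by positivity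
  obtain ⟨t, h1⟩ := (Metric.tendsto_nhds.1 (tendsto_trunc_self ψ) (ε / 2 / (|C| + 1))
    (by positivity)).exists
  filter_upwards [Metric.tendsto_nhds.1 (ht t fun x => ψ x) (ε / 2) (by positivity)] with i hi
  rw [dist_zero_right] at hi ⊢
  rw [dist_comm, dist_eq_norm, lt_div_iff₀ hC] at h1
  have h2 := h i (ψ - trunc t fun x => ψ x)
  have h3 : ‖L i ψ‖ ≤ ‖L i (ψ - trunc t fun x => ψ x)‖ + ‖L i (trunc t fun x => ψ x)‖ := by
    conv_lhs => rw [← sub_add_cancel ψ (trunc t fun x => ψ x), map_add]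
    exact norm_add_le _ _
  have h4 : C * ‖ψ - trunc t fun x => ψ x‖ ≤ ‖ψ - trunc t fun x => ψ x‖ * (|C| + 1) := by
    rw [mul_comm]
    exact mul_le_mul_of_nonneg_left ((le_abs_self C).trans (by linarith)) (norm_nonneg _)
  linarith

theorem tendsto_cofinite (ψ : L2 Γ D) : Tendsto (fun x => ψ x) cofinite (𝓝 0) := by
  rw [tendsto_zero_iff_norm_tendsto_zero]
  have h := ψ.summable_self.tendsto_cofinite_zero.norm
  simp only [CStarRing.norm_star_mul_self, norm_zero] at h
  simpa [Function.comp_def] using (Real.continuous_sqrt.tendsto 0).comp h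

variable [CommGroup Γ] (α : Γ →* (D ≃⋆ₐ[ℂ] D))

/-- The isometry `(W_s ψ)(x) = α_s(ψ(x s))` of `ℓ²(Γ, D)`. -/
noncomputable def twist (s : Γ) : L2 Γ D →ₗ[ℂ] L2 Γ D where
  toFun ψ := mk (fun x => α s (ψ (x * s))) <| by
    have h1 := ((Equiv.mulRight s).summable_iff.2 ψ.summable_self).map (α s)
      (continuous_starAlgEquiv (α s))
    refine h1.congr fun x => ?_
    simp [map_star]
  map_add' ψ φ := L2.ext fun x => map_add (α s) _ _
  map_smul' c ψ := L2.ext fun x => map_smul (α s) c _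

theorem twist_apply (s : Γ) (ψ : L2 Γ D) (x : Γ) : twist α s ψ x = α s (ψ (x * s)) := rfl

/-- The operator `W_s` is only semilinear over `α_s`, so in general it is not adjointable. This
identity makes it isometric and lets conjugation by it preserve adjointability. -/
theorem ip_twist (s : Γ) (ψ φ : L2 Γ D) : ip (twist α s ψ) (twist α s φ) = α s (ip ψ φ) := by
  have h1 := ((Equiv.mulRight s).hasSum_iff.2 (hasSum_ip ψ φ)).map (α s)
      (continuous_starAlgEquiv (α s))
  refine HasSum.unique (hasSum_ip _ _) (h1.congr_fun ?_)
  intro x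
  simp [twist_apply, map_star]

theorem norm_twist (s : Γ) (ψ : L2 Γ D) : ‖twist α s ψ‖ = ‖ψ‖ := by
  rw [norm_def, norm_def, ip_twist, norm_starAlgEquiv]

theorem twist_twist (s t : Γ) (ψ : L2 Γ D) : twist α s (twist α t ψ) = twist α (s * t) ψ := by
  ext x
  rw [twist_apply, twist_apply, twist_apply, map_mul, StarAlgEquiv.mul_apply, mul_assoc]

@[simp] theorem twist_one (ψ : L2 Γ D) : twist α 1 ψ = ψ := by
  ext x
  simp [twist_apply]

@[simp] theorem twist_inv_twist (s : Γ) (ψ : L2 Γ D) : twist α s⁻¹ (twist α s ψ) = ψ := by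
  rw [twist_twist, inv_mul_cancel, twist_one]

@[simp] theorem twist_twist_inv (s : Γ) (ψ : L2 Γ D) : twist α s (twist α s⁻¹ ψ) = ψ := by
  rw [twist_twist, mul_inv_cancel, twist_one]

theorem twist_single (s x : Γ) (b : D) : twist α s (single x b) = single (x * s⁻¹) (α s b) := by
  ext y
  rw [twist_apply]
  by_cases hy : y = x * s⁻¹
  · subst hy; simp
  · rw [single_apply_of_ne hy, single_apply_of_ne (fun h => hy (by rw [← h]; group)), map_zero]

end L2

/-! ### Strong limits of translated operators. -/

namespace AdjEnd
variable {Γ D D' : Type*} [NonUnitalCStarAlgebra D] [NonUnitalCStarAlgebra D']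

/-- A uniformly bounded family of operators that converges on functions supported at one point
converges strongly. -/
theorem tendsto_apply_of_single {ι : Type*} {l : Filter ι} {T : ι → AdjEnd Γ D} {S : AdjEnd Γ D}
    {C : ℝ} (hC : ∀ i, ‖T i‖ ≤ C)
    (hs : ∀ x b, Tendsto (fun i => (T i).1 (L2.single x b)) l (𝓝 (S.1 (L2.single x b))))
    (ψ : L2 Γ D) : Tendsto (fun i => (T i).1 ψ) l (𝓝 (S.1 ψ)) := by
  rw [tendsto_iff_norm_sub_tendsto_zero]
  have := L2.tendsto_zero_of_single (l := l) (L := fun i => ((T i - S).1 : L2 Γ D →+ L2 Γ D))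
    (C := C + ‖S‖) (fun i ψ => ?_) (fun x b => ?_) ψ
  · simpa using this.norm
  · exact (norm_apply_le (T i - S) ψ).trans
      (mul_le_mul_of_nonneg_right ((norm_sub_le _ _).trans (by linarith [hC i])) (norm_nonneg _))
  · have := (hs x b).sub_const (S.1 (L2.single x b))
    rw [sub_self] at this
    exact this

theorem star_theta (ψ φ : L2 Γ D) : star (theta ψ φ) = theta φ ψ :=
  star_eq fun χ η => by
    rw [theta_apply, theta_apply, L2.ip_rsmul_left, L2.ip_rsmul_right, L2.star_ip]

theorem norm_theta_le (ψ φ : L2 Γ D) : ‖theta ψ φ‖ ≤ ‖ψ‖ * ‖φ‖ :=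
  norm_le_bound (by positivity) fun χ => by
    rw [theta_apply, mul_assoc]
    exact (L2.norm_rsmul_le _ _).trans
      (mul_le_mul_of_nonneg_left (L2.norm_ip_le _ _) (norm_nonneg _))

theorem star_mulOp (a : lp (fun _ : Γ => D) ∞) : star (mulOp a) = mulOp (star a) :=
  star_eq fun ψ φ => tsum_congr fun x => by
    rw [mulOp_apply, mulOp_apply, star_mul, mul_assoc]
    rfl

variable [CommGroup Γ]

theorem star_shiftOp (g : Γ) : star (shiftOp g : AdjEnd Γ D) = shiftOp g⁻¹ :=
  star_eq fun ψ φ => by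
    refine ((Equiv.mulLeft g).tsum_eq _).symm.trans (tsum_congr fun x => ?_)
    rw [Equiv.coe_mulLeft, shiftOp_apply, shiftOp_apply, inv_mul_cancel_left, inv_inv]

variable (α : Γ →* (D ≃⋆ₐ[ℂ] D))

theorem monomialOp_apply (g : Γ) (f : lp (fun _ : Γ => D) ∞) (ψ : L2 Γ D) (x : Γ) :
    (monomialOp α g f).1 ψ x = α (g⁻¹ * x)⁻¹ (f (g⁻¹ * x)) * ψ (g⁻¹ * x) := rfl

theorem star_monomialOp_apply (g : Γ) (f : lp (fun _ : Γ => D) ∞) (ψ : L2 Γ D) (x : Γ) :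
    (star (monomialOp α g f)).1 ψ x = star (α x⁻¹ (f x)) * ψ (g * x) := by
  rw [monomialOp, star_mul, star_mulOp, star_shiftOp, mul_apply, mulOp_apply, shiftOp_apply,
    inv_inv]
  rfl

/-- The conjugate `W_s T W_s⁻¹` of an operator `T`. -/
noncomputable def conj (s : Γ) (T : AdjEnd Γ D) : AdjEnd Γ D :=
  have hb : ∀ T : AdjEnd Γ D, ∀ ψ, ‖L2.twist α s (T.1 (L2.twist α s⁻¹ ψ))‖ ≤ ‖T‖ * ‖ψ‖ := by
    intro T ψ
    rw [L2.norm_twist, ← L2.norm_twist α s⁻¹ ψ]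
    exact norm_apply_le T _
  ⟨(L2.twist α s ∘ₗ (T.1 : L2 Γ D →ₗ[ℂ] L2 Γ D) ∘ₗ L2.twist α s⁻¹).mkContinuous ‖T‖ (hb T),
    (L2.twist α s ∘ₗ ((star T).1 : L2 Γ D →ₗ[ℂ] L2 Γ D) ∘ₗ L2.twist α s⁻¹).mkContinuous ‖star T‖
      (hb (star T)), fun ψ φ => by
    change L2.ip (L2.twist α s (T.1 (L2.twist α s⁻¹ ψ))) φ =
      L2.ip ψ (L2.twist α s ((star T).1 (L2.twist α s⁻¹ φ)))
    conv_lhs => rw [← L2.twist_twist_inv α s φ, L2.ip_twist, ip_apply_left, ← L2.ip_twist,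
      L2.twist_twist_inv]⟩

theorem conj_apply (s : Γ) (T : AdjEnd Γ D) (ψ : L2 Γ D) :
    (conj α s T).1 ψ = L2.twist α s (T.1 (L2.twist α s⁻¹ ψ)) := rfl

theorem norm_conj_le (s : Γ) (T : AdjEnd Γ D) : ‖conj α s T‖ ≤ ‖T‖ :=
  norm_le_bound (norm_nonneg _) fun ψ => by
    rw [conj_apply, L2.norm_twist, ← L2.norm_twist α s⁻¹ ψ]
    exact norm_apply_le T _

theorem conj_add (s : Γ) (T S : AdjEnd Γ D) : conj α s (T + S) = conj α s T + conj α s S := by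
  ext1 ψ; simp [conj_apply]

theorem conj_sub (s : Γ) (T S : AdjEnd Γ D) : conj α s (T - S) = conj α s T - conj α s S := by
  ext1 ψ; simp [conj_apply]

theorem conj_smul (s : Γ) (c : ℂ) (T : AdjEnd Γ D) : conj α s (c • T) = c • conj α s T := by
  ext1 ψ; simp [conj_apply]

theorem conj_one (s : Γ) : conj α s (1 : AdjEnd Γ D) = 1 := by
  ext1 ψ; simp [conj_apply]

theorem conj_zero (s : Γ) : conj α s (0 : AdjEnd Γ D) = 0 := by
  ext1 ψ; simp [conj_apply]

theorem conj_mul (s : Γ) (T S : AdjEnd Γ D) : conj α s (T * S) = conj α s T * conj α s S := by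
  ext1 ψ; simp [conj_apply]

theorem conj_star (s : Γ) (T : AdjEnd Γ D) : conj α s (star T) = star (conj α s T) :=
  (star_eq fun ψ φ => by
    rw [conj_apply, conj_apply]
    conv_lhs => rw [← L2.twist_twist_inv α s φ, L2.ip_twist, ip_apply_left, ← L2.ip_twist,
      L2.twist_twist_inv]).symm

/-- The `α_s` in `W_s` cancels against part of `α_{ys}⁻¹`, so conjugation turns `S_g f` into `S_g
f(· s)` with no automorphism left over. -/
theorem conj_monomialOp_single (s g : Γ) (f : lp (fun _ : Γ => D) ∞) (y : Γ) (b : D) :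
    (conj α s (monomialOp α g f)).1 (L2.single y b) =
      L2.single (g * y) (α y⁻¹ (f (y * s)) * b) := by
  ext x
  rw [conj_apply, L2.twist_single, L2.twist_apply, monomialOp_apply, inv_inv]
  by_cases hx : x = g * y
  · subst hx
    rw [L2.single_apply_self, mul_assoc g, inv_mul_cancel_left, L2.single_apply_self, map_mul,
      ← StarAlgEquiv.mul_apply, ← StarAlgEquiv.mul_apply, ← map_mul, ← map_mul]
    simp
  · rw [L2.single_apply_of_ne hx, L2.single_apply_of_ne, mul_zero, map_zero]
    intro h
    apply hx
    rw [← mul_assoc] at h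
    rw [← mul_right_cancel h, mul_inv_cancel_left]

theorem conj_star_monomialOp_single (s g : Γ) (f : lp (fun _ : Γ => D) ∞) (y : Γ) (b : D) :
    (conj α s (star (monomialOp α g f))).1 (L2.single y b) =
      L2.single (g⁻¹ * y) (star (α (g⁻¹ * y)⁻¹ (f (g⁻¹ * y * s))) * b) := by
  ext x
  rw [conj_apply, L2.twist_single, L2.twist_apply, star_monomialOp_apply, inv_inv]
  by_cases hx : x = g⁻¹ * y
  · subst hx
    rw [L2.single_apply_self, ← mul_assoc g, mul_inv_cancel_left, L2.single_apply_self, map_mul,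
      map_star, ← StarAlgEquiv.mul_apply, ← StarAlgEquiv.mul_apply, ← map_mul, ← map_mul]
    simp
  · rw [L2.single_apply_of_ne hx, L2.single_apply_of_ne, mul_zero, map_zero]
    intro h
    apply hx
    rw [← mul_assoc] at h
    rw [← mul_right_cancel h, inv_mul_cancel_left]

/-- The translates `W_s T W_s⁻¹` converge to `R` along `l`, strongly and together with their
adjoints, on the range of a map `e` from `ℓ²(Γ, D')` to `ℓ²(Γ, D)` that intertwines. -/
structure TranslatesTo (l : Filter Γ) (e : L2 Γ D' →L[ℂ] L2 Γ D) (T : AdjEnd Γ D)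
    (R : AdjEnd Γ D') : Prop where
  apply : ∀ ψ, Tendsto (fun s => (conj α s T).1 (e ψ)) l (𝓝 (e (R.1 ψ)))
  star_apply : ∀ ψ, Tendsto (fun s => (conj α s (star T)).1 (e ψ)) l (𝓝 (e ((star R).1 ψ)))

namespace TranslatesTo
variable {α} {l : Filter Γ} {e : L2 Γ D' →L[ℂ] L2 Γ D} {T S : AdjEnd Γ D} {R Q : AdjEnd Γ D'}

theorem star (h : TranslatesTo α l e T R) : TranslatesTo α l e (star T) (star R) :=
  ⟨h.star_apply, by simpa only [star_star] using h.apply⟩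

theorem add (h : TranslatesTo α l e T R) (h' : TranslatesTo α l e S Q) :
    TranslatesTo α l e (T + S) (R + Q) :=
  ⟨fun ψ => by simpa [conj_add] using (h.apply ψ).add (h'.apply ψ),
    fun ψ => by simpa [conj_add] using (h.star_apply ψ).add (h'.star_apply ψ)⟩

theorem smul (c : ℂ) (h : TranslatesTo α l e T R) : TranslatesTo α l e (c • T) (c • R) :=
  ⟨fun ψ => by simpa [conj_smul] using (h.apply ψ).const_smul c,
    fun ψ => by simpa [conj_smul] using (h.star_apply ψ).const_smul (Star.star c)⟩

theorem zero : TranslatesTo α l e 0 0 :=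
  ⟨fun ψ => by simp [conj_zero, tendsto_const_nhds],
    fun ψ => by simp [conj_zero, tendsto_const_nhds]⟩

theorem one : TranslatesTo α l e 1 1 :=
  ⟨fun ψ => by simp [conj_one, tendsto_const_nhds], fun ψ => by simp [conj_one, tendsto_const_nhds]⟩

theorem mul (h : TranslatesTo α l e T R) (h' : TranslatesTo α l e S Q) :
    TranslatesTo α l e (T * S) (R * Q) := by
  have aux : ∀ {T S : AdjEnd Γ D} {R Q : AdjEnd Γ D'},
      (∀ ψ, Tendsto (fun s => (conj α s T).1 (e ψ)) l (𝓝 (e (R.1 ψ)))) →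
      (∀ ψ, Tendsto (fun s => (conj α s S).1 (e ψ)) l (𝓝 (e (Q.1 ψ)))) →
      ∀ ψ, Tendsto (fun s => (conj α s (T * S)).1 (e ψ)) l (𝓝 (e ((R * Q).1 ψ))) := by
    intro T S R Q h h' ψ
    have h1 : Tendsto (fun s => (conj α s T).1 ((conj α s S).1 (e ψ) - e (Q.1 ψ))) l (𝓝 0) := by
      have h2 := tendsto_iff_norm_sub_tendsto_zero.1 (h' ψ)
      refine squeeze_zero_norm (fun s => ?_) (by simpa using h2.const_mul ‖T‖)
      exact (norm_apply_le _ _).trans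
        (mul_le_mul_of_nonneg_right (norm_conj_le α s T) (norm_nonneg _))
    have h3 := h1.add (h (Q.1 ψ))
    rw [zero_add] at h3
    refine h3.congr fun s => ?_
    rw [conj_mul, mul_apply, map_sub, sub_add_cancel]
  refine ⟨aux h.apply h'.apply, ?_⟩
  simp only [star_mul]
  exact aux h'.star_apply h.star_apply

theorem norm_apply_le [l.NeBot] (h : TranslatesTo α l e T R) (ψ : L2 Γ D') :
    ‖e (R.1 ψ)‖ ≤ ‖T‖ * ‖e ψ‖ :=
  le_of_tendsto' (h.apply ψ).norm fun s => (AdjEnd.norm_apply_le _ _).trans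
    (mul_le_mul_of_nonneg_right (norm_conj_le α s T) (norm_nonneg _))

theorem norm_le [l.NeBot] {R : AdjEnd Γ D}
    (h : TranslatesTo α l (ContinuousLinearMap.id ℂ (L2 Γ D)) T R) : ‖R‖ ≤ ‖T‖ :=
  norm_le_bound (norm_nonneg _) h.norm_apply_le

theorem mono {l' : Filter Γ} (hl : l' ≤ l) (h : TranslatesTo α l e T R) :
    TranslatesTo α l' e T R :=
  ⟨fun ψ => (h.apply ψ).mono_left hl, fun ψ => (h.star_apply ψ).mono_left hl⟩

/-- Limits along `l` are compatible with intertwining maps. -/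
theorem of_intertwines {S : AdjEnd Γ D}
    (h : TranslatesTo α l (ContinuousLinearMap.id ℂ (L2 Γ D)) T S)
    (h1 : ∀ ψ, e (R.1 ψ) = S.1 (e ψ)) (h2 : ∀ ψ, e ((Star.star R).1 ψ) = (Star.star S).1 (e ψ)) :
    TranslatesTo α l e T R :=
  ⟨fun ψ => by rw [h1]; exact h.apply (e ψ), fun ψ => by rw [h2]; exact h.star_apply (e ψ)⟩

/-- If the translates of a bounded function converge pointwise, so do those of the monomials. -/
theorem of_tendsto {g : Γ} {f φ : lp (fun _ : Γ => D) ∞}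
    (h : ∀ x, Tendsto (fun s => f (x * s)) l (𝓝 (φ x))) :
    TranslatesTo α l (ContinuousLinearMap.id ℂ (L2 Γ D)) (monomialOp α g f)
      (monomialOp α g φ) := by
  have e1 := fun y b => conj_monomialOp_single α 1 g φ y b
  have e2 := fun y b => conj_star_monomialOp_single α 1 g φ y b
  have c1 : ∀ T : AdjEnd Γ D, conj α 1 T = T := fun T => by ext1 ψ; simp [conj_apply]
  simp only [c1, mul_one] at e1 e2
  refine ⟨tendsto_apply_of_single (T := fun s => conj α s (monomialOp α g f))
    (S := monomialOp α g φ) (fun s => norm_conj_le α s _) fun y b => ?_,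
    tendsto_apply_of_single (T := fun s => conj α s (Star.star (monomialOp α g f)))
    (S := Star.star (monomialOp α g φ)) (fun s => norm_conj_le α s _) fun y b => ?_⟩
  · simp only [conj_monomialOp_single, e1]
    exact ((L2.continuous_single _).tendsto _).comp
      ((((continuous_starAlgEquiv (α y⁻¹)).tendsto _).comp (h y)).mul_const b)
  · simp only [conj_star_monomialOp_single, e2]
    exact ((L2.continuous_single _).tendsto _).comp
      ((((continuous_starAlgEquiv (α _)).tendsto _).comp (h _)).star.mul_const b)

end TranslatesTo

variable (l : Filter Γ) (e : L2 Γ D' →L[ℂ] L2 Γ D)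

/-- The pairs `(T, R)` such that the translates of `T` converge to `R` along `l`. -/
def translateGraph : NonUnitalStarSubalgebra ℂ (AdjEnd Γ D × AdjEnd Γ D') where
  carrier := {p | TranslatesTo α l e p.1 p.2}
  add_mem' h h' := h.add h'
  zero_mem' := TranslatesTo.zero
  mul_mem' h h' := h.mul h'
  smul_mem' c _ h := h.smul c
  star_mem' h := h.star

/-- Conjugation by `W_s` is contractive uniformly in `s`, so strong limits along the filter survive
norm limits of pairs, by an `ε/3` argument. -/
theorem isClosed_translateGraph :
    IsClosed (translateGraph α l e : Set (AdjEnd Γ D × AdjEnd Γ D')) := by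
  have aux : ∀ ψ, IsClosed {p : AdjEnd Γ D × AdjEnd Γ D' |
      Tendsto (fun s => (conj α s p.1).1 (e ψ)) l (𝓝 (e (p.2.1 ψ)))} := by
    intro ψ
    refine isClosed_of_closure_subset fun p hp => ?_
    rw [Set.mem_ofPred_eq, Metric.tendsto_nhds]
    intro ε hε
    have hC : 0 < ‖e‖ * ‖ψ‖ + 1 := by positivity
    obtain ⟨q, hq, hpq⟩ := Metric.mem_closure_iff.1 hp (ε / 3 / (‖e‖ * ‖ψ‖ + 1)) (by positivity)
    rw [dist_eq_norm, lt_div_iff₀ hC] at hpq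
    have h1 : ‖p.1 - q.1‖ ≤ ‖p - q‖ := norm_fst_le (p - q)
    have h2 : ‖p.2 - q.2‖ ≤ ‖p - q‖ := norm_snd_le (p - q)
    have h0 : ‖p - q‖ * (‖e‖ * ‖ψ‖) ≤ ‖p - q‖ * (‖e‖ * ‖ψ‖ + 1) :=
      mul_le_mul_of_nonneg_left (by linarith) (norm_nonneg _)
    filter_upwards [Metric.tendsto_nhds.1 hq (ε / 3) (by positivity)] with s hs
    rw [dist_eq_norm] at hs ⊢
    have h3 : ‖(conj α s (p.1 - q.1)).1 (e ψ)‖ ≤ ‖p - q‖ * (‖e‖ * ‖ψ‖) :=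
      (norm_apply_le _ _).trans (mul_le_mul ((norm_conj_le α s _).trans h1) (e.le_opNorm ψ)
        (norm_nonneg _) (norm_nonneg _))
    have h4 : ‖e ((p.2 - q.2).1 ψ)‖ ≤ ‖p - q‖ * (‖e‖ * ‖ψ‖) := by
      refine (e.le_opNorm _).trans ?_
      rw [mul_left_comm]
      exact mul_le_mul_of_nonneg_left ((norm_apply_le _ _).trans
        (mul_le_mul_of_nonneg_right h2 (norm_nonneg _))) (norm_nonneg _)
    rw [conj_sub, sub_apply] at h3
    rw [sub_apply, map_sub] at h4
    calc _ = ‖((conj α s p.1).1 (e ψ) - (conj α s q.1).1 (e ψ))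
          + ((conj α s q.1).1 (e ψ) - e (q.2.1 ψ)) - (e (p.2.1 ψ) - e (q.2.1 ψ))‖ := by
          congr 1; abel
      _ ≤ _ := (norm_sub_le _ _).trans (add_le_add_left (norm_add_le _ _) _)
      _ < ε := by linarith
  have : (translateGraph α l e : Set (AdjEnd Γ D × AdjEnd Γ D')) =
      (⋂ ψ, {p | Tendsto (fun s => (conj α s p.1).1 (e ψ)) l (𝓝 (e (p.2.1 ψ)))}) ∩
      star ⁻¹' (⋂ ψ, {p | Tendsto (fun s => (conj α s p.1).1 (e ψ)) l (𝓝 (e (p.2.1 ψ)))}) := by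
    ext p
    simp only [Set.mem_inter_iff, Set.mem_iInter, Set.mem_preimage, Set.mem_ofPred_eq]
    exact ⟨fun h => ⟨h.apply, h.star_apply⟩, fun h => ⟨h.1, h.2⟩⟩
  rw [this]
  exact (isClosed_iInter aux).inter ((isClosed_iInter aux).preimage continuous_star)

/-- The translates of a compact operator tend to zero. -/
theorem translatesTo_zero_of_mem_compactIdeal {k : AdjEnd Γ D} (hk : k ∈ compactIdeal Γ D) :
    TranslatesTo α cofinite (ContinuousLinearMap.id ℂ (L2 Γ D)) k 0 := by
  -- For `χ` supported at `x` the inner product involves only `φ(x s)`, and `φ` vanishes at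
  -- infinity. A uniform bound extends this to all `χ`.
  have hip : ∀ φ χ : L2 Γ D, Tendsto (fun s => L2.ip φ (L2.twist α s⁻¹ χ)) cofinite (𝓝 0) := by
    intro φ χ
    refine L2.tendsto_zero_of_single (C := ‖φ‖) (L := fun s =>
      { toFun := fun χ => L2.ip φ (L2.twist α s⁻¹ χ)
        map_zero' := by simp [L2.ip]
        map_add' := fun χ η => by rw [map_add, L2.ip_add_right] }) (fun s ψ => ?_)
      (fun x b => ?_) χ
    · rw [← L2.norm_twist α s⁻¹ ψ]
      exact L2.norm_ip_le _ _
    · change Tendsto (fun s => L2.ip φ (L2.twist α s⁻¹ (L2.single x b))) cofinite (𝓝 0)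
      have h1 : Tendsto (fun s => ‖φ (x * s)‖ * ‖b‖) cofinite (𝓝 0) := by
        simpa using ((φ.tendsto_cofinite.comp
          (mul_right_injective x).tendsto_cofinite).norm).mul_const ‖b‖
      refine squeeze_zero_norm (fun s => ?_) h1
      rw [L2.twist_single, L2.ip_single_right, inv_inv]
      refine (norm_mul_le _ _).trans (le_of_eq ?_)
      rw [norm_star, norm_starAlgEquiv]
  have hth : ∀ ψ φ χ : L2 Γ D, Tendsto (fun s => (conj α s (theta ψ φ)).1 χ) cofinite (𝓝 0) := by
    intro ψ φ χ
    have h1 := (hip φ χ).norm.const_mul ‖ψ‖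
    rw [norm_zero, mul_zero] at h1
    refine squeeze_zero_norm (fun s => ?_) h1
    rw [conj_apply, L2.norm_twist, theta_apply]
    exact L2.norm_rsmul_le _ _
  let V : Submodule ℂ (AdjEnd Γ D) := (translateGraph α cofinite
    (ContinuousLinearMap.id ℂ (L2 Γ D))).toSubmodule.comap (LinearMap.inl ℂ _ _)
  have hV : IsClosed (V : Set (AdjEnd Γ D)) :=
    (isClosed_translateGraph α cofinite _).preimage (by fun_prop :
      Continuous fun k : AdjEnd Γ D => (k, (0 : AdjEnd Γ D)))
  refine closure_minimal ?_ hV hk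
  refine Submodule.span_le.2 ?_
  rintro _ ⟨ψ, φ, rfl⟩
  refine ⟨fun χ => by simpa using hth ψ φ χ, fun χ => ?_⟩
  change Tendsto (fun s => (conj α s (star (theta ψ φ))).1 χ) _ _
  simpa [star_theta] using hth φ ψ χ

end AdjEnd

/-! ### Homomorphisms obtained from closed graphs. -/

/-- If every pair `(x, y)` in a closed ⋆-subalgebra `G` of a product of C⋆-algebras satisfies
`‖y‖ ≤ ‖x‖`, then `G` is the graph of a map at least on the C⋆-algebra generated by the first
components of any subset `s` of `G`, with values in the one generated by the second components. -/
theorem exists_mem_graph {X Y : Type*} [CStarAlgebra X] [CStarAlgebra Y] {s : Set (X × Y)}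
    {G : NonUnitalStarSubalgebra ℂ (X × Y)} (hG : IsClosed (G : Set (X × Y))) (hs : s ⊆ G)
    (hn : ∀ p ∈ G, ‖p.2‖ ≤ ‖p.1‖) {x : X}
    (hx : x ∈ (NonUnitalStarAlgebra.adjoin ℂ (Prod.fst '' s)).topologicalClosure) :
    ∃ y ∈ (NonUnitalStarAlgebra.adjoin ℂ (Prod.snd '' s)).topologicalClosure, (x, y) ∈ G := by
  let N := (NonUnitalStarAlgebra.adjoin ℂ (Prod.snd '' s)).topologicalClosure
  have hN : IsClosed (N : Set Y) := NonUnitalStarSubalgebra.isClosed_topologicalClosure _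
  let H : NonUnitalStarSubalgebra ℂ (X × Y) := G ⊓ N.comap (NonUnitalStarAlgHom.snd ℂ X Y)
  have hH : IsClosed (H : Set (X × Y)) := by
    rw [NonUnitalStarAlgebra.coe_inf]
    exact hG.inter (hN.preimage continuous_snd)
  let M : NonUnitalStarSubalgebra ℂ X := H.map (NonUnitalStarAlgHom.fst ℂ X Y)
  have hM : IsClosed (M : Set X) := by
    have : CompleteSpace H := hH.completeSpace_coe
    -- Since the second coordinate never dominates in the sup norm, the first projection is
    -- isometric on `H`; hence its image is complete and contains the closure of what it contains.
    have hi : Isometry fun p : H => p.1.1 := by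
      refine Isometry.of_dist_eq fun p q => ?_
      have h1 := hn _ (sub_mem p.2.1 q.2.1)
      rw [Subtype.dist_eq, dist_eq_norm, dist_eq_norm, Prod.norm_def, max_eq_left h1]
      rfl
    have h2 := hi.isClosedEmbedding.isClosed_range
    convert h2 using 1
    ext x
    constructor
    · rintro ⟨p, hp, rfl⟩
      exact ⟨⟨p, hp⟩, rfl⟩
    · rintro ⟨p, rfl⟩
      exact ⟨p.1, p.2, rfl⟩
  have hle : (NonUnitalStarAlgebra.adjoin ℂ (Prod.fst '' s)).topologicalClosure ≤ M := by
    refine NonUnitalStarSubalgebra.topologicalClosure_minimal _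
      (NonUnitalStarAlgebra.adjoin_le ?_) hM
    rintro _ ⟨p, hp, rfl⟩
    exact ⟨p, ⟨hs hp, NonUnitalStarSubalgebra.le_topologicalClosure _
      (NonUnitalStarAlgebra.subset_adjoin ℂ _ ⟨p, hp, rfl⟩)⟩, rfl⟩
  obtain ⟨p, ⟨hp1, hp2⟩, rfl⟩ := hle hx
  exact ⟨p.2, hp2, hp1⟩

/-- A ⋆-subalgebra `G` of a product all of whose elements `(x, y)` satisfy `‖y‖ ≤ ‖x‖` is the graph
of a continuous ⋆-homomorphism. -/
theorem exists_hom_of_graph {X Y : Type*} [CStarAlgebra X] [CStarAlgebra Y]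
    {G : NonUnitalStarSubalgebra ℂ (X × Y)} (hn : ∀ p ∈ G, ‖p.2‖ ≤ ‖p.1‖)
    (M : NonUnitalStarSubalgebra ℂ X) (N : NonUnitalStarSubalgebra ℂ Y)
    (hex : ∀ x : M, ∃ y : N, (x.1, y.1) ∈ G) :
    ∃ q : M →⋆ₙₐ[ℂ] N, Continuous q ∧ ∀ x : M, (x.1, (q x).1) ∈ G := by
  have huniq : ∀ {x : X} {y y' : N}, (x, y.1) ∈ G → (x, y'.1) ∈ G → y = y' := by
    intro x y y' h h'
    have := hn _ (sub_mem h h')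
    rw [Prod.mk_sub_mk, sub_self, norm_zero] at this
    exact Subtype.ext (sub_eq_zero.1 (norm_le_zero_iff.1 this))
  choose q hq using hex
  let Q : M →⋆ₙₐ[ℂ] N :=
    { toFun := q
      map_smul' := fun c x => huniq (hq (c • x)) (G.smul_mem' c (hq x))
      map_zero' := huniq (hq 0) (zero_mem G)
      map_add' := fun x y => huniq (hq (x + y)) (add_mem (hq x) (hq y))
      map_mul' := fun x y => huniq (hq (x * y)) (mul_mem (hq x) (hq y))
      map_star' := fun x => huniq (hq (star x)) (star_mem (hq x)) }
  refine ⟨Q, AddMonoidHomClass.continuous_of_bound Q 1 fun x => ?_, hq⟩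
  rw [one_mul]
  exact hn _ (hq x)

/-! ### Evaluation at points of `ℓ²(Γ, C₀(X, B))`. -/

section Eval
variable {Γ B X : Type*} [CStarAlgebra B] [TopologicalSpace X]

theorem norm_c0_apply_le (f : C₀(X, B)) (ξ : X) : ‖f ξ‖ ≤ ‖f‖ := f.toBCF.norm_coe_le_norm ξ

/-- Evaluation at a point, as an additive map. -/
def evalHom (ξ : X) : C₀(X, B) →+ B where
  toFun f := f ξ
  map_zero' := rfl
  map_add' _ _ := rfl

theorem continuous_evalHom (ξ : X) : Continuous (evalHom ξ : C₀(X, B) → B) :=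
  AddMonoidHomClass.continuous_of_bound (evalHom ξ) 1 fun f => by
    rw [one_mul]; exact norm_c0_apply_le f ξ

namespace L2

/-- Pointwise evaluation `ℓ²(Γ, C₀(X, B)) → ℓ²(Γ, B)` at a point `ξ` of `X`. -/
noncomputable def evalAt (ξ : X) : L2 Γ C₀(X, B) →L[ℂ] L2 Γ B :=
  let E : L2 Γ C₀(X, B) →ₗ[ℂ] L2 Γ B :=
    { toFun := fun ψ => mk (fun x => ψ x ξ) (ψ.summable_self.map (evalHom ξ) (continuous_evalHom ξ))
      map_add' := fun _ _ => rfl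
      map_smul' := fun _ _ => rfl }
  E.mkContinuous 1 fun ψ => by
    rw [one_mul, norm_def, norm_def]
    refine Real.sqrt_le_sqrt ?_
    have : ip (E ψ) (E ψ) = (ip ψ ψ) ξ :=
      (hasSum_ip _ _).unique ((hasSum_ip ψ ψ).map (evalHom ξ) (continuous_evalHom ξ))
    rw [this]
    exact norm_c0_apply_le _ ξ

theorem evalAt_apply (ξ : X) (ψ : L2 Γ C₀(X, B)) (x : Γ) : evalAt ξ ψ x = ψ x ξ := rfl

theorem ip_evalAt (ξ : X) (ψ φ : L2 Γ C₀(X, B)) :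
    ip (evalAt ξ ψ) (evalAt ξ φ) = (ip ψ φ) ξ :=
  (hasSum_ip _ _).unique ((hasSum_ip ψ φ).map (evalHom ξ) (continuous_evalHom ξ))

theorem norm_evalAt_le (ξ : X) (ψ : L2 Γ C₀(X, B)) : ‖evalAt ξ ψ‖ ≤ ‖ψ‖ := by
  rw [norm_def, norm_def, ip_evalAt]
  exact Real.sqrt_le_sqrt (norm_c0_apply_le _ ξ)

theorem norm_le_of_evalAt {ψ : L2 Γ C₀(X, B)} {c : ℝ} (hc : 0 ≤ c)
    (h : ∀ ξ : X, ‖evalAt ξ ψ‖ ≤ c) : ‖ψ‖ ≤ c := by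
  refine (sq_le_sq₀ (norm_nonneg _) hc).1 ?_
  rw [norm_sq]
  refine (BoundedContinuousFunction.norm_le (f := (ip ψ ψ).toBCF) (by positivity)).2 fun ξ => ?_
  change ‖(ip ψ ψ) ξ‖ ≤ _
  rw [← ip_evalAt, ← norm_sq]
  exact pow_le_pow_left₀ (norm_nonneg _) (h ξ) 2

end L2
end Eval

/-! ### Construction and uniqueness of the quotient maps `q_j`. -/

section Quotient
variable {Γ B Ω : Type*} [CommGroup Γ] [CStarAlgebra B] [TopologicalSpace Ω] [MulAction Γ Ω]
  {β : Γ →* (B ≃⋆ₐ[ℂ] B)}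
  {A : NonUnitalStarSubalgebra ℂ (lp (fun _ : Γ => B) ∞)} {ι : Γ → Ω}

theorem generatedBy_le {D : Type*} [NonUnitalCStarAlgebra D] {α : Γ →* (D ≃⋆ₐ[ℂ] D)}
    {F : Set (lp (fun _ : Γ => D) ∞)} {M : NonUnitalStarSubalgebra ℂ (AdjEnd Γ D)}
    (hM : IsClosed (M : Set (AdjEnd Γ D))) (h : ∀ g, ∀ f ∈ F, monomialOp α g f ∈ M) :
    generatedBy α F ≤ M :=
  NonUnitalStarSubalgebra.topologicalClosure_minimal _ (NonUnitalStarAlgebra.adjoin_le (by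
    rintro _ ⟨g, f, hf, rfl⟩; exact h g f hf)) hM

theorem monomialOp_mem_generatedBy {D : Type*} [NonUnitalCStarAlgebra D] (α : Γ →* (D ≃⋆ₐ[ℂ] D))
    {F : Set (lp (fun _ : Γ => D) ∞)} (g : Γ) {f : lp (fun _ : Γ => D) ∞} (hf : f ∈ F) :
    monomialOp α g f ∈ generatedBy α F :=
  NonUnitalStarSubalgebra.le_topologicalClosure _
    (NonUnitalStarAlgebra.subset_adjoin ℂ _ ⟨g, f, hf, rfl⟩)

theorem isClosed_generatedBy {D : Type*} [NonUnitalCStarAlgebra D] (α : Γ →* (D ≃⋆ₐ[ℂ] D))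
    (F : Set (lp (fun _ : Γ => D) ∞)) : IsClosed (generatedBy α F : Set (AdjEnd Γ D)) :=
  NonUnitalStarSubalgebra.isClosed_topologicalClosure _

namespace IsModelSpace

theorem comap_nhds_neBot (hΩ : IsModelSpace A ι) (ξ : Ω) : (comap ι (𝓝 ξ)).NeBot := by
  refine comap_neBot fun t ht => ?_
  obtain ⟨_, hx, x, rfl⟩ := mem_closure_iff_nhds.1 (hΩ.denseRange ξ) t ht
  exact ⟨x, hx⟩

theorem tendsto_translate [ContinuousConstSMul Γ Ω] (hΩ : IsModelSpace A ι)
    (F : C₀(Ω, B)) (ξ : Ω) (x : Γ) :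
    Tendsto (fun s => restrictGroup ι F (x * s)) (comap ι (𝓝 ξ))
      (𝓝 (restrictGroup (fun y : Γ => y • ξ) F x)) := by
  have h1 : Tendsto (fun s => F (x • ι s)) (comap ι (𝓝 ξ)) (𝓝 (F (x • ξ))) :=
    ((F.continuous.comp (continuous_const_smul x)).tendsto ξ).comp tendsto_comap
  refine h1.congr fun s => ?_
  rw [← hΩ.equivariant]
  rfl

end IsModelSpace

/-- Along a filter on which translates of the coefficients converge, so do those of all operators
in the interface algebra. -/
theorem exists_translatesTo {l : Filter Γ} [l.NeBot]
    (h : ∀ f ∈ A, ∃ φ : lp (fun _ : Γ => B) ∞, ∀ x, Tendsto (fun s => f (x * s)) l (𝓝 (φ x)))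
    {T : AdjEnd Γ B} (hT : T ∈ interfaceAlgebra β A) :
    ∃ S, AdjEnd.TranslatesTo β l (ContinuousLinearMap.id ℂ (L2 Γ B)) T S := by
  let G := AdjEnd.translateGraph β l (ContinuousLinearMap.id ℂ (L2 Γ B))
  have hT' : T ∈ (NonUnitalStarAlgebra.adjoin ℂ
      (Prod.fst '' (G : Set (AdjEnd Γ B × AdjEnd Γ B)))).topologicalClosure := by
    refine generatedBy_le (NonUnitalStarSubalgebra.isClosed_topologicalClosure _) ?_ hT
    intro g f hf
    obtain ⟨φ, hφ⟩ := h f hf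
    exact NonUnitalStarSubalgebra.le_topologicalClosure _
      (NonUnitalStarAlgebra.subset_adjoin ℂ _ ⟨(_, monomialOp β g φ), .of_tendsto hφ, rfl⟩)
  obtain ⟨S, -, hS⟩ := exists_mem_graph (AdjEnd.isClosed_translateGraph _ _ _) subset_rfl
    (fun p hp => AdjEnd.TranslatesTo.norm_le hp) hT'
  exact ⟨S, hS⟩

/-- This serves for filters leaving all compact subsets of `Ω`, along which every coefficient in `A`
dies out. -/
theorem translatesTo_zero {l : Filter Γ}
    (h : ∀ f ∈ A, ∀ x, Tendsto (fun s => f (x * s)) l (𝓝 0))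
    {T : AdjEnd Γ B} (hT : T ∈ interfaceAlgebra β A) :
    AdjEnd.TranslatesTo β l (ContinuousLinearMap.id ℂ (L2 Γ B)) T 0 := by
  let G := AdjEnd.translateGraph β l (ContinuousLinearMap.id ℂ (L2 Γ B))
  have hM : IsClosed (G.comap (NonUnitalStarAlgHom.inl ℂ (AdjEnd Γ B) (AdjEnd Γ B)) :
      Set (AdjEnd Γ B)) :=
    (AdjEnd.isClosed_translateGraph β l _).preimage
      (by fun_prop : Continuous fun k : AdjEnd Γ B => (k, (0 : AdjEnd Γ B)))
  refine generatedBy_le hM (fun g f hf => ?_) hT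
  have h1 : AdjEnd.TranslatesTo β l (ContinuousLinearMap.id ℂ (L2 Γ B)) (monomialOp β g f)
      (monomialOp β g 0) := .of_tendsto (h f hf)
  have h2 : monomialOp β g (0 : lp (fun _ : Γ => B) ∞) = 0 := by
    ext ψ x
    rw [AdjEnd.monomialOp_apply]
    simp
  rwa [h2] at h1

variable [ContinuousConstSMul Γ Ω]

/-- Evaluation at a point `ξ` of the quasi-orbit turns the monomials of the bulk algebra into
limits of translates. -/
theorem translatesTo_evalAt (hΩ : IsModelSpace A ι) (ω : Ω) (ξ : quasiOrbit Γ ω) (g : Γ)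
    (F : C₀(Ω, B)) :
    AdjEnd.TranslatesTo β (comap ι (𝓝 (ξ : Ω))) (L2.evalAt ξ) (monomialOp β g (restrictGroup ι F))
      (monomialOp (c0Action (quasiOrbit Γ ω) β) g (constFun Γ (restrictQuasiOrbit ω F))) := by
  -- The limit on `ℓ²(Γ, B)` is the monomial with coefficient `x ↦ F(x • ξ)`. Evaluation at `ξ`
  -- intertwines it with the bulk monomial because `β_x⁻¹(F(x • ξ))` is the value at `ξ` of the
  -- `x⁻¹`-translate of `F`.
  refine .of_intertwines (.of_tendsto (hΩ.tendsto_translate F ξ)) (fun ψ => ?_) fun ψ => ?_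
  · ext x
    rw [L2.evalAt_apply, AdjEnd.monomialOp_apply, AdjEnd.monomialOp_apply,
      ZeroAtInftyContinuousMap.mul_apply, c0Action_apply, inv_inv]
    rfl
  · ext x
    rw [L2.evalAt_apply, AdjEnd.star_monomialOp_apply, AdjEnd.star_monomialOp_apply,
      ZeroAtInftyContinuousMap.mul_apply, ZeroAtInftyContinuousMap.star_apply, c0Action_apply,
      inv_inv]
    rfl

/-- The norm of `ℓ²(Γ, C₀(Ξ, B))` is controlled by evaluations at points, and each evaluation of `R
ψ` is a limit of conjugates of `T` applied to the evaluation of `ψ`. Density of `Γ` makes the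
filters at the points `ξ` proper. -/
theorem norm_le_of_translatesTo_evalAt (hΩ : IsModelSpace A ι) {ω : Ω} {T : AdjEnd Γ B}
    {R : AdjEnd Γ C₀(quasiOrbit Γ ω, B)}
    (h : ∀ ξ : quasiOrbit Γ ω,
      AdjEnd.TranslatesTo β (comap ι (𝓝 (ξ : Ω))) (L2.evalAt ξ) T R) : ‖R‖ ≤ ‖T‖ := by
  refine AdjEnd.norm_le_bound (norm_nonneg _) fun ψ => L2.norm_le_of_evalAt (by positivity)
    fun ξ => ?_
  have := hΩ.comap_nhds_neBot (ξ : Ω)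
  exact ((h ξ).norm_apply_le ψ).trans
    (mul_le_mul_of_nonneg_left (L2.norm_evalAt_le ξ ψ) (norm_nonneg _))

/-- The second conclusion is the link to limit operators: the comparison of spectra uses the values
of `q` through it. -/
theorem exists_isBulkQuotient (hΩ : IsModelSpace A ι) (ω : Ω) :
    ∃ q : interfaceAlgebra β A →⋆ₙₐ[ℂ] bulkAlgebra β ω, IsBulkQuotient β A ι ω q ∧
      ∀ (T : interfaceAlgebra β A) (ξ : quasiOrbit Γ ω), AdjEnd.TranslatesTo β
        (comap ι (𝓝 (ξ : Ω))) (L2.evalAt ξ) (T : AdjEnd Γ B) (q T).1 := by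
  let α := c0Action (quasiOrbit Γ ω) β
  let G : NonUnitalStarSubalgebra ℂ (AdjEnd Γ B × AdjEnd Γ C₀(quasiOrbit Γ ω, B)) :=
    ⨅ ξ : quasiOrbit Γ ω, AdjEnd.translateGraph β (comap ι (𝓝 (ξ : Ω))) (L2.evalAt ξ)
  have hmem : ∀ p, p ∈ G ↔ ∀ ξ : quasiOrbit Γ ω,
      AdjEnd.TranslatesTo β (comap ι (𝓝 (ξ : Ω))) (L2.evalAt ξ) p.1 p.2 := fun p =>
    NonUnitalStarAlgebra.mem_iInf
  have hG : IsClosed (G : Set (AdjEnd Γ B × AdjEnd Γ C₀(quasiOrbit Γ ω, B))) := by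
    rw [NonUnitalStarAlgebra.coe_iInf]
    exact isClosed_iInter fun ξ => AdjEnd.isClosed_translateGraph _ _ _
  have hn : ∀ p ∈ G, ‖p.2‖ ≤ ‖p.1‖ := fun p hp =>
    norm_le_of_translatesTo_evalAt hΩ ((hmem p).1 hp)
  have huniq : ∀ {T R R'}, (T, R) ∈ G → (T, R') ∈ G → R = R' := by
    intro T R R' h h'
    have := hn _ (sub_mem h h')
    rw [Prod.mk_sub_mk, sub_self, norm_zero] at this
    exact sub_eq_zero.1 (norm_le_zero_iff.1 this)
  let s : Set (AdjEnd Γ B × AdjEnd Γ C₀(quasiOrbit Γ ω, B)) :=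
    Set.range fun p : Γ × C₀(Ω, B) => (monomialOp β p.1 (restrictGroup ι p.2),
      monomialOp α p.1 (constFun Γ (restrictQuasiOrbit ω p.2)))
  have hs : s ⊆ G := by
    rintro _ ⟨⟨g, F⟩, rfl⟩
    exact (hmem _).2 fun ξ => translatesTo_evalAt hΩ ω ξ g F
  have hex : ∀ T : interfaceAlgebra β A, ∃ R : bulkAlgebra β ω, (T.1, R.1) ∈ G := by
    rintro ⟨T, hT⟩
    have hT' : T ∈ (NonUnitalStarAlgebra.adjoin ℂ
      (Prod.fst '' s)).topologicalClosure := by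
      refine generatedBy_le (NonUnitalStarSubalgebra.isClosed_topologicalClosure _) ?_ hT
      intro g f hf
      obtain ⟨F, rfl⟩ := (hΩ.mem_iff f).1 hf
      exact NonUnitalStarSubalgebra.le_topologicalClosure _
        (NonUnitalStarAlgebra.subset_adjoin ℂ _ ⟨_, ⟨(g, F), rfl⟩, rfl⟩)
    obtain ⟨R, hR, hTR⟩ := exists_mem_graph hG hs hn hT'
    refine ⟨⟨R, ?_⟩, hTR⟩
    refine NonUnitalStarSubalgebra.topologicalClosure_mono (NonUnitalStarAlgebra.adjoin_mono ?_) hR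
    rintro _ ⟨_, ⟨⟨g, F⟩, rfl⟩, rfl⟩
    exact ⟨g, _, ⟨restrictQuasiOrbit ω F, rfl⟩, rfl⟩
  obtain ⟨q, hqc, hq⟩ := exists_hom_of_graph hn _ _ hex
  refine ⟨q, ⟨hqc, fun g F T hT => ?_⟩, fun T => (hmem _).1 (hq T)⟩
  refine huniq (hq T) ?_
  rw [hT]
  exact hs ⟨(g, F), rfl⟩

/-- The equaliser of `q` and `q'` is closed and contains all `S_g f`, hence everything. -/
theorem IsBulkQuotient.unique (hΩ : IsModelSpace A ι) {ω : Ω}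
    {q q' : interfaceAlgebra β A →⋆ₙₐ[ℂ] bulkAlgebra β ω} (h : IsBulkQuotient β A ι ω q)
    (h' : IsBulkQuotient β A ι ω q') : q = q' := by
  let E : NonUnitalStarSubalgebra ℂ (interfaceAlgebra β A) :=
    NonUnitalStarAlgHom.equalizer q q'
  have hE : IsClosed (E : Set (interfaceAlgebra β A)) := isClosed_eq h.1 h'.1
  let M := E.map (NonUnitalStarSubalgebraClass.subtype (interfaceAlgebra β A))
  have hM : IsClosed (M : Set (AdjEnd Γ B)) :=
    (isClosed_generatedBy β (A : Set (lp (fun _ : Γ => B) ∞))).isClosedEmbedding_subtypeVal.isClosedMap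
      _ hE
  have hle : interfaceAlgebra β A ≤ M := by
    refine generatedBy_le hM fun g f hf => ?_
    refine ⟨⟨_, monomialOp_mem_generatedBy β g hf⟩, ?_, rfl⟩
    obtain ⟨F, rfl⟩ := (hΩ.mem_iff f).1 hf
    exact Subtype.ext ((h.2 g F _ rfl).trans (h'.2 g F _ rfl).symm)
  ext1 T
  obtain ⟨S, hS, hST⟩ := hle T.2
  obtain rfl : S = T := Subtype.ext hST
  exact hS

end Quotient

/-! ### The two notions of bulk spectrum as invertibility in the full operator algebra. -/

section Spectra
variable {E : Type*} [CStarAlgebra E] {M : NonUnitalStarSubalgebra ℂ E}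

theorem notMem_unitalSpectrum_iff (hM : IsClosed (M : Set E)) (h1 : (1 : E) ∈ M) (q : M) (μ : ℂ) :
    μ ∉ unitalSpectrum q ↔ IsUnit (μ • 1 - (q : E)) := by
  rw [unitalSpectrum, Set.mem_ofPred_eq, not_not]
  constructor
  · rintro ⟨e, b, he, hb, hb'⟩
    obtain rfl : e = ⟨1, h1⟩ := by
      have := (he ⟨1, h1⟩).1
      rw [← this]
      exact Subtype.ext (mul_one _).symm
    exact ⟨⟨_, b, congrArg Subtype.val hb, congrArg Subtype.val hb'⟩, rfl⟩
  · rintro ⟨u, hu⟩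
    have e1 : (μ • 1 - (q : E)) * ↑u⁻¹ = 1 := by rw [← hu, Units.mul_inv]
    have e2 : ↑u⁻¹ * (μ • 1 - (q : E)) = 1 := by rw [← hu, Units.inv_mul]
    have hr : (↑u⁻¹ : E) ∈ M := by
      -- With `x = μ - q` and inverse `r`, permanence applied to `1 - x` at the spectral value `1`
      -- gives `(1 - x) r = r - 1 ∈ M`, whence `r ∈ M`.
      have hx : 1 - (μ • 1 - (q : E)) ∈ M :=
        sub_mem h1 (sub_mem (SMulMemClass.smul_mem _ h1) q.2)
      have h3 := (mul_inverse_mem hM hx (μ := 1) (r := ↑u⁻¹) (by rwa [one_smul, sub_sub_cancel])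
        (by rwa [one_smul, sub_sub_cancel])).1
      rw [sub_mul, e1, one_mul] at h3
      simpa using add_mem h3 h1
    exact ⟨⟨1, h1⟩, ⟨_, hr⟩, fun x => ⟨Subtype.ext (one_mul _), Subtype.ext (mul_one _)⟩,
      Subtype.ext e1, Subtype.ext e2⟩

/-- If `r` inverts `μ - q` in `E`, then `r = μ⁻¹(1 + q r)` with `q r ∈ M`. The right-hand side makes
sense in the unitization and is an inverse there. At `μ = 0` this breaks down, since `q` is never
invertible in the unitization. -/
theorem notMem_spectrum_unitization_iff (hM : IsClosed (M : Set E)) (q : M) {μ : ℂ} (hμ : μ ≠ 0) :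
    μ ∉ spectrum ℂ (q : Unitization ℂ M) ↔ IsUnit (μ • 1 - (q : E)) := by
  rw [spectrum.notMem_iff]
  constructor
  · intro h
    have := h.map (Unitization.lift (NonUnitalStarSubalgebraClass.subtype M).toNonUnitalAlgHom :
      Unitization ℂ M →ₐ[ℂ] E)
    rw [map_sub, AlgHom.commutes, Algebra.algebraMap_eq_smul_one] at this
    simpa using this
  · rintro ⟨u, hu⟩
    have e1 : (μ • 1 - (q : E)) * ↑u⁻¹ = 1 := by rw [← hu, Units.mul_inv]
    have e2 : ↑u⁻¹ * (μ • 1 - (q : E)) = 1 := by rw [← hu, Units.inv_mul]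
    obtain ⟨h3, h4⟩ := mul_inverse_mem hM q.2 e1 e2
    rw [sub_mul, smul_mul_assoc, one_mul] at e1
    rw [mul_sub, mul_smul_comm, mul_one] at e2
    have hc : (q : E) * ↑u⁻¹ = ↑u⁻¹ * q := by
      rw [← sub_right_inj (a := μ • (↑u⁻¹ : E)), e1, e2]
    let b : M := ⟨μ⁻¹ • (q * ↑u⁻¹), SMulMemClass.smul_mem _ h3⟩
    have hr : (↑u⁻¹ : E) = μ⁻¹ • (1 + q * ↑u⁻¹) := by
      rw [← e1, sub_add_cancel, inv_smul_smul₀ hμ]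
    have k1 : μ • b - q * b = μ⁻¹ • q := by
      apply Subtype.ext
      change μ • (μ⁻¹ • ((q : E) * ↑u⁻¹)) - q * (μ⁻¹ • (q * ↑u⁻¹)) = μ⁻¹ • (q : E)
      conv_lhs => rw [smul_inv_smul₀ hμ]
      nth_rw 1 [hr]
      rw [mul_smul_comm, mul_smul_comm, mul_add, mul_one, smul_add, add_sub_cancel_right]
    have k2 : μ • b - b * q = μ⁻¹ • q := by
      rw [← k1]
      congr 1
      apply Subtype.ext
      change (μ⁻¹ • ((q : E) * ↑u⁻¹)) * q = q * (μ⁻¹ • (q * ↑u⁻¹))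
      rw [smul_mul_assoc, mul_smul_comm, mul_assoc, hc]
    refine ⟨⟨algebraMap ℂ (Unitization ℂ M) μ - q, algebraMap ℂ (Unitization ℂ M) μ⁻¹ + b,
      ?_, ?_⟩, rfl⟩
    · rw [mul_add, sub_mul, sub_mul, ← map_mul, mul_inv_cancel₀ hμ, map_one,
        Algebra.algebraMap_eq_smul_one, Algebra.algebraMap_eq_smul_one, smul_mul_assoc, one_mul,
        mul_smul_comm, mul_one, ← Unitization.inr_mul, ← Unitization.inr_smul,
        ← Unitization.inr_smul, ← sub_sub_cancel (μ • b) (q * b), k1]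
      simp only [Unitization.inr_sub]
      abel
    · rw [mul_sub, add_mul, add_mul, ← map_mul, inv_mul_cancel₀ hμ, map_one,
        Algebra.algebraMap_eq_smul_one, Algebra.algebraMap_eq_smul_one, smul_mul_assoc, one_mul,
        mul_smul_comm, mul_one, ← Unitization.inr_mul, ← Unitization.inr_smul,
        ← Unitization.inr_smul, ← sub_sub_cancel (μ • b) (b * q), k2]
      simp only [Unitization.inr_sub]
      abel

end Spectra

/-! ### Parametrices and closedness of the essential spectrum. -/

section Calkin
variable {Γ D : Type*} [NonUnitalCStarAlgebra D]

theorem star_mem_compactIdeal {k : AdjEnd Γ D} (hk : k ∈ compactIdeal Γ D) :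
    star k ∈ compactIdeal Γ D := by
  refine map_mem_closure continuous_star hk fun R hR => ?_
  refine Submodule.span_induction ?_ ?_ ?_ ?_ hR
  · rintro _ ⟨ψ, φ, rfl⟩
    exact Submodule.subset_span ⟨_, _, AdjEnd.star_theta ψ φ⟩
  · simp
  · intro x y _ _ hx hy
    rw [star_add]; exact Submodule.add_mem _ hx hy
  · intro c x _ hx
    rw [star_smul]; exact Submodule.smul_mem _ _ hx

/-- Invertibility is split into left and right parametrices because these arise separately, from `T`
and from its adjoint. -/
theorem notMem_essentialSpectrum_iff (T : AdjEnd Γ D) (μ : ℂ) :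
    μ ∉ essentialSpectrum T ↔ (∃ S, (μ • 1 - T) * S - 1 ∈ compactIdeal Γ D) ∧
      ∃ S, S * (μ • 1 - T) - 1 ∈ compactIdeal Γ D := by
  have e : algebraMap ℂ (Calkin Γ D) μ - Ideal.Quotient.mk (compactIdeal Γ D) T =
      Ideal.Quotient.mk (compactIdeal Γ D) (μ • 1 - T) := by
    rw [map_sub, ← Algebra.algebraMap_eq_smul_one]
    rfl
  rw [essentialSpectrum, spectrum.notMem_iff, e, isUnit_iff_exists_and_exists]
  have hs : Function.Surjective (Ideal.Quotient.mk (compactIdeal Γ D)) :=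
    Ideal.Quotient.mk_surjective
  rw [hs.exists, hs.exists]
  simp only [← map_mul, ← map_one (Ideal.Quotient.mk (compactIdeal Γ D)),
    Ideal.Quotient.mk_eq_mk_iff_sub_mem]

/-- The complement of the essential spectrum is open. -/
theorem isClosed_essentialSpectrum (T : AdjEnd Γ D) : IsClosed (essentialSpectrum T) := by
  rw [← isOpen_compl_iff, Metric.isOpen_iff]
  intro μ hμ
  rw [Set.mem_compl_iff, notMem_essentialSpectrum_iff] at hμ
  obtain ⟨⟨S, hS⟩, S', hS'⟩ := hμ
  -- Within this radius `1 + (ν - μ)S` and `1 + (ν - μ)S'` are invertible by a Neumann series, and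
  -- their inverses correct `S` and `S'` to parametrices at `ν`.
  refine ⟨1 / (‖S‖ + ‖S'‖ + 1), by positivity, fun ν hν => ?_⟩
  rw [Metric.mem_ball, dist_eq_norm, lt_div_iff₀ (by positivity)] at hν
  have hsmall : ∀ R : AdjEnd Γ D, ‖R‖ ≤ ‖S‖ + ‖S'‖ + 1 → IsUnit (1 + (ν - μ) • R) := by
    intro R hR
    have : ‖(μ - ν) • R‖ < 1 := by
      rw [norm_smul, norm_sub_rev]
      exact lt_of_le_of_lt (mul_le_mul_of_nonneg_left hR (norm_nonneg _)) hν
    have h2 := isUnit_one_sub_of_norm_lt_one this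
    rwa [← neg_sub ν μ, neg_smul, sub_neg_eq_add] at h2
  rw [Set.mem_compl_iff, notMem_essentialSpectrum_iff]
  constructor
  · obtain ⟨v, hv⟩ := hsmall S (by linarith [norm_nonneg S'])
    refine ⟨S * ↑v⁻¹, ?_⟩
    have : (ν • 1 - T) * (S * ↑v⁻¹) - 1 = ((μ • 1 - T) * S - 1) * ↑v⁻¹ := by
      have h3 : (ν • 1 - T) * S = ((μ • 1 - T) * S - 1) + v := by
        rw [hv, sub_mul, sub_mul, smul_mul_assoc, smul_mul_assoc, one_mul, sub_smul]; abel
      rw [← mul_assoc, h3, add_mul, Units.mul_inv, add_sub_cancel_right]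
    rw [this]
    exact Ideal.mul_mem_right _ _ hS
  · obtain ⟨v, hv⟩ := hsmall S' (by linarith [norm_nonneg S])
    refine ⟨↑v⁻¹ * S', ?_⟩
    have : (↑v⁻¹ * S') * (ν • 1 - T) - 1 = ↑v⁻¹ * (S' * (μ • 1 - T) - 1) := by
      have h3 : S' * (ν • 1 - T) = (S' * (μ • 1 - T) - 1) + v := by
        rw [hv, mul_sub, mul_sub, mul_smul_comm, mul_smul_comm, mul_one, sub_smul]; abel
      rw [mul_assoc, h3, mul_add, Units.inv_mul, add_sub_cancel_right]
    rw [this]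
    exact Ideal.mul_mem_left _ _ hS'

end Calkin

/-! ### Fredholmness implies invertibility of the limits. -/

section Limits
variable {Γ D D' : Type*} [NonUnitalCStarAlgebra D] [NonUnitalCStarAlgebra D'] [CommGroup Γ]
  {α : Γ →* (D ≃⋆ₐ[ℂ] D)} {l : Filter Γ} {e : L2 Γ D' →L[ℂ] L2 Γ D} {T : AdjEnd Γ D}
  {R : AdjEnd Γ D'}

theorem AdjEnd.TranslatesTo.smul_one_sub (h : AdjEnd.TranslatesTo α l e T R) (μ : ℂ) :
    AdjEnd.TranslatesTo α l e (μ • 1 - T) (μ • 1 - R) :=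
  sub_mem (H := AdjEnd.translateGraph α l e) (x := (μ • 1, μ • 1)) (y := (T, R))
    (AdjEnd.TranslatesTo.one.smul μ) h

/-- Limits at infinity of operators that are left invertible modulo compacts are bounded below. -/
theorem AdjEnd.TranslatesTo.norm_le_of_mem_compactIdeal [l.NeBot] (hl : l ≤ cofinite)
    (h : AdjEnd.TranslatesTo α l e T R) {S : AdjEnd Γ D} (hS : S * T - 1 ∈ compactIdeal Γ D)
    (ψ : L2 Γ D') : ‖e ψ‖ ≤ ‖S‖ * ‖e (R.1 ψ)‖ := by
  have h1 := (h.apply ψ).norm.const_mul ‖S‖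
  have h2 := (((AdjEnd.translatesTo_zero_of_mem_compactIdeal α hS).mono hl).apply (e ψ)).norm
  have h3 := h1.add h2
  simp only [ContinuousLinearMap.id_apply, AdjEnd.zero_apply, norm_zero, add_zero] at h3
  refine ge_of_tendsto' h3 fun s => ?_
  -- This is `1 = S T - (S T - 1)` conjugated by `W_s`; the compact second term disappears in the
  -- limit.
  have h4 : e ψ = (AdjEnd.conj α s S).1 ((AdjEnd.conj α s T).1 (e ψ)) -
      (AdjEnd.conj α s (S * T - 1)).1 (e ψ) := by
    rw [AdjEnd.conj_sub, AdjEnd.conj_mul, AdjEnd.conj_one]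
    simp
  conv_lhs => rw [h4]
  exact (norm_sub_le _ _).trans (add_le_add_left ((AdjEnd.norm_apply_le _ _).trans
    (mul_le_mul_of_nonneg_right (AdjEnd.norm_conj_le α s S) (norm_nonneg _))) _)

end Limits

/-- Approaching a boundary point means leaving every finite subset of `Γ`; this is why compact
operators are invisible to the limits there. -/
theorem comap_nhds_le_cofinite {Γ Ω : Type*} [TopologicalSpace Ω] [T2Space Ω] {ι : Γ → Ω} {ξ : Ω}
    (hξ : ξ ∉ Set.range ι) : comap ι (𝓝 ξ) ≤ cofinite := by
  rw [le_cofinite_iff_compl_singleton_mem]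
  intro x
  refine ⟨{ι x}ᶜ, isClosed_singleton.isOpen_compl.mem_nhds fun h => hξ ⟨x, h.symm⟩, ?_⟩
  rintro y hy rfl
  exact hy rfl

section Inclusion
variable {Γ B Ω : Type*} [CommGroup Γ] [CStarAlgebra B] [TopologicalSpace Ω] [MulAction Γ Ω]
  [ContinuousConstSMul Γ Ω] {β : Γ →* (B ≃⋆ₐ[ℂ] B)}
  {A : NonUnitalStarSubalgebra ℂ (lp (fun _ : Γ => B) ∞)} {ι : Γ → Ω}

theorem IsModelSpace.tendsto_translate_cocompact (hΩ : IsModelSpace A ι) (F : C₀(Ω, B)) (x : Γ) :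
    Tendsto (fun s => restrictGroup ι F (x * s)) (comap ι (cocompact Ω)) (𝓝 0) := by
  have h1 : Tendsto (fun s => F (x • ι s)) (comap ι (cocompact Ω)) (𝓝 0) :=
    (F.zero_at_infty'.comp (Homeomorph.smul (α := Ω) x).isClosedEmbedding.tendsto_cocompact).comp
      tendsto_comap
  refine h1.congr fun s => ?_
  rw [← hΩ.equivariant]
  rfl

/-- If `A` is not unital then `0` belongs to all essential spectra. -/
theorem zero_mem_essentialSpectrum [T2Space Ω] [Nontrivial B] (hΩ : IsModelSpace A ι)
    (h1 : 1 ∉ A) {T : AdjEnd Γ B} (hT : T ∈ interfaceAlgebra β A) :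
    (0 : ℂ) ∈ essentialSpectrum T := by
  by_contra h0
  obtain ⟨-, S, hS⟩ := (notMem_essentialSpectrum_iff T 0).1 h0
  rw [zero_smul, zero_sub] at hS
  have hcpt : ¬ CompactSpace Ω := by
    intro hc
    refine h1 ((hΩ.mem_iff 1).2 ⟨⟨⟨fun _ => 1, continuous_const⟩, ?_⟩, rfl⟩)
    simp
  have hne : (comap ι (cocompact Ω)).NeBot := by
    -- If the complement of a compact set `K` missed `Γ`, density would give `Ω = K`, contrary to
    -- the absence of a unit in `A`.
    refine comap_neBot fun t ht => ?_
    obtain ⟨K, hK, hKt⟩ := mem_cocompact.1 ht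
    by_contra hcon
    push Not at hcon
    have hsub : Set.range ι ⊆ K := by
      rintro _ ⟨x, rfl⟩
      by_contra hx
      exact hcon x (hKt hx)
    have huniv : (Set.univ : Set Ω) ⊆ K := by
      rw [← hΩ.denseRange.closure_range]
      exact closure_minimal hsub hK.isClosed
    exact hcpt ⟨hK.of_isClosed_subset isClosed_univ huniv⟩
  have hle : comap ι (cocompact Ω) ≤ cofinite := by
    rw [le_cofinite_iff_compl_singleton_mem]
    intro x
    refine ⟨{ι x}ᶜ, isCompact_singleton.compl_mem_cocompact, ?_⟩
    rintro y hy rfl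
    exact hy rfl
  have hl : ∀ f ∈ A, ∀ x, Tendsto (fun s => f (x * s)) (comap ι (cocompact Ω)) (𝓝 0) := by
    intro f hf x
    obtain ⟨F, rfl⟩ := (hΩ.mem_iff f).1 hf
    exact hΩ.tendsto_translate_cocompact F x
  -- Along the cocompact filter `-T` translates to `0`, so the parametrix `S` would give `‖δ‖ ≤ ‖S‖
  -- · 0` for a unit vector `δ`.
  have h2 := (translatesTo_zero (β := β) hl hT).smul (-1)
  have h3 := h2.norm_le_of_mem_compactIdeal hle (S := S) (by simpa using hS) (L2.single 1 1)
  rw [ContinuousLinearMap.id_apply, L2.norm_single, norm_one] at h3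
  norm_num at h3

/-- The lower bound at `ξ` depends only on the norm of the parametrix, not on `ξ`, so it passes to
the supremum over the quasi-orbit. The right parametrix does the same for the adjoint. -/
theorem isUnit_of_notMem_essentialSpectrum [T2Space Ω] (hΩ : IsModelSpace A ι) {ω : Ω}
    (hω : (quasiOrbit Γ ω : Set Ω) ⊆ (Set.range ι)ᶜ) {T : AdjEnd Γ B}
    {R : AdjEnd Γ C₀(quasiOrbit Γ ω, B)}
    (h : ∀ ξ : quasiOrbit Γ ω,
      AdjEnd.TranslatesTo β (comap ι (𝓝 (ξ : Ω))) (L2.evalAt ξ) T R)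
    {μ : ℂ} (hμ : μ ∉ essentialSpectrum T) : IsUnit (μ • 1 - R) := by
  have aux : ∀ {T : AdjEnd Γ B} {R : AdjEnd Γ C₀(quasiOrbit Γ ω, B)},
      (∀ ξ : quasiOrbit Γ ω, AdjEnd.TranslatesTo β (comap ι (𝓝 (ξ : Ω))) (L2.evalAt ξ) T R) →
      ∀ {S}, S * T - 1 ∈ compactIdeal Γ B → ∀ ψ, (‖S‖ + 1)⁻¹ * ‖ψ‖ ≤ ‖R.1 ψ‖ := by
    intro T R h S hS ψ
    rw [inv_mul_le_iff₀ (by positivity)]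
    refine L2.norm_le_of_evalAt (by positivity) fun ξ => ?_
    have := hΩ.comap_nhds_neBot (ξ : Ω)
    refine ((h ξ).norm_le_of_mem_compactIdeal (comap_nhds_le_cofinite (hω ξ.2)) hS ψ).trans ?_
    exact mul_le_mul (by linarith) (L2.norm_evalAt_le ξ _) (norm_nonneg _) (by positivity)
  obtain ⟨⟨S', hS'⟩, S, hS⟩ := (notMem_essentialSpectrum_iff T μ).1 hμ
  refine AdjEnd.isUnit_of_bounded_below (by positivity) (by positivity)
    (aux (fun ξ => (h ξ).smul_one_sub μ) hS)
    (aux (fun ξ => ((h ξ).smul_one_sub μ).star) (S := star S') ?_)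
  have := star_mem_compactIdeal hS'
  rwa [star_sub, star_mul, star_one] at this

end Inclusion

/-! ### Følner sets in abelian groups. -/

section Foelner
variable {Γ : Type*} [CommGroup Γ]

open Classical in
/-- Approximate invariance of a finite set `F` under the elements of `K`. -/
def IsFoelnerSet (K : Finset Γ) (δ : ℝ) (F : Finset Γ) : Prop :=
  F.Nonempty ∧ ∀ g ∈ K, (1 - δ) * F.card ≤ (F.filter fun x => g⁻¹ * x ∈ F).card

-- The sets `b n` of products of elements of `K` with exponents at most `n` grow polynomially, so
-- `|b (n+1)| ≤ (1+δ)|b n|` for some `n`. Both `b n` and `g b n` lie in `b (n+1)`, which forces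
-- their overlap to be at least `(1-δ)|b n|`.
open Classical in
theorem exists_isFoelnerSet (K : Finset Γ) {δ : ℝ} (hδ : 0 < δ) : ∃ F, IsFoelnerSet K δ F := by
  let b : ℕ → Finset Γ := fun n =>
    (Fintype.piFinset fun _ : K => Finset.range (n + 1)).image fun v => ∏ s : K, (s : Γ) ^ v s
  have hmem : ∀ n x, x ∈ b n ↔ ∃ v : K → ℕ, (∀ s, v s < n + 1) ∧ ∏ s : K, (s : Γ) ^ v s = x := by
    intro n x
    simp [b]
  have hcard : ∀ n, (b n).card ≤ (n + 1) ^ K.card := fun n => by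
    refine Finset.card_image_le.trans ?_
    simp [Fintype.card_piFinset]
  have hne : ∀ n, (b n).Nonempty := fun n => ⟨1, (hmem n 1).2 ⟨0, by simp, by simp⟩⟩
  have hmono : ∀ n, b n ⊆ b (n + 1) := fun n x hx => by
    obtain ⟨v, hv, rfl⟩ := (hmem n x).1 hx
    exact (hmem _ _).2 ⟨v, fun s => (hv s).trans (Nat.lt_succ_self _), rfl⟩
  have hshift : ∀ n, ∀ g ∈ K, (b n).image (g * ·) ⊆ b (n + 1) := by
    intro n g hg y hy
    obtain ⟨x, hx, rfl⟩ := Finset.mem_image.1 hy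
    obtain ⟨v, hv, rfl⟩ := (hmem n x).1 hx
    refine (hmem _ _).2 ⟨fun s => v s + if s = ⟨g, hg⟩ then 1 else 0, fun s => ?_, ?_⟩
    · have := hv s
      dsimp only
      split_ifs <;> omega
    · simp only [pow_add, Finset.prod_mul_distrib]
      rw [mul_comm]
      congr 1
      rw [Finset.prod_eq_single ⟨g, hg⟩]
      · simp
      · intro s _ hs; simp [hs]
      · simp
  obtain ⟨n, hn⟩ : ∃ n, ((b (n + 1)).card : ℝ) ≤ (1 + δ) * (b n).card := by
    by_contra hcon
    push Not at hcon
    have hgrow : ∀ n, (1 + δ) ^ n ≤ ((b n).card : ℝ) := by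
      intro n
      induction n with
      | zero => simpa using (hne 0).card_pos
      | succ n ih =>
        rw [pow_succ, mul_comm]
        exact (mul_le_mul_of_nonneg_left ih (by positivity)).trans (hcon n).le
    have h1 := tendsto_pow_const_div_const_pow_of_one_lt K.card (show 1 < 1 + δ by linarith)
    have h2 := (tendsto_add_atTop_iff_nat 1).2 h1
    have h3 : Tendsto (fun n : ℕ => ((n + 1 : ℕ) : ℝ) ^ K.card / (1 + δ) ^ (n + 1) * (1 + δ)) atTop
        (𝓝 0) := by simpa using h2.mul_const (1 + δ)
    have h4 : (1 : ℝ) ≤ 0 := by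
      refine ge_of_tendsto' h3 fun n => ?_
      rw [pow_succ, div_mul_eq_mul_div, mul_div_mul_right _ _ (by positivity), le_div_iff₀
        (by positivity), one_mul]
      exact (hgrow n).trans (by exact_mod_cast hcard n)
    norm_num at h4
  refine ⟨b n, hne n, fun g hg => ?_⟩
  have h1 : (b n).filter (fun x => g⁻¹ * x ∈ b n) = b n ∩ (b n).image (g * ·) := by
    ext x
    simp only [Finset.mem_filter, Finset.mem_inter, Finset.mem_image, and_congr_right_iff]
    exact fun _ => ⟨fun h => ⟨_, h, mul_inv_cancel_left g x⟩, by
      rintro ⟨y, hy, rfl⟩; rwa [inv_mul_cancel_left]⟩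
  have h2 := Finset.card_inter_add_card_union (b n) ((b n).image (g * ·))
  rw [Finset.card_image_of_injective _ (mul_right_injective g)] at h2
  have h3 := Finset.card_le_card (Finset.union_subset (hmono n) (hshift n g hg))
  rw [h1]
  have h4 : ((b n ∩ (b n).image (g * ·)).card : ℝ) + (b n ∪ (b n).image (g * ·)).card =
      (b n).card + (b n).card := by exact_mod_cast h2
  have h5 : ((b n ∪ (b n).image (g * ·)).card : ℝ) ≤ (b (n + 1)).card := by exact_mod_cast h3
  linarith

end Foelner

/-! ### Banded operators and averaging over translates of a Følner set. -/

section Banded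

theorem mulOp_mul_mulOp {Γ D : Type*} [NonUnitalCStarAlgebra D]
    (a b : lp (fun _ : Γ => D) ∞) : mulOp a * mulOp b = mulOp (a * b) := by
  ext ψ x
  exact (mul_assoc (a x) (b x) (ψ x)).symm

variable {Γ D : Type*} [NonUnitalCStarAlgebra D] [CommGroup Γ]

/-- The shifted function `x ↦ a(h x)`. -/
noncomputable def shiftFun (h : Γ) (a : lp (fun _ : Γ => D) ∞) : lp (fun _ : Γ => D) ∞ :=
  ⟨fun x => a (h * x), memℓp_infty ⟨‖a‖, by
    rintro _ ⟨x, rfl⟩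
    exact lp.norm_apply_le_norm ENNReal.top_ne_zero a _⟩⟩

theorem mulOp_mul_shiftOp (a : lp (fun _ : Γ => D) ∞) (h : Γ) :
    mulOp a * shiftOp h = shiftOp h * mulOp (shiftFun h a) := by
  ext ψ x
  change a x * ψ (h⁻¹ * x) = a (h * (h⁻¹ * x)) * ψ (h⁻¹ * x)
  rw [mul_inv_cancel_left]

theorem shiftOp_mul_shiftOp (g h : Γ) :
    (shiftOp g * shiftOp h : AdjEnd Γ D) = shiftOp (g * h) := by
  ext ψ x
  change ψ (h⁻¹ * (g⁻¹ * x)) = ψ ((g * h)⁻¹ * x)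
  rw [mul_inv_rev, mul_assoc]

variable (Γ D) in
/-- The ⋆-algebra of finite sums of operators `S_g a` with bounded functions `a`. -/
noncomputable def banded : NonUnitalStarSubalgebra ℂ (AdjEnd Γ D) where
  __ := Submodule.span ℂ {T : AdjEnd Γ D | ∃ g a, T = shiftOp g * mulOp a}
  mul_mem' {T S} hT hS := by
    refine Submodule.span_induction ?_ ?_ ?_ ?_ hT
    · rintro _ ⟨g, a, rfl⟩
      refine Submodule.span_induction ?_ ?_ ?_ ?_ hS
      · rintro _ ⟨h, b, rfl⟩
        refine Submodule.subset_span ⟨g * h, shiftFun h a * b, ?_⟩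
        rw [mul_assoc, ← mul_assoc (mulOp a), mulOp_mul_shiftOp, mul_assoc, mulOp_mul_mulOp,
          ← mul_assoc, shiftOp_mul_shiftOp]
      · rw [mul_zero]; exact Submodule.zero_mem _
      · intro x y _ _ hx hy
        rw [mul_add]; exact Submodule.add_mem _ hx hy
      · intro c x _ hx
        rw [mul_smul_comm]; exact Submodule.smul_mem _ c hx
    · rw [zero_mul]; exact Submodule.zero_mem _
    · intro x y _ _ hx hy
      rw [add_mul]; exact Submodule.add_mem _ hx hy
    · intro c x _ hx
      rw [smul_mul_assoc]; exact Submodule.smul_mem _ c hx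
  star_mem' {T} hT := by
    refine Submodule.span_induction ?_ ?_ ?_ ?_ hT
    · rintro _ ⟨g, a, rfl⟩
      refine Submodule.subset_span ⟨g⁻¹, shiftFun g⁻¹ (star a), ?_⟩
      rw [star_mul, AdjEnd.star_mulOp, AdjEnd.star_shiftOp, mulOp_mul_shiftOp]
    · rw [star_zero]; exact Submodule.zero_mem _
    · intro x y _ _ hx hy
      rw [star_add]; exact Submodule.add_mem _ hx hy
    · intro c x _ hx
      rw [star_smul]; exact Submodule.smul_mem _ _ hx

theorem mem_banded_iff {T : AdjEnd Γ D} : T ∈ banded Γ D ↔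
    T ∈ Submodule.span ℂ {T : AdjEnd Γ D | ∃ g a, T = shiftOp g * mulOp a} := Iff.rfl

theorem generatedBy_le_banded (α : Γ →* (D ≃⋆ₐ[ℂ] D)) (F : Set (lp (fun _ : Γ => D) ∞)) :
    generatedBy α F ≤ (banded Γ D).topologicalClosure :=
  generatedBy_le (NonUnitalStarSubalgebra.isClosed_topologicalClosure _) fun g _ _ =>
    NonUnitalStarSubalgebra.le_topologicalClosure _ (Submodule.subset_span ⟨g, _, rfl⟩)

theorem one_eq_shiftOp_mul_mulOp {B : Type*} [CStarAlgebra B] :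
    (1 : AdjEnd Γ B) = shiftOp 1 * mulOp (constFun Γ 1) := by
  ext ψ x
  change ψ x = 1 * ψ (1⁻¹ * x)
  simp

theorem one_mem_banded {B : Type*} [CStarAlgebra B] : (1 : AdjEnd Γ B) ∈ banded Γ B :=
  mem_banded_iff.2 (Submodule.subset_span ⟨1, _, one_eq_shiftOp_mul_mulOp⟩)

open Classical in
/-- The translates of the finite set `F` that meet the finite set `E` are indexed by this set. -/
noncomputable def meetingTranslates (F E : Finset Γ) : Finset Γ :=
  (F ×ˢ E).image fun p => p.1⁻¹ * p.2

/-- The translate of `F` by `t`, as a set. -/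
def translateSet (F : Finset Γ) (t : Γ) : Set Γ := {x | x * t⁻¹ ∈ F}

-- The term pairing `x` with `g⁻¹x` survives the cut to `F t` exactly when `x t⁻¹ ∈ F ∩ gF`. The
-- number of such `t` is `|F ∩ gF|` whatever `x` is, so averaging multiplies the form of a monomial
-- by a scalar.
open Classical in
theorem sum_ip_restrict (F E : Finset Γ) (g : Γ) (a : lp (fun _ : Γ => D) ∞) {χ : L2 Γ D}
    (hχ : ∀ x ∉ E, χ x = 0) :
    ∑ t ∈ meetingTranslates F E, L2.ip (χ.restrict (translateSet F t))
        ((shiftOp g * mulOp a).1 (χ.restrict (translateSet F t))) =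
      ((F.filter fun x => g⁻¹ * x ∈ F).card : ℂ) • L2.ip χ ((shiftOp g * mulOp a).1 χ) := by
  have h1 : HasSum (fun x => ∑ t ∈ meetingTranslates F E,
      star (χ.restrict (translateSet F t) x) *
        ((shiftOp g * mulOp a).1 (χ.restrict (translateSet F t))) x)
      (∑ t ∈ meetingTranslates F E, L2.ip (χ.restrict (translateSet F t))
        ((shiftOp g * mulOp a).1 (χ.restrict (translateSet F t)))) :=
    hasSum_sum fun t _ => L2.hasSum_ip _ _
  refine h1.unique (((L2.hasSum_ip χ ((shiftOp g * mulOp a).1 χ)).const_smul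
    ((F.filter fun x => g⁻¹ * x ∈ F).card : ℂ)).congr_fun fun x => ?_)
  by_cases hx : x ∈ E
  · have h2 : ∀ t, star (χ.restrict (translateSet F t) x) *
        ((shiftOp g * mulOp a).1 (χ.restrict (translateSet F t))) x =
        if x * t⁻¹ ∈ F ∧ g⁻¹ * (x * t⁻¹) ∈ F then
          star (χ x) * ((shiftOp g * mulOp a).1 χ) x else 0 := by
      intro t
      change star (χ.restrict (translateSet F t) x) *
        (a (g⁻¹ * x) * χ.restrict (translateSet F t) (g⁻¹ * x)) = if _ then
          star (χ x) * (a (g⁻¹ * x) * χ (g⁻¹ * x)) else 0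
      rw [L2.restrict_apply, L2.restrict_apply]
      by_cases p : x * t⁻¹ ∈ F
      · by_cases q : g⁻¹ * (x * t⁻¹) ∈ F
        · rw [if_pos ⟨p, q⟩, Set.indicator_of_mem (by exact p),
            Set.indicator_of_mem (by rwa [translateSet, Set.mem_ofPred_eq, mul_assoc])]
        · rw [if_neg (fun h => q h.2), Set.indicator_of_notMem (a := g⁻¹ * x)
            (by rwa [translateSet, Set.mem_ofPred_eq, mul_assoc]), mul_zero, mul_zero]
      · rw [if_neg (fun h => p h.1), Set.indicator_of_notMem (a := x) (by exact p), star_zero,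
          zero_mul]
    simp only [h2]
    rw [← Finset.sum_filter, Finset.sum_const, ← Nat.cast_smul_eq_nsmul ℂ]
    congr 2
    refine Finset.card_nbij' (fun t => x * t⁻¹) (fun f => f⁻¹ * x) ?_ ?_ ?_ ?_
    · intro t ht
      simpa using (Finset.mem_filter.1 ht).2
    · intro f hf
      have hf := Finset.mem_filter.1 hf
      refine Finset.mem_coe.2 (Finset.mem_filter.2 ⟨Finset.mem_image.2
        ⟨(f, x), Finset.mem_product.2 ⟨hf.1, hx⟩, rfl⟩, ?_⟩)
      have : x * (f⁻¹ * x)⁻¹ = f := by rw [mul_inv_rev, inv_inv, mul_inv_cancel_left]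
      rwa [this]
    · intro t _
      simp
    · intro f _
      simp
  · have hz : χ x = 0 := hχ x hx
    have h3 : ∀ t, χ.restrict (translateSet F t) x = 0 := fun t => by
      rw [L2.restrict_apply]
      by_cases h : x ∈ translateSet F t
      · rw [Set.indicator_of_mem h, hz]
      · rw [Set.indicator_of_notMem h]
    simp [h3, hz]

theorem IsFoelnerSet.mono {K K' F : Finset Γ} {δ δ' : ℝ} (hK : K ⊆ K') (hδ : δ' ≤ δ)
    (h : IsFoelnerSet K' δ' F) : IsFoelnerSet K δ F :=
  ⟨h.1, fun g hg => le_trans (mul_le_mul_of_nonneg_right (by linarith) (by positivity))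
    (h.2 g (hK hg))⟩

/-- Cutting down a banded operator to the translates of a Følner set changes it little. -/
theorem exists_foelner_sum_ip {X : AdjEnd Γ D} (hX : X ∈ banded Γ D) {ε : ℝ} (hε : 0 < ε) :
    ∃ (K : Finset Γ) (δ : ℝ), 0 < δ ∧ ∀ F, IsFoelnerSet K δ F → ∃ Y : AdjEnd Γ D, ‖Y‖ ≤ ε ∧
      ∀ (E : Finset Γ) (χ : L2 Γ D), (∀ x ∉ E, χ x = 0) →
        ∑ t ∈ meetingTranslates F E, L2.ip (χ.restrict (translateSet F t))
          (X.1 (χ.restrict (translateSet F t))) =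
        (F.card : ℂ) • (L2.ip χ (X.1 χ) + L2.ip χ (Y.1 χ)) := by
  classical
  revert ε
  refine Submodule.span_induction (p := fun X _ => ∀ {ε : ℝ}, 0 < ε → ∃ (K : Finset Γ) (δ : ℝ),
    0 < δ ∧ ∀ F, IsFoelnerSet K δ F → ∃ Y : AdjEnd Γ D, ‖Y‖ ≤ ε ∧
      ∀ (E : Finset Γ) (χ : L2 Γ D), (∀ x ∉ E, χ x = 0) →
        ∑ t ∈ meetingTranslates F E, L2.ip (χ.restrict (translateSet F t))
          (X.1 (χ.restrict (translateSet F t))) =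
        (F.card : ℂ) • (L2.ip χ (X.1 χ) + L2.ip χ (Y.1 χ))) ?_ ?_ ?_ ?_ (mem_banded_iff.1 hX)
  · rintro _ ⟨g, a, rfl⟩ ε hε
    set T : AdjEnd Γ D := shiftOp g * mulOp a
    refine ⟨{g}, ε / (‖T‖ + 1), by positivity, fun F hF => ?_⟩
    have hF0 : (0 : ℝ) < F.card := by exact_mod_cast hF.1.card_pos
    set r : ℝ := (F.filter fun x => g⁻¹ * x ∈ F).card / F.card with hr
    have hr1 : r ≤ 1 := by
      rw [hr, div_le_one hF0]
      exact_mod_cast Finset.card_filter_le _ _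
    have hr2 : 1 - ε / (‖T‖ + 1) ≤ r := by
      rw [hr, le_div_iff₀ hF0]
      exact hF.2 g (Finset.mem_singleton_self g)
    -- Here `r = |F ∩ gF| / |F|`, and `δ` was chosen so that `(1 - r)‖T‖ ≤ ε`. The error is one
    -- operator, independent of `χ`, so it can be estimated in the order of the coefficients.
    refine ⟨((r - 1 : ℝ) : ℂ) • T, ?_, fun E χ hχ => ?_⟩
    · rw [norm_smul, Complex.norm_real, Real.norm_eq_abs, abs_of_nonpos (by linarith)]
      have h1 : -(r - 1) ≤ ε / (‖T‖ + 1) := by linarith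
      calc -(r - 1) * ‖T‖ ≤ ε / (‖T‖ + 1) * (‖T‖ + 1) :=
            mul_le_mul h1 (by linarith) (norm_nonneg _) (by positivity)
        _ = ε := div_mul_cancel₀ _ (by positivity)
    · rw [sum_ip_restrict F E g a hχ, AdjEnd.smul_apply, L2.ip_smul_right]
      have h2 : ((F.filter fun x => g⁻¹ * x ∈ F).card : ℂ) = F.card * (r : ℂ) := by
        rw [hr]
        push_cast
        rw [mul_div_cancel₀]
        exact_mod_cast hF0.ne'
      rw [h2, mul_smul]
      congr 1
      push_cast
      rw [sub_smul, one_smul, add_sub_cancel]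
  · intro ε hε
    refine ⟨∅, 1, one_pos, fun F _ => ⟨0, by simpa using hε.le, fun E χ _ => ?_⟩⟩
    have : ∀ φ : L2 Γ D, L2.ip φ (0 : L2 Γ D) = 0 := fun φ => by simp [L2.ip]
    simp [this]
  · intro X X' _ _ h h' ε hε
    obtain ⟨K, δ, hδ, hK⟩ := h (half_pos hε)
    obtain ⟨K', δ', hδ', hK'⟩ := h' (half_pos hε)
    refine ⟨K ∪ K', min δ δ', lt_min hδ hδ', fun F hF => ?_⟩
    obtain ⟨Y, hY, e⟩ := hK F (hF.mono Finset.subset_union_left (min_le_left _ _))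
    obtain ⟨Y', hY', e'⟩ := hK' F (hF.mono Finset.subset_union_right (min_le_right _ _))
    refine ⟨Y + Y', (norm_add_le _ _).trans (by linarith), fun E χ hχ => ?_⟩
    simp only [AdjEnd.add_apply, L2.ip_add_right, Finset.sum_add_distrib, e E χ hχ, e' E χ hχ]
    rw [← smul_add]
    congr 1
    abel
  · intro c X _ h ε hε
    obtain ⟨K, δ, hδ, hK⟩ := h (ε := ε / (‖c‖ + 1)) (by positivity)
    refine ⟨K, δ, hδ, fun F hF => ?_⟩
    obtain ⟨Y, hY, e⟩ := hK F hF
    refine ⟨c • Y, ?_, fun E χ hχ => ?_⟩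
    · rw [norm_smul]
      calc ‖c‖ * ‖Y‖ ≤ (‖c‖ + 1) * (ε / (‖c‖ + 1)) :=
            mul_le_mul (by linarith) hY (norm_nonneg _) (by positivity)
        _ = ε := mul_div_cancel₀ _ (by positivity)
    · simp only [AdjEnd.smul_apply, L2.ip_smul_right, ← Finset.smul_sum, e E χ hχ]
      rw [← smul_add, smul_comm]

end Banded

/-! ### Order-theoretic lower bounds and their localisation. -/

section Form
variable {Γ D : Type*} [NonUnitalCStarAlgebra D]

theorem L2.ip_real_smul_right (r : ℝ) (ψ φ : L2 Γ D) : L2.ip ψ ((r : ℂ) • φ) = r • L2.ip ψ φ := by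
  rw [L2.ip_smul_right, Complex.coe_smul]

theorem star_ip_apply {Z : AdjEnd Γ D} (hZ : IsSelfAdjoint Z) (χ : L2 Γ D) :
    star (L2.ip χ (Z.1 χ)) = L2.ip χ (Z.1 χ) := by
  rw [L2.star_ip, AdjEnd.ip_apply_left, hZ.star_eq]

variable [PartialOrder D] [StarOrderedRing D]

/-- Only the value of the form at `χ` is required to be self-adjoint, as the perturbations met later
need not be self-adjoint operators. At such `χ`, `Z` may be replaced by its real part `W`, and `W ≤
‖W‖`. -/
theorem ip_apply_le {Z : AdjEnd Γ D} {χ : L2 Γ D} (h : star (L2.ip χ (Z.1 χ)) = L2.ip χ (Z.1 χ)) :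
    L2.ip χ (Z.1 χ) ≤ ‖Z‖ • L2.ip χ χ := by
  set W : AdjEnd Γ D := (1 / 2 : ℂ) • (Z + star Z) with hW
  have hWs : IsSelfAdjoint W := by
    rw [IsSelfAdjoint, hW, star_smul, star_add, star_star, add_comm (star Z)]
    norm_num
  have hWn : ‖W‖ ≤ ‖Z‖ := by
    rw [hW, norm_smul]
    have := norm_add_le Z (star Z)
    rw [norm_star] at this
    norm_num
    linarith
  have e : L2.ip χ (Z.1 χ) = L2.ip χ (W.1 χ) := by
    rw [hW, AdjEnd.smul_apply, AdjEnd.add_apply, L2.ip_smul_right, L2.ip_add_right,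
      ← AdjEnd.ip_apply_left, ← L2.star_ip χ, h, ← two_smul ℂ, smul_smul]
    norm_num
  have h1 : 0 ≤ (‖W‖ : ℂ) • (1 : AdjEnd Γ D) - W := by
    have := hWs.le_algebraMap_norm_self
    rwa [← sub_nonneg, Algebra.algebraMap_eq_smul_one] at this
  have h2 := AdjEnd.ip_nonneg h1 χ
  have h3 : L2.ip χ (((‖W‖ : ℂ) • (1 : AdjEnd Γ D) - W).1 χ) =
      ‖W‖ • L2.ip χ χ - L2.ip χ (W.1 χ) := by
    have h4 := L2.ip_add_right χ (((‖W‖ : ℂ) • (1 : AdjEnd Γ D) - W).1 χ) (W.1 χ)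
    rw [eq_sub_iff_add_eq, ← h4, AdjEnd.sub_apply, sub_add_cancel, AdjEnd.smul_apply,
      AdjEnd.one_apply, L2.ip_real_smul_right]
  rw [h3, sub_nonneg] at h2
  rw [e]
  exact h2.trans (smul_le_smul_of_nonneg_right hWn (L2.ip_self_nonneg χ))

/-- The quadratic form of `X` is at least `c` on finitely supported functions that vanish
outside `E`. -/
def FormLE (c : ℝ) (X : AdjEnd Γ D) (E : Set Γ) : Prop :=
  ∀ χ : L2 Γ D, (Function.support fun x => χ x).Finite → (∀ x ∉ E, χ x = 0) →
    c • L2.ip χ χ ≤ L2.ip χ (X.1 χ)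

theorem FormLE.mono {c c' : ℝ} {X : AdjEnd Γ D} {E E' : Set Γ} (hc : c' ≤ c) (hE : E' ⊆ E)
    (h : FormLE c X E) : FormLE c' X E' := fun χ hf hχ =>
  (smul_le_smul_of_nonneg_right hc (L2.ip_self_nonneg χ)).trans
    (h χ hf fun x hx => hχ x fun h => hx (hE h))

/-- Perturbation of lower bounds. -/
theorem FormLE.of_norm_sub_le {c ε : ℝ} {X Z : AdjEnd Γ D} {E : Set Γ} (h : FormLE c X E)
    (hX : IsSelfAdjoint X) (hZ : IsSelfAdjoint Z) {P : AdjEnd Γ D}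
    (hP : ∀ χ : L2 Γ D, (∀ x ∉ E, χ x = 0) → P.1 χ = χ) (hn : ‖(X - Z) * P‖ ≤ ε) :
    FormLE (c - ε) Z E := by
  intro χ hf hχ
  have h1 : L2.ip χ (((X - Z) * P).1 χ) = L2.ip χ ((X - Z).1 χ) := by
    rw [AdjEnd.mul_apply, hP χ hχ]
  have h2 := ip_apply_le (Z := (X - Z) * P) (χ := χ) (by rw [h1]; exact star_ip_apply (hX.sub hZ) χ)
  have h3 : L2.ip χ (X.1 χ) = L2.ip χ ((X - Z).1 χ) + L2.ip χ (Z.1 χ) := by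
    rw [← L2.ip_add_right, AdjEnd.sub_apply, sub_add_cancel]
  rw [h1] at h2
  have h4 := h χ hf hχ
  rw [h3] at h4
  rw [sub_smul, sub_le_iff_le_add']
  exact h4.trans (add_le_add_left (h2.trans
    (smul_le_smul_of_nonneg_right hn (L2.ip_self_nonneg χ))) _)

variable [CommGroup Γ]

/-- `W_s` carries functions supported in `F s` to functions supported in `F` and changes the forms
by `α_s`, which preserves order in both directions. -/
theorem FormLE.of_conj {α : Γ →* (D ≃⋆ₐ[ℂ] D)} {c : ℝ} {X : AdjEnd Γ D} {s : Γ} {F : Finset Γ}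
    (h : FormLE c (AdjEnd.conj α s X) F) : FormLE c X (translateSet F s) := by
  intro χ hf hχ
  have h1 := h (L2.twist α s χ) ?_ ?_
  · rw [AdjEnd.conj_apply, L2.twist_inv_twist, L2.ip_twist, L2.ip_twist, ← Complex.coe_smul,
      ← map_smul] at h1
    have h2 := OrderHomClass.mono (α s⁻¹) h1
    simp only [← StarAlgEquiv.mul_apply, ← map_mul, inv_mul_cancel, map_one,
      StarAlgEquiv.one_apply] at h2
    rwa [Complex.coe_smul] at h2
  · refine (hf.preimage (mul_left_injective s).injOn).subset fun x hx => ?_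
    intro h0
    refine hx ?_
    change α s (χ (x * s)) = 0
    rw [show χ (x * s) = 0 from h0, map_zero]
  · intro x hx
    rw [L2.twist_apply, hχ, map_zero]
    intro h
    exact hx (by simpa [translateSet] using h)

/-- Localisation of lower bounds to translates of a finite set. -/
theorem exists_localisation {B : Type*} [CStarAlgebra B] [PartialOrder B] [StarOrderedRing B]
    {X : AdjEnd Γ B} (hX : IsSelfAdjoint X)
    (hb : X ∈ (banded Γ B).topologicalClosure) {ε : ℝ} (hε : 0 < ε) :
    ∃ F : Finset Γ, ∀ (E : Set Γ) (c : ℝ), (∀ t, FormLE c X (E ∩ translateSet F t)) →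
      FormLE (c - ε) X E := by
  classical
  obtain ⟨X₀, hX₀, hd⟩ := Metric.mem_closure_iff.1 hb (ε / 3) (by positivity)
  rw [dist_eq_norm] at hd
  -- The loss `ε` is spent in thirds: from `X` to the banded `X₁` on the pieces, on the Følner error
  -- `Y`, and from `X₁` back to `X`.
  obtain ⟨X₁, hX₁, hs₁, hd₁⟩ : ∃ X₁ ∈ banded Γ B, IsSelfAdjoint X₁ ∧ ‖X - X₁‖ ≤ ε / 3 := by
    refine ⟨(1 / 2 : ℂ) • (X₀ + star X₀), SMulMemClass.smul_mem _ (add_mem hX₀ (star_mem hX₀)),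
      ?_, ?_⟩
    · rw [IsSelfAdjoint, star_smul, star_add, star_star, add_comm (star X₀)]
      norm_num
    · have h1 : X - (1 / 2 : ℂ) • (X₀ + star X₀) =
          (1 / 2 : ℂ) • ((X - X₀) + star (X - X₀)) := by
        rw [star_sub, hX.star_eq]
        have : X = (1 / 2 : ℂ) • (X + X) := by rw [← two_smul ℂ, smul_smul]; norm_num
        nth_rw 1 [this]
        rw [← smul_sub]
        congr 1
        abel
      rw [h1, norm_smul]
      have := norm_add_le (X - X₀) (star (X - X₀))
      rw [norm_star] at this
      have h2 : ‖(1 / 2 : ℂ)‖ = 1 / 2 := by norm_num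
      rw [h2]
      linarith
  obtain ⟨K, δ, hδ, hK⟩ := exists_foelner_sum_ip hX₁ (show 0 < ε / 3 by positivity)
  obtain ⟨F, hF⟩ := exists_isFoelnerSet K hδ
  obtain ⟨Y, hY, hsum⟩ := hK F hF
  have hF0 : (0 : ℝ) < F.card := by exact_mod_cast hF.1.card_pos
  refine ⟨F, fun E c h χ hf hχ => ?_⟩
  have hE : ∀ x ∉ hf.toFinset, χ x = 0 := fun x hx => by simpa using hx
  have hsum1 := hsum hf.toFinset χ hE
  -- For `g = 1` the overlap is all of `F`: the squared lengths of the pieces sum exactly to `|F|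
  -- (χ|χ)`.
  have hone := sum_ip_restrict F hf.toFinset 1 (constFun Γ (1 : B)) hE
  rw [← one_eq_shiftOp_mul_mulOp] at hone
  simp only [AdjEnd.one_apply, inv_one, one_mul, Finset.filter_mem_eq_inter, Finset.inter_self]
    at hone
  set Q := meetingTranslates F hf.toFinset
  have hrs : ∀ t,
      (c - ε / 3) • L2.ip (χ.restrict (translateSet F t)) (χ.restrict (translateSet F t))
      ≤ L2.ip (χ.restrict (translateSet F t)) (X₁.1 (χ.restrict (translateSet F t))) := by
    intro t
    have h1 : FormLE (c - ε / 3) X₁ (E ∩ translateSet F t) :=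
      (h t).of_norm_sub_le hX hs₁ (P := 1) (fun _ _ => rfl) (by rwa [mul_one])
    refine h1 _ (hf.subset fun x hx h0 => hx ?_) fun x hx => ?_
    · dsimp only at h0 ⊢
      rw [L2.restrict_apply]
      by_cases hm : x ∈ translateSet F t
      · rw [Set.indicator_of_mem hm, h0]
      · rw [Set.indicator_of_notMem hm]
    · rw [L2.restrict_apply]
      by_cases hm : x ∈ translateSet F t
      · rw [Set.indicator_of_mem hm]
        exact hχ x fun hxE => hx ⟨hxE, hm⟩
      · rw [Set.indicator_of_notMem hm]
  have hle := Finset.sum_le_sum fun t (_ : t ∈ Q) => hrs t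
  rw [← Finset.smul_sum, hone, hsum1] at hle
  have hcast : ∀ b : B, (F.card : ℂ) • b = (F.card : ℝ) • b := fun b => by
    rw [← Complex.coe_smul]; simp
  rw [hcast, hcast, smul_comm, smul_le_smul_iff_of_pos_left hF0] at hle
  -- `Y` itself need not be self-adjoint, but its form at `χ` is a difference of self-adjoint values
  -- of the forms of `X₁`.
  have hYs : star (L2.ip χ (Y.1 χ)) = L2.ip χ (Y.1 χ) := by
    have h1 := congrArg star hsum1
    rw [star_sum] at h1
    simp only [star_ip_apply hs₁] at h1
    rw [hsum1, hcast, star_smul, star_add, star_ip_apply hs₁, star_trivial] at h1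
    have h2 := (smul_right_injective B hF0.ne' h1)
    exact (add_left_cancel h2).symm
  have h3 := (ip_apply_le hYs).trans (smul_le_smul_of_nonneg_right hY (L2.ip_self_nonneg χ))
  have h4 := ip_apply_le (star_ip_apply (hs₁.sub hX) χ)
  have hX' : ‖X₁ - X‖ ≤ ε / 3 := by rwa [norm_sub_rev]
  have h5 := h4.trans (smul_le_smul_of_nonneg_right hX' (L2.ip_self_nonneg χ))
  have h6 : L2.ip χ (X₁.1 χ) = L2.ip χ ((X₁ - X).1 χ) + L2.ip χ (X.1 χ) := by
    rw [← L2.ip_add_right, AdjEnd.sub_apply, sub_add_cancel]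
  rw [h6] at hle
  have h7 := hle.trans (add_le_add (add_le_add_left h5 _) h3)
  have h8 : (c - ε) • L2.ip χ χ = (c - ε / 3) • L2.ip χ χ - (ε / 3) • L2.ip χ χ -
      (ε / 3) • L2.ip χ χ := by
    rw [← sub_smul, ← sub_smul]
    congr 1
    ring
  rw [h8, sub_sub, sub_le_iff_le_add]
  refine h7.trans (le_of_eq ?_)
  abel

/-- A failure on `E` localises to a failure on `E ∩ F_n t`, with threshold raised by `2⁻ⁿ`, and the
lower scales are handled inside this set. Any `s ∈ F_n t` satisfies `F_n t ⊆ G_n s`, so one point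
serves all scales. The losses `2⁻ᵏ + ⋯ + 2⁻⁽ⁿ⁻¹⁾` sum to `2/2ᵏ - 2/2ⁿ`. -/
theorem exists_nested {X : AdjEnd Γ D} {F : ℕ → Finset Γ}
    (hF : ∀ n (E : Set Γ) c, (∀ t, FormLE c X (E ∩ translateSet (F n) t)) →
      FormLE (c - 1 / 2 ^ n) X E) {G : ℕ → Finset Γ}
    (hG : ∀ n, ∀ x ∈ F n, ∀ y ∈ F n, x * y⁻¹ ∈ G n) (n : ℕ) :
    ∀ (E : Set Γ) (c : ℝ), ¬ FormLE c X E → ∃ s ∈ E, ∀ k < n,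
      ¬ FormLE (c + 2 / 2 ^ k - 2 / 2 ^ n) X (translateSet (G k) s) := by
  induction n with
  | zero =>
    intro E c h
    by_contra hcon
    push Not at hcon
    -- With no scales left, only a point of `E` is needed: on an empty set every lower bound holds
    -- trivially.
    refine h fun χ _ hχ => ?_
    have : χ = 0 := L2.ext fun x => hχ x fun hx => by simpa using hcon x hx
    rw [this]
    simp [L2.ip]
  | succ n ih =>
    intro E c h
    have h1 : ∃ t, ¬ FormLE (c + 1 / 2 ^ n) X (E ∩ translateSet (F n) t) := by
      by_contra hcon
      push Not at hcon
      exact h (by simpa using hF n E _ hcon)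
    obtain ⟨t, ht⟩ := h1
    obtain ⟨s, ⟨hsE, hst⟩, hs⟩ := ih _ _ ht
    refine ⟨s, hsE, fun k hk => ?_⟩
    have h2 : (2 : ℝ) / 2 ^ (n + 1) = 1 / 2 ^ n := by
      rw [pow_succ]; field_simp
    rcases Nat.lt_succ_iff_lt_or_eq.1 hk with hk | rfl
    · convert hs k hk using 2
      rw [h2]
      ring
    · intro hcon
      refine ht (hcon.mono ?_ ?_)
      · rw [h2]
        apply le_of_eq
        ring
      · rintro x ⟨-, hx⟩
        have := hG k _ hx _ hst
        simpa [translateSet] using this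

end Form

/-! ### From local lower bounds to parametrices. -/

section Unital
variable {Γ B : Type*} [CStarAlgebra B]

/-- The projection onto the functions supported in the finite set `Y`. -/
noncomputable def finProj (Y : Finset Γ) : AdjEnd Γ B :=
  ∑ x ∈ Y, AdjEnd.theta (L2.single x 1) (L2.single x 1)

theorem AdjEnd.sum_apply {Γ D κ : Type*} [NonUnitalCStarAlgebra D] (s : Finset κ)
    (f : κ → AdjEnd Γ D) (ψ : L2 Γ D) : (∑ i ∈ s, f i).1 ψ = ∑ i ∈ s, (f i).1 ψ := by
  classical
  induction s using Finset.induction_on with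
  | empty => simp
  | insert a s ha ih => simp [Finset.sum_insert ha, ih]

theorem theta_single_apply (x : Γ) (ψ : L2 Γ B) :
    (AdjEnd.theta (L2.single x 1) (L2.single x 1)).1 ψ = L2.single x (ψ x) := by
  ext y
  rw [AdjEnd.theta_apply, L2.rsmul_apply, L2.ip_single_left, star_one, one_mul]
  by_cases hy : y = x
  · subst hy; simp
  · simp [L2.single_apply_of_ne hy]

theorem finProj_apply (Y : Finset Γ) (ψ : L2 Γ B) :
    (finProj Y).1 ψ = L2.trunc Y fun x => ψ x := by
  rw [finProj, AdjEnd.sum_apply, L2.trunc]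
  exact Finset.sum_congr rfl fun x _ => theta_single_apply x ψ

theorem finProj_apply_of_support {Y : Finset Γ} {ψ : L2 Γ B} (h : ∀ x ∉ Y, ψ x = 0) :
    (finProj Y).1 ψ = ψ := by
  ext x
  rw [finProj_apply, L2.trunc_apply]
  by_cases hx : x ∈ Y
  · rw [Set.indicator_of_mem (by simpa using hx)]
  · rw [Set.indicator_of_notMem (by simpa using hx), h x hx]

theorem star_finProj (Y : Finset Γ) : star (finProj Y : AdjEnd Γ B) = finProj Y := by
  rw [finProj, star_sum]
  exact Finset.sum_congr rfl fun x _ => AdjEnd.star_theta _ _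

theorem finProj_mul_self (Y : Finset Γ) : (finProj Y * finProj Y : AdjEnd Γ B) = finProj Y := by
  ext1 ψ
  rw [AdjEnd.mul_apply]
  refine finProj_apply_of_support fun x hx => ?_
  rw [finProj_apply, L2.trunc_apply, Set.indicator_of_notMem (by simpa using hx)]

theorem finProj_mem_compactIdeal (Y : Finset Γ) : finProj Y ∈ compactIdeal Γ B :=
  sum_mem fun _ _ => subset_closure (Submodule.subset_span ⟨_, _, rfl⟩)

variable [PartialOrder B] [StarOrderedRing B]

/-- A lower bound for `a⋆ a` off a finite set yields a left inverse of `a` modulo compacts. -/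
theorem exists_left_inverse_of_formLE {a : AdjEnd Γ B} {Y : Finset Γ} {c : ℝ} (hc : 0 < c)
    (h : FormLE c (star a * a) (Y : Set Γ)ᶜ) : ∃ S, S * a - 1 ∈ compactIdeal Γ B := by
  set N := star a * a with hN
  set P : AdjEnd Γ B := finProj Y with hP
  -- Off `Y` this is the compression of `N`, and on `Y` it is replaced by `c`. The lower bound `c`
  -- then holds everywhere, and since `P` is compact, `N - N'` is compact.
  set N' := (1 - P) * N * (1 - P) + (c : ℂ) • P with hN'
  have hPs : star P = P := star_finProj Y
  have hPP : P * P = P := finProj_mul_self Y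
  have hN's : star N' = N' := by
    simp only [hN', hN, star_add, star_mul, star_sub, star_one, hPs, star_star, star_smul,
      Complex.star_def, Complex.conj_ofReal, mul_assoc]
  have hform : FormLE c N' Set.univ := by
    intro χ hf _
    set φ := (1 - P).1 χ with hφ
    have h1 : ∀ x ∉ (Y : Set Γ)ᶜ, φ x = 0 := by
      intro x hx
      rw [hφ, AdjEnd.sub_apply, AdjEnd.one_apply, L2.sub_apply, hP, finProj_apply, L2.trunc_apply,
        Set.indicator_of_mem (by simpa using hx), sub_self]
    have h2 : (Function.support fun x => φ x).Finite := by
      refine hf.subset fun x hx h0 => hx ?_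
      dsimp only at h0 ⊢
      rw [hφ, AdjEnd.sub_apply, AdjEnd.one_apply, L2.sub_apply, hP, finProj_apply, L2.trunc_apply]
      by_cases hx : x ∈ (Y : Set Γ)
      · rw [Set.indicator_of_mem hx, sub_self]
      · rw [Set.indicator_of_notMem hx, h0, sub_zero]
    have h3 := h φ h2 h1
    have hs : star (1 - P) = 1 - P := by rw [star_sub, star_one, hPs]
    have h4 : L2.ip χ (N'.1 χ) = L2.ip φ (N.1 φ) + c • L2.ip χ (P.1 χ) := by
      rw [hN', AdjEnd.add_apply, L2.ip_add_right, AdjEnd.smul_apply, L2.ip_real_smul_right,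
        AdjEnd.mul_apply, AdjEnd.mul_apply, ← hs, ← AdjEnd.ip_apply_left, hs]
    have h5 : L2.ip χ χ = L2.ip φ φ + L2.ip χ (P.1 χ) := by
      rw [hφ, AdjEnd.ip_apply_left, hs, ← AdjEnd.mul_apply, ← L2.ip_add_right, ← AdjEnd.add_apply]
      have : (1 - P) * (1 - P) + P = 1 := by
        rw [mul_sub, sub_mul, sub_mul, hPP]; simp
      rw [this, AdjEnd.one_apply]
    rw [h4, h5, smul_add]
    exact add_le_add_left h3 _
  -- Cauchy–Schwarz turns the form bound into a norm bound on finitely supported functions, which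
  -- are dense.
  have hbound : ∀ ψ, c * ‖ψ‖ ≤ ‖N'.1 ψ‖ := by
    have hfin : ∀ χ : L2 Γ B, (Function.support fun x => χ x).Finite → c * ‖χ‖ ≤ ‖N'.1 χ‖ := by
      intro χ hf
      have h1 := CStarAlgebra.norm_le_norm_of_nonneg_of_le
        (smul_nonneg hc.le (L2.ip_self_nonneg χ)) (hform χ hf fun x hx => absurd trivial hx)
      rw [norm_smul, Real.norm_of_nonneg hc.le, ← L2.norm_sq] at h1
      have h2 := h1.trans (L2.norm_ip_le _ _)
      rcases (norm_nonneg χ).eq_or_lt with h0 | h0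
      · rw [← h0, mul_zero]; exact norm_nonneg _
      · nlinarith
    intro ψ
    have h1 := L2.tendsto_trunc_self ψ
    refine le_of_tendsto_of_tendsto' (h1.norm.const_mul c)
      ((N'.1.continuous.tendsto ψ).comp h1).norm
      fun t => hfin _ ?_
    refine t.finite_toSet.subset fun x hx => ?_
    by_contra hxt
    exact hx ((L2.trunc_apply _ _ x).trans (Set.indicator_of_notMem hxt _))
  obtain ⟨v, hv⟩ := AdjEnd.isUnit_of_bounded_below hc hc hbound (by rw [hN's]; exact hbound)
  refine ⟨↑v⁻¹ * star a, ?_⟩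
  have hPK : P ∈ compactIdeal Γ B := finProj_mem_compactIdeal Y
  have hd : N - N' ∈ compactIdeal Γ B := by
    have : N - N' = N * P + P * N - P * N * P - (c : ℂ) • P := by
      rw [hN']; noncomm_ring
    rw [this]
    refine sub_mem (sub_mem (add_mem (Ideal.mul_mem_left _ _ hPK) (Ideal.mul_mem_right _ _ hPK))
      (Ideal.mul_mem_left _ _ hPK)) ?_
    rw [← smul_one_mul]
    exact Ideal.mul_mem_left _ _ hPK
  have : ↑v⁻¹ * star a * a - 1 = ↑v⁻¹ * (N - N') := by
    rw [mul_sub, ← hv, Units.inv_mul, hN, mul_assoc]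
  rw [this]
  exact Ideal.mul_mem_left _ _ hd

variable [CommGroup Γ] {β : Γ →* (B ≃⋆ₐ[ℂ] B)}

/-- Strong convergence becomes norm convergence after multiplication by the projection onto
functions supported in the finite set `F`, a finite sum of rank-one operators. -/
theorem AdjEnd.TranslatesTo.eventually_formLE {l : Filter Γ} {X S : AdjEnd Γ B}
    (h : AdjEnd.TranslatesTo β l (ContinuousLinearMap.id ℂ (L2 Γ B)) X S) (hX : IsSelfAdjoint X)
    (hS : IsSelfAdjoint S) {c ε : ℝ} (hε : 0 < ε) {F : Finset Γ} (hF : FormLE c S F) :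
    ∀ᶠ s in l, FormLE (c - ε) (AdjEnd.conj β s X) F := by
  have h1 : Tendsto (fun s => ‖(S - AdjEnd.conj β s X) * finProj F‖) l (𝓝 0) := by
    have h2 : ∀ x ∈ F, Tendsto (fun s => ‖(S.1 (L2.single x 1) -
        (AdjEnd.conj β s X).1 (L2.single x 1))‖ * ‖L2.single x (1 : B)‖) l (𝓝 0) := by
      intro x _
      have h3 := (tendsto_iff_norm_sub_tendsto_zero.1 (h.apply (L2.single x 1)))
      simp only [norm_sub_rev] at h3
      simpa using h3.mul_const ‖L2.single x (1 : B)‖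
    have h4 := tendsto_finsetSum F h2
    rw [Finset.sum_const_zero] at h4
    refine squeeze_zero (fun _ => norm_nonneg _) (fun s => ?_) h4
    rw [finProj, Finset.mul_sum]
    refine (norm_sum_le _ _).trans (Finset.sum_le_sum fun x _ => ?_)
    rw [AdjEnd.mul_theta]
    exact AdjEnd.norm_theta_le _ _
  filter_upwards [h1.eventually (gt_mem_nhds hε)] with s hs
  refine hF.of_norm_sub_le hS ?_ (fun χ hχ => finProj_apply_of_support hχ) hs.le
  rw [IsSelfAdjoint, ← AdjEnd.conj_star, hX.star_eq]

open Classical in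
/-- A lower bound for all limits at infinity gives one off a finite set. -/
theorem exists_formLE_compl {X : AdjEnd Γ B} (hX : IsSelfAdjoint X)
    (hb : X ∈ (banded Γ B).topologicalClosure)
    (hlim : ∀ u : Ultrafilter Γ, (u : Filter Γ) ≤ cofinite → ∃ (S : AdjEnd Γ B) (c : ℝ), 0 < c ∧
      IsSelfAdjoint S ∧ FormLE c S Set.univ ∧
      AdjEnd.TranslatesTo β u (ContinuousLinearMap.id ℂ (L2 Γ B)) X S) :
    ∃ (Y : Finset Γ) (c : ℝ), 0 < c ∧ FormLE c X (Y : Set Γ)ᶜ := by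
  by_contra hcon
  push Not at hcon
  choose F hF using fun n : ℕ => exists_localisation hX hb (ε := 1 / 2 ^ n) (by positivity)
  let G : ℕ → Finset Γ := fun n => (F n ×ˢ F n).image fun p => p.1 * p.2⁻¹
  have hG : ∀ n, ∀ x ∈ F n, ∀ y ∈ F n, x * y⁻¹ ∈ G n := fun n x hx y hy =>
    Finset.mem_image.2 ⟨(x, y), Finset.mem_product.2 ⟨hx, hy⟩, rfl⟩
  have hs : ∀ p : Finset Γ × ℕ, ∃ s ∉ p.1, ∀ k < p.2,
      ¬ FormLE (3 / 2 ^ k) X (translateSet (G k) s) := by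
    rintro ⟨Y, n⟩
    -- Starting from the failing bound `1/2ⁿ` off `Y`, the threshold at scale `k` is `2/2ᵏ - 1/2ⁿ`,
    -- below `3/2ᵏ`.
    obtain ⟨s, hsY, hs⟩ := exists_nested hF hG n _ _ (hcon Y (1 / 2 ^ n) (by positivity))
    refine ⟨s, by simpa using hsY, fun k hk h => hs k hk (h.mono ?_ subset_rfl)⟩
    have h1 : (0 : ℝ) < 1 / 2 ^ n := by positivity
    have h2 : (0 : ℝ) < 1 / 2 ^ k := by positivity
    have h3 : (2 : ℝ) / 2 ^ k = 2 * (1 / 2 ^ k) := by ring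
    have h4 : (2 : ℝ) / 2 ^ n = 2 * (1 / 2 ^ n) := by ring
    have h5 : (3 : ℝ) / 2 ^ k = 3 * (1 / 2 ^ k) := by ring
    rw [h3, h4, h5]
    linarith
  choose s hsY hs using hs
  -- Along `u` the points leave every finite set `Y`, and for each fixed `k` the bound `3/2ᵏ` fails
  -- eventually on `G k` translated by the point.
  let u : Ultrafilter Γ := Ultrafilter.of (map s atTop)
  have hu : (u : Filter Γ) ≤ map s atTop := Ultrafilter.of_le _
  have hucof : (u : Filter Γ) ≤ cofinite := by
    refine hu.trans (le_cofinite_iff_compl_singleton_mem.2 fun x => ?_)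
    rw [mem_map]
    filter_upwards [eventually_ge_atTop (({x}, 0) : Finset Γ × ℕ)] with p hp
    intro hx
    refine hsY p (hp.1 ?_)
    rw [Set.mem_singleton_iff.1 hx]
    exact Finset.mem_singleton_self x
  obtain ⟨S, c, hc, hSs, hSc, hXS⟩ := hlim u hucof
  -- The scale is chosen after the limit operator and its own constant `c`, so no uniformity over
  -- limits is needed.
  obtain ⟨k, hk⟩ : ∃ k : ℕ, (3 : ℝ) / 2 ^ k < c / 2 := by
    obtain ⟨k, hk⟩ := exists_pow_lt_of_lt_one (show 0 < c / 6 by positivity)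
      (show (1 / 2 : ℝ) < 1 by norm_num)
    refine ⟨k, ?_⟩
    rw [div_pow, one_pow] at hk
    have : (3 : ℝ) / 2 ^ k = 3 * (1 / 2 ^ k) := by ring
    rw [this]
    linarith
  have h1 := hXS.eventually_formLE hX hSs (half_pos hc)
    (hSc.mono le_rfl (Set.subset_univ (G k : Set Γ)))
  have h2 : ∀ᶠ s in (u : Filter Γ), ¬ FormLE (3 / 2 ^ k) X (translateSet (G k) s) := by
    refine hu (mem_map.2 ?_)
    filter_upwards [eventually_ge_atTop ((∅, k + 1) : Finset Γ × ℕ)] with p hp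
    exact hs p k hp.2
  obtain ⟨t, ht1, ht2⟩ := (h1.and h2).exists
  refine ht2 (ht1.of_conj.mono ?_ subset_rfl)
  linarith

end Unital

/-! ### Lower bounds for limits from invertibility in the bulk. -/

section LowerBound
variable {Γ B X : Type*} [CStarAlgebra B] [TopologicalSpace X]

theorem AdjEnd.norm_sq_smul_sub_one_nonneg {D : Type*} [NonUnitalCStarAlgebra D]
    {R Q : AdjEnd Γ D} (h : Q * R = 1) : 0 ≤ ‖Q‖ ^ 2 • (star R * R) - 1 := by
  have h1 := CStarAlgebra.star_left_conjugate_le_norm_smul (a := R)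
    (IsSelfAdjoint.star_mul_self Q)
  have h2 : star R * (star Q * Q) * R = 1 := by
    rw [mul_assoc, mul_assoc, h, mul_one, ← star_mul, h, star_one]
  rw [h2, CStarRing.norm_star_mul_self, ← sq] at h1
  exact sub_nonneg.2 h1

/-- Form bounds are tested only on finitely supported functions, and these lift value by value, with
no summability to check. -/
theorem L2.exists_evalAt_eq {ξ : X} (hs : ∀ b : B, ∃ f : C₀(X, B), f ξ = b) {χ : L2 Γ B}
    (hχ : (Function.support fun x => χ x).Finite) : ∃ ψ : L2 Γ C₀(X, B), L2.evalAt ξ ψ = χ := by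
  choose f hf using hs
  refine ⟨L2.trunc hχ.toFinset fun x => f (χ x), L2.ext fun x => ?_⟩
  rw [L2.evalAt_apply, L2.trunc_apply]
  by_cases hx : χ x = 0
  · rw [Set.indicator_of_notMem (by simpa using hx), hx]
    rfl
  · rw [Set.indicator_of_mem (by simpa using hx), hf]

variable [PartialOrder B] [StarOrderedRing B]

/-- If evaluation at `ξ` intertwines the invertible operator `R` with `S`, then `S⋆ S` has a
positive lower bound. -/
theorem exists_formLE_of_evalAt {R : AdjEnd Γ C₀(X, B)} (hR : IsUnit R) {ξ : X}
    (hs : ∀ b : B, ∃ f : C₀(X, B), f ξ = b) {S : AdjEnd Γ B}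
    (h : ∀ ψ, L2.evalAt ξ (R.1 ψ) = S.1 (L2.evalAt ξ ψ)) :
    ∃ c : ℝ, 0 < c ∧ FormLE c (star S * S) Set.univ := by
  obtain ⟨v, rfl⟩ := hR
  set C := ‖(↑v⁻¹ : AdjEnd Γ C₀(X, B))‖ ^ 2 with hC
  -- Writing `C R⋆R - 1` as `Z⋆Z`, where `C` is the squared norm of the inverse, expresses the bound
  -- through `(Zψ|Zψ)`. Evaluation at `ξ` turns this into an inner product of a vector of `ℓ²(Γ, B)`
  -- with itself, which is positive in `B`.
  obtain ⟨Z, hZ⟩ := CStarAlgebra.nonneg_iff_eq_star_mul_self.1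
    (AdjEnd.norm_sq_smul_sub_one_nonneg v.inv_mul)
  refine ⟨(C + 1)⁻¹, by positivity, fun χ hχ _ => ?_⟩
  obtain ⟨ψ, rfl⟩ := L2.exists_evalAt_eq hs hχ
  have h2 : L2.ip (Z.1 ψ) (Z.1 ψ) = C • L2.ip (v.1.1 ψ) (v.1.1 ψ) - L2.ip ψ ψ := by
    have h3 : L2.ip (Z.1 ψ) (Z.1 ψ) + L2.ip ψ ψ = C • L2.ip (v.1.1 ψ) (v.1.1 ψ) := by
      rw [← AdjEnd.ip_star_mul_self, ← AdjEnd.ip_star_mul_self, ← hZ, ← L2.ip_add_right,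
        ← L2.ip_real_smul_right, ← AdjEnd.smul_apply, Complex.coe_smul, AdjEnd.sub_apply,
        AdjEnd.one_apply, sub_add_cancel]
    rw [← h3, add_sub_cancel_right]
  have h4 : 0 ≤ C • L2.ip (S.1 (L2.evalAt ξ ψ)) (S.1 (L2.evalAt ξ ψ)) -
      L2.ip (L2.evalAt ξ ψ) (L2.evalAt ξ ψ) := by
    rw [← h, L2.ip_evalAt, L2.ip_evalAt]
    have := congrArg (fun f : C₀(X, B) => f ξ) h2
    have h5 : (L2.ip (Z.1 ψ) (Z.1 ψ)) ξ = C • (L2.ip (v.1.1 ψ) (v.1.1 ψ)) ξ - (L2.ip ψ ψ) ξ := this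
    rw [← h5, ← L2.ip_evalAt]
    exact L2.ip_self_nonneg _
  have h6 := L2.ip_self_nonneg (S.1 (L2.evalAt ξ ψ))
  rw [AdjEnd.ip_star_mul_self, inv_smul_le_iff_of_pos (by positivity), add_smul, one_smul]
  exact (sub_nonneg.1 h4).trans (le_add_of_nonneg_right h6)

end LowerBound

/-! ### Limits along ultrafilters and the converse inclusion. -/

theorem Ultrafilter.le_comap_cocompact {Γ Ω : Type*} [TopologicalSpace Ω] {ι : Γ → Ω}
    {u : Ultrafilter Γ}
    (h : ∀ ξ, ¬ (u : Filter Γ) ≤ comap ι (𝓝 ξ)) : (u : Filter Γ) ≤ comap ι (cocompact Ω) := by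
  rw [← map_le_iff_le_comap, ← Ultrafilter.coe_map]
  intro t ht
  obtain ⟨K, hK, hKt⟩ := mem_cocompact.1 ht
  refine mem_of_superset ?_ hKt
  rw [Ultrafilter.mem_coe, Ultrafilter.compl_mem_iff_notMem]
  intro hKu
  obtain ⟨ξ, -, hξ⟩ := hK.ultrafilter_le_nhds _ (le_principal_iff.2 hKu)
  exact h ξ (map_le_iff_le_comap.1 hξ)

section Limits
variable {Γ B Ω J : Type*} [CommGroup Γ] [CStarAlgebra B] [TopologicalSpace Ω] [MulAction Γ Ω]
  {β : Γ →* (B ≃⋆ₐ[ℂ] B)} {A : NonUnitalStarSubalgebra ℂ (lp (fun _ : Γ => B) ∞)} {ι : Γ → Ω}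
  {ω : J → Ω}

theorem exists_c0_apply_eq [LocallyCompactSpace Ω] [T2Space Ω] (ξ : Ω) (b : B) :
    ∃ F : C₀(Ω, B), F ξ = b := by
  obtain ⟨f, h1, -, hf, -⟩ := exists_continuous_one_zero_of_isCompact (isCompact_singleton (x := ξ))
    isClosed_empty (Set.disjoint_empty _)
  have hc : Continuous fun x => f x • b := by fun_prop
  have hs : HasCompactSupport fun x => f x • b := hf.smul_right
  refine ⟨⟨⟨_, hc⟩, hs.is_zero_at_infty⟩, ?_⟩
  change f ξ • b = b
  rw [h1 rfl, Pi.one_apply, one_smul]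

/-- Points of `Γ` are isolated in `Ω`, so convergence to one of them would force the filter to stay
at that point. -/
theorem IsModelSpace.notMem_range_of_le [T2Space Ω] (hΩ : IsModelSpace A ι) {u : Filter Γ}
    [u.NeBot] (hu : u ≤ cofinite) {ξ : Ω} (hξ : u ≤ comap ι (𝓝 ξ)) : ξ ∉ Set.range ι := by
  rintro ⟨x, rfl⟩
  have h1 : ∀ᶠ y in u, ι y = ι x :=
    hξ (preimage_mem_comap ((hΩ.isOpen_singleton x).mem_nhds rfl))
  have h2 : ∀ᶠ y in u, y ≠ x := hu (Set.finite_singleton x).compl_mem_cofinite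
  obtain ⟨y, hy, hyx⟩ := (h1.and h2).exists
  exact hyx (hΩ.injective hy)

variable [ContinuousConstSMul Γ Ω]

/-- The restriction of functions to a quasi-orbit attains all values. -/
theorem exists_restrictQuasiOrbit_apply_eq [LocallyCompactSpace Ω] [T2Space Ω] {ω : Ω}
    (ξ : quasiOrbit Γ ω) (b : B) : ∃ f : C₀(quasiOrbit Γ ω, B), f ξ = b := by
  obtain ⟨F, hF⟩ := exists_c0_apply_eq (ξ : Ω) b
  exact ⟨restrictQuasiOrbit ω F, hF⟩

theorem IsModelSpace.one_notMem_of_tendsto_cocompact [Nontrivial B] (hΩ : IsModelSpace A ι)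
    {u : Filter Γ} [u.NeBot] (hu : u ≤ comap ι (cocompact Ω)) : 1 ∉ A := by
  intro h1
  obtain ⟨F, hF⟩ := (hΩ.mem_iff 1).1 h1
  have h2 := (hΩ.tendsto_translate_cocompact F 1).mono_left hu
  rw [hF] at h2
  have h3 : Tendsto (fun _ : Γ => (1 : B)) u (𝓝 0) := h2
  exact one_ne_zero (tendsto_nhds_unique h3 tendsto_const_nhds).symm

variable [PartialOrder B] [StarOrderedRing B] [Nontrivial B] [LocallyCompactSpace Ω] [T2Space Ω]
  {T : AdjEnd Γ B} {R : ∀ j, AdjEnd Γ C₀(quasiOrbit Γ (ω j), B)} {μ : ℂ}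

/-- If the ultrafilter converges in `Ω`, its limit lies in some `Ξ_j`, and invertibility of `μ - R
j` bounds the limit operator below. If it does not, it leaves all compact sets and the limit
operator is the scalar `μ`, which is nonzero because a unit in `A` excludes this case. -/
theorem exists_translatesTo_formLE (hΩ : IsModelSpace A ι)
    (hcover : (Set.range ι)ᶜ ⊆ ⋃ j, (quasiOrbit Γ (ω j) : Set Ω))
    (hT : T ∈ interfaceAlgebra β A)
    (hTR : ∀ j (ξ : quasiOrbit Γ (ω j)),
      AdjEnd.TranslatesTo β (comap ι (𝓝 (ξ : Ω))) (L2.evalAt ξ) T (R j))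
    (hμ : ∀ j, IsUnit (μ • 1 - R j)) (h0 : 1 ∈ A ∨ μ ≠ 0) {u : Ultrafilter Γ}
    (hu : (u : Filter Γ) ≤ cofinite) :
    ∃ (S : AdjEnd Γ B) (c : ℝ), 0 < c ∧ FormLE c (star S * S) Set.univ ∧
      AdjEnd.TranslatesTo β u (ContinuousLinearMap.id ℂ (L2 Γ B)) (μ • 1 - T) S := by
  by_cases h : ∃ ξ, (u : Filter Γ) ≤ comap ι (𝓝 ξ)
  · obtain ⟨ξ, hξ⟩ := h
    obtain ⟨j, hj⟩ := Set.mem_iUnion.1 (hcover (hΩ.notMem_range_of_le hu hξ))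
    have hlim : ∀ f ∈ A, ∃ φ : lp (fun _ : Γ => B) ∞,
        ∀ x, Tendsto (fun s => f (x * s)) u (𝓝 (φ x)) := by
      intro f hf
      obtain ⟨F, rfl⟩ := (hΩ.mem_iff f).1 hf
      exact ⟨_, fun x => (hΩ.tendsto_translate F ξ x).mono_left hξ⟩
    obtain ⟨S, hS⟩ := exists_translatesTo (β := β) hlim hT
    have hS' := hS.smul_one_sub μ
    obtain ⟨c, hc, hcS⟩ := exists_formLE_of_evalAt (hμ j) (ξ := ⟨ξ, hj⟩)
      (exists_restrictQuasiOrbit_apply_eq _) (S := μ • 1 - S) fun ψ =>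
        -- Evaluation at `ξ` intertwines `μ - R j` with `μ - S` because both sides are limits of the
        -- same translates.
        tendsto_nhds_unique (((hTR j ⟨ξ, hj⟩).mono hξ).smul_one_sub μ |>.apply ψ) (hS'.apply _)
    exact ⟨_, c, hc, hcS, hS'⟩
  · push Not at h
    have hle := Ultrafilter.le_comap_cocompact h
    have hμ0 : μ ≠ 0 := h0.resolve_left (hΩ.one_notMem_of_tendsto_cocompact hle)
    have hz := translatesTo_zero (β := β) (l := u) (A := A) (fun f hf x => by
      obtain ⟨F, rfl⟩ := (hΩ.mem_iff f).1 hf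
      exact (hΩ.tendsto_translate_cocompact F x).mono_left hle) hT
    refine ⟨_, ‖μ‖ ^ 2, by positivity, fun χ _ _ => ?_, hz.smul_one_sub μ⟩
    rw [AdjEnd.ip_star_mul_self, sub_zero, AdjEnd.smul_apply, AdjEnd.one_apply, L2.ip_smul_left,
      L2.ip_smul_right, smul_smul, Complex.star_def, Complex.conj_mul', ← Complex.ofReal_pow,
      Complex.coe_smul]

theorem exists_left_inverse_mod_compact [Countable Γ] (hΩ : IsModelSpace A ι)
    (hcover : (Set.range ι)ᶜ ⊆ ⋃ j, (quasiOrbit Γ (ω j) : Set Ω))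
    (hT : T ∈ interfaceAlgebra β A)
    (hTR : ∀ j (ξ : quasiOrbit Γ (ω j)),
      AdjEnd.TranslatesTo β (comap ι (𝓝 (ξ : Ω))) (L2.evalAt ξ) T (R j))
    (hμ : ∀ j, IsUnit (μ • 1 - R j)) (h0 : 1 ∈ A ∨ μ ≠ 0) :
    ∃ S, S * (μ • 1 - T) - 1 ∈ compactIdeal Γ B := by
  have hb : μ • 1 - T ∈ (banded Γ B).topologicalClosure :=
    sub_mem (SMulMemClass.smul_mem _
      (NonUnitalStarSubalgebra.le_topologicalClosure _ one_mem_banded))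
      (generatedBy_le_banded β _ hT)
  obtain ⟨Y, c, hc, h⟩ := exists_formLE_compl (β := β) (IsSelfAdjoint.star_mul_self (μ • 1 - T))
    (mul_mem (star_mem hb) hb) fun u hu => by
      obtain ⟨S, c, hc, h, hS⟩ := exists_translatesTo_formLE hΩ hcover hT hTR hμ h0 hu
      exact ⟨_, c, hc, IsSelfAdjoint.star_mul_self S, h, hS.star.mul hS⟩
  exact exists_left_inverse_of_formLE hc h

end Limits

theorem star_smul_one_sub {E : Type*} [Ring E] [StarRing E] [Module ℂ E] [StarModule ℂ E] (μ : ℂ)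
    (a : E) : star (μ • 1 - a) = star μ • 1 - star a := by
  rw [star_sub, star_smul, star_one]

theorem notMem_essentialSpectrum_of_isUnit {Γ B Ω J : Type*} [CommGroup Γ] [Countable Γ]
    [CStarAlgebra B]
    [TopologicalSpace Ω] [MulAction Γ Ω] [ContinuousConstSMul Γ Ω] {β : Γ →* (B ≃⋆ₐ[ℂ] B)}
    {A : NonUnitalStarSubalgebra ℂ (lp (fun _ : Γ => B) ∞)} {ι : Γ → Ω} {ω : J → Ω}
    [Nontrivial B] [LocallyCompactSpace Ω] [T2Space Ω]
    {T : AdjEnd Γ B} {R : ∀ j, AdjEnd Γ C₀(quasiOrbit Γ (ω j), B)} {μ : ℂ}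
    (hΩ : IsModelSpace A ι) (hcover : (Set.range ι)ᶜ ⊆ ⋃ j, (quasiOrbit Γ (ω j) : Set Ω))
    (hT : T ∈ interfaceAlgebra β A)
    (hTR : ∀ j (ξ : quasiOrbit Γ (ω j)),
      AdjEnd.TranslatesTo β (comap ι (𝓝 (ξ : Ω))) (L2.evalAt ξ) T (R j))
    (hμ : ∀ j, IsUnit (μ • 1 - R j)) (h0 : 1 ∈ A ∨ μ ≠ 0) : μ ∉ essentialSpectrum T := by
  let _ := CStarAlgebra.spectralOrder B
  let _ := CStarAlgebra.spectralOrderedRing B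
  rw [notMem_essentialSpectrum_iff]
  refine ⟨?_, exists_left_inverse_mod_compact hΩ hcover hT hTR hμ h0⟩
  obtain ⟨S, hS⟩ := exists_left_inverse_mod_compact (μ := star μ) hΩ hcover (star_mem hT)
    (fun j ξ => (hTR j ξ).star) (fun j => by rw [← star_smul_one_sub]; exact (hμ j).star)
    (h0.imp_right star_ne_zero.2)
  refine ⟨star S, ?_⟩
  have := star_mem_compactIdeal hS
  rwa [star_sub, star_mul, star_one, ← star_smul_one_sub, star_star] at this

/-- The extension of `1 ∈ A` to `Ω` is constant by density, so it restricts to the unit on every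
quasi-orbit. -/
theorem one_mem_bulkAlgebra {Γ B Ω : Type*} [CommGroup Γ] [CStarAlgebra B] [Nontrivial B]
    [TopologicalSpace Ω] [MulAction Γ Ω] [ContinuousConstSMul Γ Ω] {β : Γ →* (B ≃⋆ₐ[ℂ] B)}
    {A : NonUnitalStarSubalgebra ℂ (lp (fun _ : Γ => B) ∞)} {ι : Γ → Ω}
    (hΩ : IsModelSpace A ι) (h1 : 1 ∈ A) (ω : Ω) :
    (1 : AdjEnd Γ C₀(quasiOrbit Γ ω, B)) ∈ bulkAlgebra β ω := by
  obtain ⟨F, hF⟩ := (hΩ.mem_iff 1).1 h1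
  have hF1 : ∀ ξ, F ξ = 1 := by
    have := hΩ.denseRange.equalizer F.continuous continuous_const
      (funext fun x => congrArg (fun f : lp (fun _ : Γ => B) ∞ => f x) hF)
    exact congrFun this
  have he : monomialOp (c0Action (quasiOrbit Γ ω) β) 1
      (constFun Γ (restrictQuasiOrbit ω F)) = 1 := by
    ext1 ψ
    ext x ξ
    rw [AdjEnd.monomialOp_apply, AdjEnd.one_apply, inv_one, one_mul]
    change β x⁻¹ (F _) * ψ x ξ = ψ x ξ
    rw [hF1, map_one, one_mul]
  exact he ▸ monomialOp_mem_generatedBy _ 1 (Set.mem_range_self _)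

end Interface

/-! ### The main theorem. -/

theorem mainTheorem2 {Γ B Ω J : Type*} [CommGroup Γ] [Countable Γ] [CStarAlgebra B] [Nontrivial B]
    (β : Γ →* (B ≃⋆ₐ[ℂ] B))
    (A : NonUnitalStarSubalgebra ℂ (lp (fun _ : Γ => B) ∞))
    (hA : Interface.IsInterfaceAlgebra β A)
    [TopologicalSpace Ω] [LocallyCompactSpace Ω] [T2Space Ω] [MulAction Γ Ω]
    [ContinuousConstSMul Γ Ω] (ι : Γ → Ω) (hΩ : Interface.IsModelSpace A ι)
    (hne : (Set.range ι)ᶜ.Nonempty)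
    (ω : J → Ω) (hcover : (Set.range ι)ᶜ = ⋃ j, (Interface.quasiOrbit Γ (ω j) : Set Ω)) :
    (∀ j, ∃! q : Interface.interfaceAlgebra β A →⋆ₙₐ[ℂ] Interface.bulkAlgebra β (ω j),
      Interface.IsBulkQuotient β A ι (ω j) q) ∧
    ∀ q : ∀ j, Interface.interfaceAlgebra β A →⋆ₙₐ[ℂ] Interface.bulkAlgebra β (ω j),
      (∀ j, Interface.IsBulkQuotient β A ι (ω j) (q j)) →
      ∀ T : Interface.interfaceAlgebra β A,
        (1 ∈ A → Interface.essentialSpectrum (T : Interface.AdjEnd Γ B) =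
          closure (⋃ j, Interface.unitalSpectrum (q j T))) ∧
        (1 ∉ A → Interface.essentialSpectrum (T : Interface.AdjEnd Γ B) =
          closure (⋃ j, spectrum ℂ (q j T : Unitization ℂ (Interface.bulkAlgebra β (ω j))))) := by
  constructor
  · intro j
    obtain ⟨q, hq, -⟩ := Interface.exists_isBulkQuotient (β := β) hΩ (ω j)
    exact ⟨q, hq, fun q' hq' => hq'.unique hΩ hq⟩
  intro q hq T
  have hTR : ∀ j (ξ : Interface.quasiOrbit Γ (ω j)), Interface.AdjEnd.TranslatesTo β
      (comap ι (𝓝 (ξ : Ω))) (Interface.L2.evalAt ξ) (T : Interface.AdjEnd Γ B) (q j T).1 := by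
    intro j
    obtain ⟨q', hq', h⟩ := Interface.exists_isBulkQuotient (β := β) hΩ (ω j)
    -- By uniqueness an arbitrary admissible `q j` is the constructed one and inherits its
    -- description by limits of translates.
    rw [(hq j).unique hΩ hq']
    exact h T
  have hunit : ∀ (j) {μ : ℂ}, μ ∉ Interface.essentialSpectrum (T : Interface.AdjEnd Γ B) →
      IsUnit (μ • 1 - (q j T).1) := fun j _ hμ =>
    Interface.isUnit_of_notMem_essentialSpectrum hΩ
      (hcover ▸ Set.subset_iUnion (fun j => (Interface.quasiOrbit Γ (ω j) : Set Ω)) j) (hTR j) hμ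
  have hess := Interface.isClosed_essentialSpectrum (T : Interface.AdjEnd Γ B)
  have hM : ∀ j, IsClosed (Interface.bulkAlgebra β (ω j) : Set (Interface.AdjEnd Γ
      C₀(Interface.quasiOrbit Γ (ω j), B))) := fun j => Interface.isClosed_generatedBy _ _
  constructor
  · intro h1
    have key : ∀ μ, μ ∉ Interface.essentialSpectrum (T : Interface.AdjEnd Γ B) ↔
        ∀ j, μ ∉ Interface.unitalSpectrum (q j T) := by
      intro μ
      rw [forall_congr' fun j => Interface.notMem_unitalSpectrum_iff (hM j)
        (Interface.one_mem_bulkAlgebra hΩ h1 _) (q j T) μ]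
      exact ⟨fun hμ j => hunit j hμ, fun hμ => Interface.notMem_essentialSpectrum_of_isUnit hΩ
        hcover.subset T.2 hTR hμ (Or.inl h1)⟩
    -- Equality holds before taking the closure, which changes nothing because the essential
    -- spectrum is closed.
    have heq : Interface.essentialSpectrum (T : Interface.AdjEnd Γ B) =
        ⋃ j, Interface.unitalSpectrum (q j T) := by
      ext μ
      rw [← not_iff_not, key, Set.mem_iUnion, not_exists]
    rw [← heq, hess.closure_eq]
  · intro h1
    have heq : Interface.essentialSpectrum (T : Interface.AdjEnd Γ B) =
        ⋃ j, spectrum ℂ (q j T : Unitization ℂ (Interface.bulkAlgebra β (ω j))) := by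
      ext μ
      rcases eq_or_ne μ 0 with rfl | hμ0
      -- The value `0` lies on both sides. On the right this needs at least one index `j`, which the
      -- nonempty boundary provides.
      · obtain ⟨ξ, hξ⟩ := hne
        rw [hcover] at hξ
        obtain ⟨j, -⟩ := Set.mem_iUnion.1 hξ
        exact iff_of_true (Interface.zero_mem_essentialSpectrum hΩ h1 T.2)
          (Set.mem_iUnion.2 ⟨j, Unitization.zero_mem_spectrum_inr ℂ ℂ _⟩)
      · rw [← not_iff_not, Set.mem_iUnion, not_exists]
        rw [forall_congr' fun j =>
          Interface.notMem_spectrum_unitization_iff (hM j) (q j T) hμ0]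
        exact ⟨fun hμ j => hunit j hμ, fun hμ => Interface.notMem_essentialSpectrum_of_isUnit hΩ
          hcover.subset T.2 hTR hμ (Or.inr hμ0)⟩
    rw [← heq, hess.closure_eq]
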